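/- **Setting.** Let $T$ be a string of length $n$ over $\{1,2,\dots\}$ whose last character is the smallest character $\$=1$, which occurs nowhere else in $T$. For $1\le\delta\le n$ let $T_\delta$ be the suffix of $T$ of length $\delta$. Let $x_1,\dots,x_\delta$ be the starting positions of the suffixes of $T_\delta$ in lexicographic order, $F_\delta[i]=T_\delta[x_i]$, and $L_\delta[i]=T_\delta[x_i-1]$ with $T_\delta[0]:=\$$ (the BWT of $T_\delta$). $\mathsf{LF}_\delta(i)=j$ iff $x_i-1=x_j$, or $x_i=1$ and $x_j=\delta$. A *DBWT* $D$ of $L_\delta$ is a partition of $L_\delta$ into $k$ non-empty blocks $L_\delta[p_i..p_{i+1}-1]$, $1\le i\le k$ (*DBWT-repetitions*), each a repetition of a single character; $[\mathsf{LF}_\delta(p_i),\mathsf{LF}_\delta(p_{i+1}-1)]$ is the *$i$-th F-interval*. A DBWT-repetition is *$\alpha$-heavy* if $[p_i,p_{i+1}-1]$ contains at least $\alpha$ starting positions of F-intervals, and an F-interval is *$\alpha$-heavy* if it contains at least $\alpha$ of the positions $p_1,\dots,p_k$. $D$ is *$\alpha$-balanced* if it has no $\alpha$-heavy DBWT-repetition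 and no $\alpha$-heavy F-interval. The *LF-interval graph* $\mathsf{Grp}(D)$ has nodes $u_1,\dots,u_k$ (repetitions) and $v_1,\dots,v_k$ (F-intervals), undirected edges $(u_i,v_i)$, directed edges $E_L=\{(u_i,v_j): p_i\in[\mathsf{LF}_\delta(p_j),\mathsf{LF}_\delta(p_{j+1}-1)]\}$ with labels $p_i-\mathsf{LF}_\delta(p_j)$ and $E_F=\{(v_j,u_i):\mathsf{LF}_\delta(p_j)\in[p_i,p_{i+1}-1]\}$ with labels $\mathsf{LF}_\delta(p_j)-p_i$; $u_i$ and $v_i$ are both labelled with the character and the length of the $i$-th repetition. It is stored with: a doubly linked list of the $u_i$ in the order of $i$ and one of the $v_i$ in the order of $\mathsf{LF}_\delta(p_i)$; a pointer to the node $u_i$ labelled $(\$,1)$; arrays with exactly the nodes of the $\alpha$-heavy repetitions and of the $\alpha$-heavy F-intervals; an order maintenance structure on the $u_i$; and a B-tree on some of the $v_i$, ordered by (character of $u_i$, $i$), where each $v_i$ in the tree has a pointer to its place in it. *B-tree invariant*: the B-tree contains only nodes $v_g$ that satisfy one of these conditions: (i) $u_{g+1}$ exists, is not labelled with $\$$,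 and $u_g,u_{g+1}$ have different characters; (ii) $u_{g+1},u_{g+2}$ exist, $u_{g+1}$ is labelled with $\$$, and $u_g,u_{g+2}$ have different characters; (iii) $u_g$ is labelled with $\$$. *$\mathsf{fastUpdate}(\mathsf{Grp}(D),c)$*, used when $u_{i-1}$ or $u_{i+1}$ has character $c$, where $u_i$ is the node labelled $(\$,1)$, is the following operation. The node $v_{i'}$ labelled $(c,1)$ is to be placed right after $v_{i-1}$ if $u_{i-1}$ has character $c$, and right before $v_{i+1}$ otherwise; let $v_{\mathsf{gnext}}$ be the node that will follow it and $(v_{\mathsf{gnext}},u_x)\in E_F$. If the label $d$ of this edge is positive, $u_x$ and $v_x$ are split after $d$ characters. Then $u_i$ is relabelled $(c,1)$, the node $v_{i'}$ is placed as described, a node labelled $(\$,1)$ is inserted into $U$ between the two parts of $u_x$ (before $u_x$ if $d=0$; at the end if $v_{\mathsf{gnext}}$ does not exist), and its partner takes the place of $v_i$ as first node of $V$. Finally, the nodes labelled $(c,1)$ are merged with those neighbours in the list of $U$ (and their partners in $V$) that have character $c$. Edges, labels, lists, arrays and the order maintenance structure are updated accordingly. In the B-tree, elements are only overwritten in place: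 that of $v_i$ by the new $\$$-node, that of a split node by its second part, and that of the rightmost node of a merge by the merged node (if the absorbed node has no element, the element of the other node stays). Time is counted in elementary steps (reading or writing one constant-size record), and calls of the insert and delete operations of the order maintenance structure are counted separately (each of them takes $O(1)$ time in that structure). **Lemma.** There is an absolute constant $C$ such that the following holds for all integers $\alpha\ge2$, all $T$ as above and all $1\le\delta<n$. Let $c=T[n-\delta]$ be the first character of $T_{\delta+1}$, let $D$ be an $\alpha$-balanced DBWT of $L_\delta$, and suppose that $u_{i-1}$ or $u_{i+1}$ has character $c$, where $u_i$ is the node labelled $(\$,1)$. Suppose $\mathsf{Grp}(D)$ is stored as above with a B-tree (of any minimum degree $m\geq 2$) that satisfies the B-tree invariant. Then: (i) $\mathsf{fastUpdate}(\mathsf{Grp}(D),c)$ runs in $O(\alpha)$ time: it takes at most $C\alpha$ elementary steps and at most $C$ calls of the order maintenance structure; (ii) it outputs the stored LF-interval graph, with all the data structures listed above, of a $(2\alpha+1)$-balanced DBWT $D'$ of $L_{\delta+1}$ that has at most two $\alpha$-heavy DBWT-repetitions and at most two $\alpha$-heavy F-intervals; (iii) the B-tree of the output satisfies the B-tree invariant;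 moreover, if the B-tree of the input contains all nodes that satisfy one of the three conditions, then so does the B-tree of the output. -/

import Mathlib

namespace RComp

/-! ## Texts, suffixes, BWT and LF function

Characters are positive integers and `dollar = 1` is the smallest of them. All positions and
all indices are counted from `0` (position `x` here is position `x + 1` in one-based counting). -/

/-- The special end character, the smallest character of the alphabet `{1, 2, …}`. -/
def dollar : ℕ := 1

/-- `T` is a non-empty string over `{1, 2, …}` whose last character is `dollar`, and `dollar`
occurs nowhere else. -/
def IsText (T : List ℕ) : Prop :=
  ∃ w : List ℕ, T = w ++ [dollar] ∧ ∀ a ∈ w, dollar < a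

/-- The suffix of `T` of length `δ` (for `δ ≤ T.length`). -/
def suffixOfLength (T : List ℕ) (δ : ℕ) : List ℕ := T.drop (T.length - δ)

/-- The starting positions of the suffixes of `t`, sorted by the lexicographic order of the
suffixes (the order `≤` on lists is lexicographic, a proper prefix being smaller). -/
def suffixArray (t : List ℕ) : List ℕ :=
  (List.range t.length).mergeSort (fun x y => decide (t.drop x ≤ t.drop y))

/-- The position (cyclically) preceding position `x` in `t`. -/
def prevPos (t : List ℕ) (x : ℕ) : ℕ := if x = 0 then t.length - 1 else x - 1

/-- The string `F`: first characters of the sorted suffixes. -/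
def fcol (t : List ℕ) : List ℕ := (suffixArray t).map (fun x => t.getD x 0)

/-- The BWT `L`: characters preceding the sorted suffixes. -/
def bwt (t : List ℕ) : List ℕ := (suffixArray t).map (fun x => t.getD (prevPos t x) 0)

/-- The LF function: `LF(i) = j` iff the `j`-th sorted suffix starts at the position
(cyclically) preceding the start of the `i`-th sorted suffix. -/
def lf (t : List ℕ) (i : ℕ) : ℕ :=
  (suffixArray t).idxOf (prevPos t ((suffixArray t).getD i 0))

/-! ## Divided BWT -/

/-- A sequence of pairs (character, length) is a DBWT of `bwt t` if all lengths are positive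
and the repetitions it lists concatenate to `bwt t`. -/
def IsDBWT (t : List ℕ) (D : List (ℕ × ℕ)) : Prop :=
  (∀ r ∈ D, 0 < r.2) ∧ D.flatMap (fun r => List.replicate r.2 r.1) = bwt t

/-- The position `p_i` at which the `i`-th repetition starts. -/
def start (D : List (ℕ × ℕ)) (i : ℕ) : ℕ := ((D.take i).map Prod.snd).sum

/-- The `i`-th DBWT-repetition, as the interval of positions `[p_i, p_{i+1} - 1]`. -/
def uInterval (D : List (ℕ × ℕ)) (i : ℕ) : Set ℕ :=
  Set.Icc (start D i) (start D (i + 1) - 1)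

/-- The `i`-th F-interval `[LF(p_i), LF(p_{i+1} - 1)]`. -/
def fInterval (t : List ℕ) (D : List (ℕ × ℕ)) (i : ℕ) : Set ℕ :=
  Set.Icc (lf t (start D i)) (lf t (start D (i + 1) - 1))

/-- The `i`-th DBWT-repetition covers at least `α` starting positions of F-intervals. -/
def HeavyU (α : ℕ) (t : List ℕ) (D : List (ℕ × ℕ)) (i : Fin D.length) : Prop :=
  α ≤ {j : Fin D.length | lf t (start D j) ∈ uInterval D i}.ncard

/-- The `i`-th F-interval covers at least `α` starting positions of DBWT-repetitions. -/
def HeavyV (α : ℕ) (t : List ℕ) (D : List (ℕ × ℕ)) (i : Fin D.length) : Prop :=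
  α ≤ {j : Fin D.length | start D j ∈ fInterval t D i}.ncard

/-- `D` is `α`-balanced. -/
def Balanced (α : ℕ) (t : List ℕ) (D : List (ℕ × ℕ)) : Prop :=
  ∀ i : Fin D.length, ¬ HeavyU α t D i ∧ ¬ HeavyV α t D i

/-! ## The LF-interval graph as a mathematical object -/

/-- A graph with two classes `u_0, …, u_{k-1}` and `v_0, …, v_{k-1}` of nodes, undirected edges
`ELF`, directed edges `EL` (from `U` to `V`) and `EF` (from `V` to `U`), and labels. -/
structure LFGraph (k : ℕ) where
  ELF : Set (Fin k × Fin k)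
  EL : Set (Fin k × Fin k)
  EF : Set (Fin k × Fin k)
  BU : Fin k → ℕ × ℕ
  BV : Fin k → ℕ × ℕ
  BL : Fin k → Fin k → ℕ
  BF : Fin k → Fin k → ℕ

/-- The LF-interval graph of the DBWT `D` of `bwt t`. A pair in `EL` is (index of the `u`-node,
index of the `v`-node), a pair in `EF` is (index of the `v`-node, index of the `u`-node). -/
def lfGraph (t : List ℕ) (D : List (ℕ × ℕ)) : LFGraph D.length where
  ELF := {e | e.1 = e.2}
  EL := {e | start D e.1 ∈ fInterval t D e.2}
  EF := {e | lf t (start D e.1) ∈ uInterval D e.2}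
  BU i := ((bwt t).getD (start D i) 0, start D (i + 1) - start D i)
  BV i := ((fcol t).getD (lf t (start D i)) 0,
    lf t (start D (i + 1) - 1) - lf t (start D i) + 1)
  BL i j := start D i - lf t (start D j)
  BF j i := lf t (start D j) - start D i

/-- The three conditions that decide which nodes `v_g` belong into the B-tree: (i) `u_{g+1}`
exists, does not carry `dollar` and its character differs from that of `u_g`; (ii) `u_{g+1}` and
`u_{g+2}` exist, `u_{g+1}` carries `dollar` and the characters of `u_g` and `u_{g+2}` differ;
(iii) `u_g` carries `dollar`. -/
def TreeCond (D : List (ℕ × ℕ)) (g : Fin D.length) : Prop :=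
  (∃ r, D[(g : ℕ) + 1]? = some r ∧ r.1 ≠ D[g].1 ∧ r.1 ≠ dollar) ∨
  (∃ r r', D[(g : ℕ) + 1]? = some r ∧ D[(g : ℕ) + 2]? = some r' ∧ r.1 = dollar ∧ r'.1 ≠ D[g].1) ∨
  D[g].1 = dollar

/-! ## B-trees

The elements of the tree are addresses of slots; a slot holds a node of `V` and its key. -/

mutual
/-- A page of a B-tree: a leaf with its elements, or an inner page with its first child and,
after it, alternating elements and children. -/
inductive BTree : Type
  | leaf (elems : List ℕ) : BTree
  | inner (first : BTree) (rest : BForest) : BTree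
/-- A sequence of alternating elements and pages. -/
inductive BForest : Type
  | nil : BForest
  | cons (elem : ℕ) (child : BTree) (rest : BForest) : BForest
end

mutual
/-- The elements of a B-tree from left to right. -/
def BTree.inorder : BTree → List ℕ
  | .leaf es => es
  | .inner f r => f.inorder ++ r.inorder
/-- The elements of a sequence of alternating elements and pages from left to right. -/
def BForest.inorder : BForest → List ℕ
  | .nil => []
  | .cons e c r => e :: (c.inorder ++ r.inorder)
end

/-- The number of elements (equivalently, of pages) at the top of the sequence. -/
def BForest.count : BForest → ℕ
  | .nil => 0
  | .cons _ _ r => r.count + 1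

mutual
/-- A proper subtree, of height `h`, of a B-tree of minimum degree `m`: every page has between
`m - 1` and `2 m - 1` elements and all leaves have the same depth. -/
def BTree.IsSub (m : ℕ) : ℕ → BTree → Prop
  | 0, .leaf es => m ≤ es.length + 1 ∧ es.length < 2 * m
  | h + 1, .inner f r => m ≤ r.count + 1 ∧ r.count < 2 * m ∧ f.IsSub m h ∧ r.AllSub m h
  | _, _ => False
/-- All pages of the sequence satisfy `BTree.IsSub m h`. -/
def BForest.AllSub (m : ℕ) : ℕ → BForest → Prop
  | _, .nil => True
  | h, .cons _ c r => c.IsSub m h ∧ r.AllSub m h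
end

/-- B-trees of minimum degree `m`; the root may have fewer than `m - 1` elements. -/
def BTree.IsBTree (m : ℕ) : BTree → Prop
  | .leaf es => es.length < 2 * m
  | .inner f r => 1 ≤ r.count ∧ r.count < 2 * m ∧ ∃ h, f.IsSub m h ∧ r.AllSub m h

/-! ## The memory of the machine -/

/-- The record of a pair of nodes `u_x`, `v_x` joined by an undirected edge. The two nodes have the
same label `(chr, len)`. Each `u`-node is the tail of exactly one edge in `E_L` and each `v`-node is
the tail of exactly one edge in `E_F`; the record stores the heads of these two edges and their
labels. -/
structure Cell where
  chr : ℕ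
  len : ℕ
  prevU : Option ℕ
  nextU : Option ℕ
  prevV : Option ℕ
  nextV : Option ℕ
  /-- head of the edge in `E_L` that starts at `u_x` -/
  tgtL : ℕ
  labL : ℕ
  /-- head of the edge in `E_F` that starts at `v_x` -/
  tgtF : ℕ
  labF : ℕ
  /-- the B-tree slot that holds `v_x`, if `v_x` is in the B-tree -/
  slot : Option ℕ

/-- Ends of the two doubly linked lists, and the address of the node that carries `dollar`. -/
structure Regs where
  firstU : Option ℕ
  lastU : Option ℕ
  firstV : Option ℕ
  lastV : Option ℕ
  dol : ℕ

/-- The memory: records of nodes by address (addresses from `fresh` on are unused), the registers,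
the arrays of heavy nodes, the order maintenance structure (an abstract ordered list of
`u`-nodes), and the B-tree of `V` with the contents of its slots (node and character of its key). -/
structure State where
  mem : ℕ → Cell
  fresh : ℕ
  regs : Regs
  heavyU : List ℕ
  heavyV : List ℕ
  order : List ℕ
  tree : BTree
  slots : ℕ → ℕ × ℕ

/-- The nodes that the B-tree holds, in its order. -/
def State.treeNodes (S : State) : List ℕ := S.tree.inorder.map (fun s => (S.slots s).1)

/-- `first`, `last`, `prev` and `next` represent the sequence `l` as a doubly linked list. -/
def IsLinkedList (l : List ℕ) (first last : Option ℕ) (prev next : ℕ → Option ℕ) : Prop :=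
  l.Nodup ∧ first = l.head? ∧ last = l.getLast? ∧
  (∀ i (h : i < l.length), next l[i] = l[i + 1]?) ∧
  (∀ i (h : i < l.length), prev l[i] = if i = 0 then none else l[i - 1]?)

/-- The key of `v_i` precedes the key of `v_j`. -/
def KeyLT (D : List (ℕ × ℕ)) (i j : Fin D.length) : Prop :=
  D[i].1 < D[j].1 ∨ (D[i].1 = D[j].1 ∧ i < j)

/-- The memory `S` stores the LF-interval graph of the DBWT `D` of `bwt t`, the records of `u_i`
and `v_i` being at address `node i`, together with its data structures: the two linked lists, the
arrays of `α`-heavy nodes, the order maintenance structure and a B-tree (of minimum degree `m`, on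
some of the nodes of `V`). -/
structure StoresAt (α m : ℕ) (t : List ℕ) (D : List (ℕ × ℕ)) (S : State)
    (node : Fin D.length → ℕ) : Prop where
  node_inj : Function.Injective node
  node_lt : ∀ i, node i < S.fresh
  labelU : ∀ i, ((S.mem (node i)).chr, (S.mem (node i)).len) = (lfGraph t D).BU i
  labelV : ∀ i, ((S.mem (node i)).chr, (S.mem (node i)).len) = (lfGraph t D).BV i
  edgeL : ∀ i j, (i, j) ∈ (lfGraph t D).EL ↔ (S.mem (node i)).tgtL = node j
  edgeF : ∀ i j, (j, i) ∈ (lfGraph t D).EF ↔ (S.mem (node j)).tgtF = node i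
  edgeLabelL : ∀ i j, (i, j) ∈ (lfGraph t D).EL →
    (S.mem (node i)).labL = (lfGraph t D).BL i j
  edgeLabelF : ∀ i j, (j, i) ∈ (lfGraph t D).EF →
    (S.mem (node j)).labF = (lfGraph t D).BF j i
  listU : IsLinkedList (List.ofFn node) S.regs.firstU S.regs.lastU
    (fun x => (S.mem x).prevU) (fun x => (S.mem x).nextU)
  listV : ∃ π : Equiv.Perm (Fin D.length), StrictMono (fun r => lf t (start D (π r))) ∧
    IsLinkedList (List.ofFn (fun r => node (π r))) S.regs.firstV S.regs.lastV
      (fun x => (S.mem x).prevV) (fun x => (S.mem x).nextV)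
  dollarNode : ∀ i : Fin D.length, D[i].1 = dollar → S.regs.dol = node i
  heavyU_nodup : S.heavyU.Nodup
  heavyU_mem : ∀ x, x ∈ S.heavyU ↔ ∃ i, HeavyU α t D i ∧ node i = x
  heavyV_nodup : S.heavyV.Nodup
  heavyV_mem : ∀ x, x ∈ S.heavyV ↔ ∃ i, HeavyV α t D i ∧ node i = x
  order_eq : S.order = List.ofFn node
  tree_valid : S.tree.IsBTree m
  tree_slots : S.tree.inorder.Nodup
  tree_slot : ∀ i s, (S.mem (node i)).slot = some s ↔
    s ∈ S.tree.inorder ∧ (S.slots s).1 = node i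
  tree_key : ∀ s ∈ S.tree.inorder, ∃ i : Fin D.length, S.slots s = (node i, D[i].1)
  tree_sorted : S.treeNodes.Pairwise (fun x y => ∃ i j, node i = x ∧ node j = y ∧ KeyLT D i j)

/-- `S` stores the LF-interval graph of `D` and its data structures, and the B-tree contains only
nodes that satisfy one of the three conditions. -/
def Stores (α m : ℕ) (t : List ℕ) (D : List (ℕ × ℕ)) (S : State) : Prop :=
  ∃ node : Fin D.length → ℕ, StoresAt α m t D S node ∧
    ∀ i, node i ∈ S.treeNodes → TreeCond D i

/-- As `Stores`, and the B-tree contains all nodes that satisfy one of the three conditions. -/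
def StoresAll (α m : ℕ) (t : List ℕ) (D : List (ℕ × ℕ)) (S : State) : Prop :=
  ∃ node : Fin D.length → ℕ, StoresAt α m t D S node ∧
    ∀ i, node i ∈ S.treeNodes ↔ TreeCond D i

/-! ## Programs with a step count

The memory is touched only through the primitives below. Every primitive costs one step, or one
call of the order maintenance structure; the remaining work (arithmetic operations, comparisons and
list operations on local variables) is at most proportional to the number of primitives. -/

/-- Result of a run: value, memory, number of steps, number of order maintenance calls. -/
structure Outcome (β : Type) where
  val : β
  st : State
  steps : ℕ
  orderCalls : ℕ

/-- Programs that return a value of type `β`. -/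
def Prog (β : Type) : Type := State → Outcome β

instance : Monad Prog where
  pure a := fun s => ⟨a, s, 0, 0⟩
  bind p f := fun s =>
    let r := p s
    let r' := f r.val r.st
    ⟨r'.val, r'.st, r.steps + r'.steps, r.orderCalls + r'.orderCalls⟩

/-- Read the record at address `x`. -/
def read (x : ℕ) : Prog Cell := fun s => ⟨s.mem x, s, 1, 0⟩

/-- Write the record at address `x`. -/
def write (x : ℕ) (c : Cell) : Prog Unit := fun s =>
  ⟨(), { s with mem := Function.update s.mem x c }, 1, 0⟩

/-- Allocate a record. -/
def alloc (c : Cell) : Prog ℕ := fun s =>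
  ⟨s.fresh, { s with mem := Function.update s.mem s.fresh c, fresh := s.fresh + 1 }, 1, 0⟩

/-- Read the registers. -/
def readRegs : Prog Regs := fun s => ⟨s.regs, s, 1, 0⟩

/-- Write the registers. -/
def writeRegs (r : Regs) : Prog Unit := fun s => ⟨(), { s with regs := r }, 1, 0⟩

/-- Overwrite the content of the B-tree slot `a`; the shape of the tree is left alone. -/
def writeSlot (a : ℕ) (e : ℕ × ℕ) : Prog Unit := fun s =>
  ⟨(), { s with slots := Function.update s.slots a e }, 1, 0⟩

/-- Append a node to the array of heavy nodes in `U`. -/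
def pushHeavyU (x : ℕ) : Prog Unit := fun s => ⟨(), { s with heavyU := s.heavyU ++ [x] }, 1, 0⟩

/-- Append a node to the array of heavy nodes in `V`. -/
def pushHeavyV (x : ℕ) : Prog Unit := fun s => ⟨(), { s with heavyV := s.heavyV ++ [x] }, 1, 0⟩

/-- Insert `x` right after `w` in a list. -/
def insertAfter (w x : ℕ) : List ℕ → List ℕ
  | [] => []
  | a :: l => if a = w then a :: x :: l else a :: insertAfter w x l

/-- Order maintenance call: insert `x` right after `w`. -/
def orderInsert (w x : ℕ) : Prog Unit := fun s =>
  ⟨(), { s with order := insertAfter w x s.order }, 0, 1⟩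

/-- Order maintenance call: delete `x`. -/
def orderDelete (x : ℕ) : Prog Unit := fun s => ⟨(), { s with order := s.order.erase x }, 0, 1⟩

/-! ### Linked lists -/

/-- Read the record at `x`, change it and write it back. -/
def modifyCell (x : ℕ) (f : Cell → Cell) : Prog Unit := do
  let c ← read x
  write x (f c)

/-- Read, change and write back the registers. -/
def modifyRegs (f : Regs → Regs) : Prog Unit := do
  let r ← readRegs
  writeRegs (f r)

/-- Insert `x` right after `w` in the linked list of `U` and in the order maintenance structure. -/
def insertU (w x : ℕ) : Prog Unit := do
  orderInsert w x
  let cw ← read w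
  modifyCell x (fun c => { c with prevU := some w, nextU := cw.nextU })
  modifyCell w (fun c => { c with nextU := some x })
  match cw.nextU with
  | some z => modifyCell z (fun c => { c with prevU := some x })
  | none => modifyRegs (fun r => { r with lastU := some x })

/-- Insert `x` right after `w` in the linked list of `V`. -/
def insertV (w x : ℕ) : Prog Unit := do
  let cw ← read w
  modifyCell x (fun c => { c with prevV := some w, nextV := cw.nextV })
  modifyCell w (fun c => { c with nextV := some x })
  match cw.nextV with
  | some z => modifyCell z (fun c => { c with prevV := some x })
  | none => modifyRegs (fun r => { r with lastV := some x })

/-- Remove `x` from the linked list of `U` and from the order maintenance structure. -/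
def removeU (x : ℕ) : Prog Unit := do
  orderDelete x
  let cx ← read x
  match cx.prevU with
  | some w => modifyCell w (fun c => { c with nextU := cx.nextU })
  | none => modifyRegs (fun r => { r with firstU := cx.nextU })
  match cx.nextU with
  | some z => modifyCell z (fun c => { c with prevU := cx.prevU })
  | none => modifyRegs (fun r => { r with lastU := cx.prevU })

/-- Remove `x` from the linked list of `V`. -/
def removeV (x : ℕ) : Prog Unit := do
  let cx ← read x
  match cx.prevV with
  | some w => modifyCell w (fun c => { c with nextV := cx.nextV })
  | none => modifyRegs (fun r => { r with firstV := cx.nextV })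
  match cx.nextV with
  | some z => modifyCell z (fun c => { c with prevV := cx.prevV })
  | none => modifyRegs (fun r => { r with lastV := cx.prevV })

/-- Put `x` in the place of `y` in the linked list of `V`. -/
def replaceV (y x : ℕ) : Prog Unit := do
  let cy ← read y
  modifyCell x (fun c => { c with prevV := cy.prevV, nextV := cy.nextV })
  match cy.prevV with
  | some w => modifyCell w (fun c => { c with nextV := some x })
  | none => modifyRegs (fun r => { r with firstV := some x })
  match cy.nextV with
  | some z => modifyCell z (fun c => { c with prevV := some x })
  | none => modifyRegs (fun r => { r with lastV := some x })

/-- If `v_y` is in the B-tree, put `v_x` (with character `a` in its key) in its place. -/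
def replaceInTree (y x a : ℕ) : Prog Unit := do
  let cy ← read y
  match cy.slot with
  | some s => do
      writeSlot s (x, a)
      modifyCell y (fun c => { c with slot := none })
      modifyCell x (fun c => { c with slot := some s })
  | none => pure ()

/-! ### Listing the edges that point to a node

The tails of the edges in `E_L` that point to `v` are consecutive in the list of `U`; the first of
them, if any, is the head of the edge in `E_F` that starts at `v`, if that edge has label `0`, and
the node after it otherwise. Symmetrically for `E_F`. -/

/-- Walk along `U` from `o`, for at most `fuel` nodes, as long as the edges in `E_L` point to
`v`. -/
def walkL (v : ℕ) : ℕ → Option ℕ → Prog (List ℕ)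
  | 0, _ => pure []
  | _ + 1, none => pure []
  | fuel + 1, some u => do
      let c ← read u
      if c.tgtL = v then
        let l ← walkL v fuel c.nextU
        pure (u :: l)
      else pure []

/-- Walk along `V` from `o`, for at most `fuel` nodes, as long as the edges in `E_F` point to
`u`. -/
def walkF (u : ℕ) : ℕ → Option ℕ → Prog (List ℕ)
  | 0, _ => pure []
  | _ + 1, none => pure []
  | fuel + 1, some v => do
      let c ← read v
      if c.tgtF = u then
        let l ← walkF u fuel c.nextV
        pure (v :: l)
      else pure []

/-- At most `fuel` of the tails of the edges in `E_L` that point to `v`. -/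
def incomingL (v fuel : ℕ) : Prog (List ℕ) := do
  let c ← read v
  if c.labF = 0 then walkL v fuel (some c.tgtF)
  else
    let d ← read c.tgtF
    walkL v fuel d.nextU

/-- At most `fuel` of the tails of the edges in `E_F` that point to `u`. -/
def incomingF (u fuel : ℕ) : Prog (List ℕ) := do
  let c ← read u
  if c.labL = 0 then walkF u fuel (some c.tgtL)
  else
    let d ← read c.tgtL
    walkF u fuel d.nextV

/-- Starting from `off` positions after the beginning of the repetition of `u`, find the node of
`U` that covers this position, and the offset in it. -/
def locate : ℕ → ℕ → ℕ → Prog (ℕ × ℕ)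
  | 0, u, off => pure (u, off)
  | fuel + 1, u, off => do
      let c ← read u
      if off < c.len then pure (u, off)
      else
        match c.nextU with
        | some u' => locate fuel u' (off - c.len)
        | none => pure (u, off)

/-! ### Splitting and merging nodes -/

/-- Split `u_j` and `v_j` after the first `d` characters; the record `j` becomes that of the first
parts, and the address of the record of the second parts is returned. The second part of `u_j`
starts where `v_z` starts. If `v_j` is in the B-tree, the second part of `v_j` takes its place. -/
def splitNode (j d z : ℕ) : Prog ℕ := do
  let cj ← read j
  let inF ← incomingF j cj.len
  let inL ← incomingL j cj.len
  let (h, off) ← locate cj.len cj.tgtF (cj.labF + d)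
  let n ← alloc
    { chr := cj.chr, len := cj.len - d, prevU := none, nextU := none, prevV := none, nextV := none,
      tgtL := z, labL := 0, tgtF := h, labF := off, slot := none }
  insertU j n
  insertV j n
  modifyCell j (fun c => { c with len := d })
  (inF ++ [n]).forM (fun v => modifyCell v (fun c =>
    if c.tgtF = j ∧ d ≤ c.labF then { c with tgtF := n, labF := c.labF - d } else c))
  inL.forM (fun u => modifyCell u (fun c =>
    if d ≤ c.labL then { c with tgtL := n, labL := c.labL - d } else c))
  replaceInTree j n cj.chr
  pure n

/-- Merge the nodes with records `p` and `q`, which are consecutive (first `p`, then `q`) both in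
`U` and in `V`, into nodes with record `p`. If `v_q` is in the B-tree, the merged node takes its
place. -/
def mergeNodes (p q : ℕ) : Prog Unit := do
  let cp ← read p
  let cq ← read q
  let inF ← incomingF q cq.len
  let inL ← incomingL q cq.len
  inF.forM (fun v => modifyCell v (fun c => { c with tgtF := p, labF := cp.len + c.labF }))
  inL.forM (fun u => modifyCell u (fun c => { c with tgtL := p, labL := cp.len + c.labL }))
  removeU q
  removeV q
  modifyCell p (fun c => { c with len := cp.len + cq.len })
  replaceInTree q p cp.chr

/-- Append to the array of heavy nodes in `U` those nodes of the list that are `α`-heavy. -/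
def checkHeavyU (α : ℕ) (l : List ℕ) : Prog Unit :=
  l.dedup.forM (fun u => do
    let e ← incomingF u α
    if e.length = α then pushHeavyU u else pure ())

/-- Append to the array of heavy nodes in `V` those nodes of the list that are `α`-heavy. -/
def checkHeavyV (α : ℕ) (l : List ℕ) : Prog Unit :=
  l.dedup.forM (fun v => do
    let e ← incomingL v α
    if e.length = α then pushHeavyV v else pure ())

/-! ### The fast update operation -/

/-- Constant-time search of the replace-node step: the node of `V` before which the new node with
label `(c, 1)` has to be inserted (`none`: at the end of the list). This is the node after
`v_{i-1}` if `u_{i-1}` carries `c`, and `v_{i+1}` otherwise, where `u_i` is the node that carries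
`dollar`. -/
def findPosition (c : ℕ) : Prog (Option ℕ) := do
  let r ← readRegs
  let ci ← read r.dol
  match ci.prevU with
  | some a => do
      let ca ← read a
      if ca.chr = c then pure ca.nextV else pure ci.nextU
  | none => pure ci.nextU

/-- Split-node step. Given the node `v_z` (if any) that starts at the position where `dollar` has to
be inserted, returns the node of `U` after which the new node for `dollar` has to be inserted and,
if a node of `U` had to be split, the address of its second part. -/
def splitStep (gnext : Option ℕ) : Prog (Option ℕ × Option ℕ) := do
  match gnext with
  | none => do
      let r ← readRegs
      pure (r.lastU, none)
  | some z => do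
      let cz ← read z
      if cz.labF = 0 then
        let cu ← read cz.tgtF
        pure (cu.prevU, none)
      else
        let n ← splitNode cz.tgtF cz.labF z
        pure (some cz.tgtF, some n)

/-- Replacement of `(dollar, 1)` by `(c, 1)` and insertion of a new node `(dollar, 1)`, where `w` is
the node of `U` after which the new node is inserted and `gnext` the node of `V` before which the
node `(c, 1)` is inserted. The record of the old `dollar` node becomes the record of the nodes
labelled `(c, 1)`; a new record `x` is created for `dollar`, and takes the place of the old one at
the top of the list of `V` and in the B-tree. The new `u`-node labelled `(dollar, 1)` and the new
`v`-node labelled `(c, 1)` start at the same position, so no other directed edge changes. -/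
def replaceAndInsert (c w : ℕ) (gnext : Option ℕ) : Prog Unit := do
  let r ← readRegs
  let i := r.dol
  let ci ← read i
  let x ← alloc
    { chr := dollar, len := 1, prevU := none, nextU := none, prevV := none, nextV := none,
      tgtL := i, labL := 0, tgtF := ci.tgtF, labF := ci.labF, slot := none }
  insertU w x
  replaceV i x
  match gnext with
  | some z => do
      let cz ← read z
      match cz.prevV with
      | some g => insertV g i
      | none => pure ()
  | none => do
      let r' ← readRegs
      match r'.lastV with
      | some g => insertV g i
      | none => pure ()
  modifyCell ci.tgtF (fun d => { d with tgtL := x })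
  modifyCell i (fun d => { d with chr := c, tgtF := x, labF := 0 })
  replaceInTree i x dollar
  modifyRegs (fun r => { r with dol := x })

/-- Merging phase: the node `i` labelled `(c, 1)` is merged with its neighbours in `U` that carry
`c`. Returns the address of the resulting node. -/
def mergeStep (c i : ℕ) : Prog ℕ := do
  let ci ← read i
  let y ← (match ci.prevU with
    | some p => do
        let cp ← read p
        if cp.chr = c then
          mergeNodes p i
          pure p
        else pure i
    | none => pure i : Prog ℕ)
  match ci.nextU with
  | some q => do
      let cq ← read q
      if cq.chr = c then mergeNodes y q else pure ()
  | none => pure ()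
  pure y

/-- The fast update operation for parameter `α` and input character `c`. -/
def fastUpdate (α c : ℕ) : Prog Unit := do
  let r ← readRegs
  let gnext ← findPosition c
  let (w, split) ← splitStep gnext
  match w with
  | some w => replaceAndInsert c w gnext
  | none => pure ()
  let y ← mergeStep c r.dol
  let cy ← read y
  match split with
  | some n => do
      let cn ← read n
      checkHeavyU α [cn.tgtF, y, cy.tgtF]
      checkHeavyV α [cn.tgtL, y, cy.tgtL]
  | none => do
      checkHeavyU α [y, cy.tgtF]
      checkHeavyV α [y, cy.tgtL]

end RComp

-- The memory is replaced by a `Model`: two lists of addresses, `us` in the order of the DBWT and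
-- `vs` in the order of the F-intervals, and the record fields as functions. Statements about nodes
-- become statements about starting positions in these lists (`pos`). The invariant `Graph` says
-- that `vs` is the stable sorting of `us` by characters, that every edge leads to the interval
-- covering the start of its tail, and that exactly one node carries `dollar`. The text enters only
-- through `flat`, the string spelled by `us`: LF sends a position to the rank of its character, and
-- this rank is the position in the stable sorting (`lf_pos`). Hence a model with `Graph`, with
-- `flat` equal to the BWT, with `TreeInv` and with the right arrays of heavy nodes is a stored
-- graph (`storesAt_of_models`), and every stored graph comes from such a model (`exists_model`).
--
-- Prepending `c` to the text changes the BWT in two places (`IsText.bwt_cons`): `dollar` becomes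
-- `c`, and a new `dollar` is inserted at the rank of the new suffix. A split (`Graph.split`) makes
-- this rank a boundary of `U`. The new node `(dollar, 1)` of `U` and the node `(c, 1)` of `V` then
-- start at the same position, everything behind it moves by one in both lists, and almost all edges
-- stay as they are (`Graph.insertDollar`). A neighbour that carries `c` shows where `c` belongs in
-- `V`, because sorting keeps the order of equal characters (`Placement`). Neighbours in `U` with
-- equal characters are neighbours in `V` as well, so they can be merged (`Graph.adjacent`,
-- `Graph.merge`).
--
-- Time: edges into one node have distinct labels below its length (`indeg_le_len`), and their tails
-- are consecutive (`filter_eq_takeWhile`). So they can be listed in time proportional to their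
-- number, which is below `α` at first and at most `α` before the merges.
--
-- Balance: splitting adds one tail of each kind, so at most one repetition and one F-interval reach
-- `α`, namely the heads of the edges of the second part. Inserting adds only nodes of length `1`,
-- into which at most one edge leads. Merging joins such a node with at most two others, of which at
-- most one has `α` incoming edges: together at most `α + (α - 1) + 1 = 2 α` (`merged_of_merge`).
-- Only the merged node and the heads just mentioned can be `α`-heavy.
--
-- B-tree: after deleting the `dollar` node from `U`, conditions (i) and (ii) become one, that the
-- next node carries another character (`Graph.treeCond_iff`). Each operation replaces one node by
-- another in the tree and in the condition alike (`Exact.replace`). If only the predecessor of the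
-- old `dollar` node carries `c`, this is true only for insertion and merge taken together
-- (`Placement.exact_of_prev`).

namespace RComp

/-! ## Cost-aware program specifications -/

/-- Started in `S`, the program needs at most `k` steps and `c` order maintenance calls, and its
result satisfies `Q`. -/
def Spec {β : Type} (p : Prog β) (S : State) (k c : ℕ) (Q : β → State → Prop) : Prop :=
  (p S).steps ≤ k ∧ (p S).orderCalls ≤ c ∧ Q (p S).val (p S).st

/-- The continuation is analysed in an arbitrary state satisfying the intermediate postcondition
`Q`, so programs are verified one instruction at a time while both costs add up. -/
theorem Spec.bind {β γ : Type} {p : Prog β} {f : β → Prog γ} {S : State} {k c k' c' : ℕ}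
    {Q : β → State → Prop} {R : γ → State → Prop} (hp : Spec p S k c Q)
    (hf : ∀ b S', Q b S' → Spec (f b) S' k' c' R) : Spec (p >>= f) S (k + k') (c + c') R := by
  obtain ⟨h1, h2, h3⟩ := hp
  obtain ⟨g1, g2, g3⟩ := hf _ _ h3
  exact ⟨Nat.add_le_add h1 g1, Nat.add_le_add h2 g2, g3⟩

theorem Spec.mono {β : Type} {p : Prog β} {S : State} {k c k' c' : ℕ}
    {Q R : β → State → Prop} (hp : Spec p S k c Q) (hk : k ≤ k') (hc : c ≤ c')
    (h : ∀ b S', Q b S' → R b S') : Spec p S k' c' R :=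
  ⟨hp.1.trans hk, hp.2.1.trans hc, h _ _ hp.2.2⟩

theorem Spec.pure {β : Type} {b : β} {S : State} {Q : β → State → Prop} (h : Q b S) :
    Spec (Pure.pure b : Prog β) S 0 0 Q := ⟨le_rfl, le_rfl, h⟩

theorem spec_read {x : ℕ} {S : State} : Spec (read x) S 1 0 (fun c S' => c = S.mem x ∧ S' = S) :=
  ⟨le_rfl, le_rfl, rfl, rfl⟩

theorem spec_readRegs {S : State} : Spec readRegs S 1 0 (fun r S' => r = S.regs ∧ S' = S) :=
  ⟨le_rfl, le_rfl, rfl, rfl⟩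

theorem spec_modifyCell {x : ℕ} {f : Cell → Cell} {S : State} : Spec (modifyCell x f) S 2 0
    (fun _ S' => S' = { S with mem := Function.update S.mem x (f (S.mem x)) }) :=
  ⟨le_rfl, le_rfl, rfl⟩

/-- A repeated address would be changed twice; for distinct addresses the loop is a simultaneous
change of all records in `l`. -/
theorem spec_forM_modifyCell {f : Cell → Cell} {l : List ℕ} (hl : l.Nodup) {S : State} :
    Spec (l.forM fun v => modifyCell v f) S (2 * l.length) 0
      (fun _ S' => S' = { S with mem := fun y => if y ∈ l then f (S.mem y) else S.mem y }) := by
  induction l generalizing S with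
  | nil => exact (Spec.pure (by simp)).mono (by simp) le_rfl (fun _ _ h => h)
  | cons a l ih =>
    rw [List.nodup_cons] at hl
    refine (Spec.bind (f := fun _ => l.forM fun v => modifyCell v f) spec_modifyCell ?_).mono
      (k := 2 + 2 * l.length) (c := 0 + 0) (by simp; omega) le_rfl (fun _ _ h => h)
    rintro _ _ rfl
    refine (ih hl.2).mono le_rfl le_rfl ?_
    rintro _ _ rfl
    congr 1
    funext y
    by_cases hy : y = a
    · subst hy; simp [hl.1]
    · simp [hy]

/-! ## Doubly linked lists -/

/-- Linked lists, described through the decompositions of the list. -/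
structure LL (l : List ℕ) (first last : Option ℕ) (prev next : ℕ → Option ℕ) : Prop where
  nodup : l.Nodup
  first : first = l.head?
  last : last = l.getLast?
  link : ∀ A x B, l = A ++ x :: B → next x = B.head? ∧ prev x = A.getLast?

/-- Decompositions in place of indices turn insertions and deletions into plain list manipulations.
-/
theorem isLinkedList_iff {l : List ℕ} {first last : Option ℕ} {prev next : ℕ → Option ℕ} :
    IsLinkedList l first last prev next ↔ LL l first last prev next := by
  constructor
  · rintro ⟨h1, h2, h3, h4, h5⟩
    refine ⟨h1, h2, h3, ?_⟩
    rintro A x B rfl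
    have hA : A.length < (A ++ x :: B).length := by simp
    have e4 := h4 A.length hA
    have e5 := h5 A.length hA
    simp only [List.getElem_append_right (le_refl A.length), Nat.sub_self,
      List.getElem_cons_zero] at e4 e5
    refine ⟨?_, ?_⟩
    · rw [e4, List.getElem?_append_right (by omega)]
      simp [List.head?_eq_getElem?]
    · rw [e5]
      rcases List.eq_nil_or_concat A with rfl | ⟨A', a, rfl⟩
      · simp
      · simp
  · rintro ⟨h1, h2, h3, h4⟩
    refine ⟨h1, h2, h3, ?_, ?_⟩
    · intro i h
      have e : l = l.take i ++ l[i] :: l.drop (i + 1) := by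
        rw [← List.drop_eq_getElem_cons, List.take_append_drop]
      rw [(h4 _ _ _ e).1]
      simp [List.head?_eq_getElem?]
    · intro i h
      have e : l = l.take i ++ l[i] :: l.drop (i + 1) := by
        rw [← List.drop_eq_getElem_cons, List.take_append_drop]
      rw [(h4 _ _ _ e).2]
      rcases i with _ | i
      · simp
      · rw [List.getLast?_eq_getElem?]
        simp only [List.length_take, Nat.succ_ne_zero, if_false]
        rw [min_eq_left (by omega)]
        simp

/-- Without duplicates neither prefix contains `x`, so both end at its only occurrence. This
identifies any two descriptions of the place of a node. -/
theorem append_cons_inj {A A' B B' : List ℕ} {x : ℕ} (h : A ++ x :: B = A' ++ x :: B')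
    (hn : (A ++ x :: B).Nodup) : A = A' ∧ B = B' := by
  have h1 : x ∉ A := by
    intro hx
    exact (List.nodup_append.mp hn).2.2 x hx x (by simp) rfl
  have h2 : x ∉ A' := by
    intro hx
    rw [h] at hn
    exact (List.nodup_append.mp hn).2.2 x hx x (by simp) rfl
  induction A generalizing A' with
  | nil =>
    cases A' with
    | nil => simpa using h
    | cons a A' => simp at h; simp [h.1] at h2
  | cons a A ih =>
    cases A' with
    | nil => simp at h; simp [h.1] at h1
    | cons a' A' =>
      simp only [List.cons_append, List.cons.injEq] at h
      simp only [List.mem_cons, not_or] at h1 h2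
      have := ih h.2 (by simpa using (List.nodup_cons.mp hn).2) h1.2 h2.2
      exact ⟨by rw [h.1, this.1], this.2⟩

/-- The decomposition around a member is unique, so the links need to be checked in one
decomposition only. -/
theorem LL.of_mem {l : List ℕ} {first last : Option ℕ} {prev next : ℕ → Option ℕ}
    (h1 : l.Nodup) (h2 : first = l.head?) (h3 : last = l.getLast?)
    (h : ∀ x ∈ l, ∃ A B, l = A ++ x :: B ∧ next x = B.head? ∧ prev x = A.getLast?) :
    LL l first last prev next := by
  refine ⟨h1, h2, h3, ?_⟩
  rintro A x B rfl
  obtain ⟨A', B', e, h4⟩ := h x (by simp)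
  obtain ⟨rfl, rfl⟩ := append_cons_inj e h1
  exact h4

/-- The new pointers are given by case distinctions of the kind that successive updates of memory
produce; only `w`, `x` and the head of `B` are concerned. -/
theorem LL.insert {A B : List ℕ} {w x : ℕ} {first last first' last' : Option ℕ}
    {prev next prev' next' : ℕ → Option ℕ}
    (h : LL (A ++ w :: B) first last prev next) (hx : x ∉ A ++ w :: B)
    (hf : first' = first) (hl : last' = if B = [] then some x else last)
    (hn : ∀ y, next' y = if y = w then some x else if y = x then B.head? else next y)
    (hp : ∀ y, prev' y = if y = x then some w else if B.head? = some y then some x else prev y) :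
    LL (A ++ w :: x :: B) first' last' prev' next' := by
  have hnd := h.nodup
  simp only [List.mem_append, List.mem_cons, not_or] at hx
  have hnd2 := hnd
  rw [List.nodup_append, List.nodup_cons] at hnd2
  obtain ⟨n1, ⟨n2, n3⟩, n4⟩ := hnd2
  refine LL.of_mem ?_ ?_ ?_ ?_
  · refine (List.Perm.nodup_iff (List.perm_middle (a := x) (l₁ := A ++ [w]) (l₂ := B) |>.symm
      |>.trans (by simp))).mp ?_
    simp only [List.append_assoc, List.cons_append, List.nil_append, List.nodup_cons]
    exact ⟨by simp [hx], hnd⟩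
  · rw [hf, h.first]; cases A <;> simp
  · rw [hl, h.last]; cases B <;> simp
  · intro y hy
    simp only [List.mem_append, List.mem_cons] at hy
    rcases hy with hy | rfl | rfl | hy
    · obtain ⟨A1, A2, rfl⟩ := List.append_of_mem hy
      have := h.link A1 y (A2 ++ w :: B) (by simp)
      refine ⟨A1, A2 ++ w :: x :: B, by simp, ?_, ?_⟩
      · have hyw : y ≠ w := n4 y hy w (by simp)
        have hyx : y ≠ x := by rintro rfl; exact hx.1 hy
        rw [hn, if_neg hyw, if_neg hyx, this.1]
        cases A2 <;> simp
      · have hyx : y ≠ x := by rintro rfl; exact hx.1 hy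
        have : B.head? ≠ some y := by
          intro hh
          exact n4 y hy y (by simp [List.mem_of_mem_head? hh]) rfl
        rw [hp, if_neg hyx, if_neg this]
        exact (h.link A1 y (A2 ++ w :: B) (by simp)).2
    · refine ⟨A, x :: B, rfl, by simp [hn], ?_⟩
      have : B.head? ≠ some y := by
        intro hh
        exact n2 (List.mem_of_mem_head? hh)
      rw [hp, if_neg (by rintro rfl; exact hx.2.1 rfl), if_neg this]
      exact (h.link A y B rfl).2
    · refine ⟨A ++ [w], B, by simp, ?_, by simp [hp]⟩
      rw [hn, if_neg hx.2.1, if_pos rfl]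
    · have hyw : y ≠ w := by rintro rfl; exact n2 hy
      have hyx : y ≠ x := by rintro rfl; exact hx.2.2 hy
      obtain ⟨B1, B2, rfl⟩ := List.append_of_mem hy
      have hlk := h.link (A ++ w :: B1) y B2 (by simp)
      refine ⟨A ++ w :: x :: B1, B2, by simp, ?_, ?_⟩
      · rw [hn, if_neg hyw, if_neg hyx, hlk.1]
      · rw [hp, if_neg hyx]
        cases B1 with
        | nil => simp
        | cons b B1 =>
          have : (b :: B1 ++ y :: B2).head? ≠ some y := by
            simp only [List.cons_append, List.nodup_cons] at n3
            simp only [List.cons_append, List.head?_cons, ne_eq, Option.some.injEq]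
            rintro rfl
            exact n3.1 (by simp)
          rw [if_neg this, hlk.2]
          simp

/-- Nothing is required of the links of `x` itself, since removal leaves the record of `x` alone. -/
theorem LL.remove {A B : List ℕ} {x : ℕ} {first last first' last' : Option ℕ}
    {prev next prev' next' : ℕ → Option ℕ}
    (h : LL (A ++ x :: B) first last prev next)
    (hf : first' = if A = [] then B.head? else first)
    (hl : last' = if B = [] then A.getLast? else last)
    (hn : ∀ y, y ≠ x → next' y = if A.getLast? = some y then B.head? else next y)
    (hp : ∀ y, y ≠ x → prev' y = if B.head? = some y then A.getLast? else prev y) :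
    LL (A ++ B) first' last' prev' next' := by
  have hnd := h.nodup
  have hnd2 := hnd
  rw [List.nodup_append, List.nodup_cons] at hnd2
  obtain ⟨n1, ⟨n2, n3⟩, n4⟩ := hnd2
  refine LL.of_mem ?_ ?_ ?_ ?_
  · exact hnd.sublist (List.Sublist.append_left (List.sublist_cons_self _ _) _)
  · rw [hf, h.first]; cases A <;> simp
  · rw [hl, h.last]
    cases B with
    | nil => simp
    | cons b B => simp [List.getLast?_append]
  · intro y hy
    simp only [List.mem_append] at hy
    rcases hy with hy | hy
    · have hyx : y ≠ x := n4 y hy x (by simp)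
      have hB : B.head? ≠ some y := by
        intro hh
        exact n4 y hy y (by simp [List.mem_of_mem_head? hh]) rfl
      obtain ⟨A1, A2, rfl⟩ := List.append_of_mem hy
      have := h.link A1 y (A2 ++ x :: B) (by simp)
      refine ⟨A1, A2 ++ B, by simp, ?_, ?_⟩
      · rw [hn y hyx]
        rcases List.eq_nil_or_concat A2 with rfl | ⟨A', a, rfl⟩
        · simp
        · have : (A1 ++ y :: A'.concat a).getLast? ≠ some y := by
            have : a ≠ y := by
              rintro rfl
              rw [List.nodup_append, List.nodup_cons] at n1
              exact n1.2.1.1 (by simp)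
            simpa [List.getLast?_append, List.getLast?_cons] using this
          rw [if_neg this, (h.link A1 y _ (by simp; rfl)).1]
          cases A' <;> simp
      · rw [hp y hyx, if_neg hB, this.2]
    · have hyx : y ≠ x := by rintro rfl; exact n2 hy
      have hA : A.getLast? ≠ some y := by
        intro hh
        exact n4 y (List.mem_of_getLast? hh) y (by simp [hy]) rfl
      obtain ⟨B1, B2, rfl⟩ := List.append_of_mem hy
      have := h.link (A ++ x :: B1) y B2 (by simp)
      refine ⟨A ++ B1, B2, by simp, ?_, ?_⟩
      · rw [hn y hyx, if_neg hA, this.1]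
      · rw [hp y hyx]
        cases B1 with
        | nil => simp
        | cons b B1 =>
          have hb : (b :: B1 ++ y :: B2).head? ≠ some y := by
            simp only [List.cons_append, List.nodup_cons] at n3
            simp only [List.cons_append, List.head?_cons, ne_eq, Option.some.injEq]
            rintro rfl
            exact n3.1 (by simp)
          rw [if_neg hb, this.2]
          simp [List.getLast?_append, List.getLast?_cons]

/-- The `dollar` node is always the first one of `V` (`Graph.vs_eq`), so replacement is needed at
the head only. -/
theorem LL.replaceHead {B : List ℕ} {x y : ℕ} {first last first' last' : Option ℕ}
    {prev next prev' next' : ℕ → Option ℕ}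
    (h : LL (y :: B) first last prev next) (hx : x ∉ y :: B)
    (hf : first' = some x)
    (hl : last' = if B = [] then some x else last)
    (hn : ∀ z, next' z = if z = x then B.head? else next z)
    (hp : ∀ z, prev' z = if B.head? = some z then some x else if z = x then none else prev z) :
    LL (x :: B) first' last' prev' next' := by
  have hnd := h.nodup
  rw [List.nodup_cons] at hnd
  simp only [List.mem_cons, not_or] at hx
  refine LL.of_mem ?_ ?_ ?_ ?_
  · exact List.nodup_cons.mpr ⟨hx.2, hnd.2⟩
  · simp [hf]
  · rw [hl, h.last]; cases B <;> simp
  · intro z hz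
    simp only [List.mem_cons] at hz
    rcases hz with rfl | hz
    · refine ⟨[], B, rfl, by simp [hn], ?_⟩
      have : B.head? ≠ some z := fun hh => hx.2 (List.mem_of_mem_head? hh)
      simp [hp, this]
    · have hzx : z ≠ x := by rintro rfl; exact hx.2 hz
      obtain ⟨B1, B2, rfl⟩ := List.append_of_mem hz
      have := h.link (y :: B1) z B2 (by simp)
      refine ⟨x :: B1, B2, by simp, ?_, ?_⟩
      · rw [hn, if_neg hzx, this.1]
      · rw [hp]
        cases B1 with
        | nil => simp
        | cons b B1 =>
          have hb : (b :: B1 ++ z :: B2).head? ≠ some z := by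
            have := hnd.2
            simp only [List.cons_append, List.nodup_cons] at this
            simp only [List.cons_append, List.head?_cons, ne_eq, Option.some.injEq]
            rintro rfl
            exact this.1 (by simp)
          rw [if_neg hb, if_neg hzx, this.2]
          simp [List.getLast?_cons]

/-! ## Abstract contents of the memory -/

/-- The contents of the memory, with the linked lists replaced by lists of addresses. -/
structure Model where
  us : List ℕ
  vs : List ℕ
  chr : ℕ → ℕ
  len : ℕ → ℕ
  tgtL : ℕ → ℕ
  labL : ℕ → ℕ
  tgtF : ℕ → ℕ
  labF : ℕ → ℕ
  slot : ℕ → Option ℕ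
  slots : ℕ → ℕ × ℕ
  fresh : ℕ
  dol : ℕ
  tree : BTree
  heavyU : List ℕ
  heavyV : List ℕ

/-- The state `S` represents the model `M`. -/
structure Models (M : Model) (S : State) : Prop where
  listU : LL M.us S.regs.firstU S.regs.lastU (fun x => (S.mem x).prevU) (fun x => (S.mem x).nextU)
  listV : LL M.vs S.regs.firstV S.regs.lastV (fun x => (S.mem x).prevV) (fun x => (S.mem x).nextV)
  order : S.order = M.us
  chr : ∀ x, (S.mem x).chr = M.chr x
  len : ∀ x, (S.mem x).len = M.len x
  tgtL : ∀ x, (S.mem x).tgtL = M.tgtL x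
  labL : ∀ x, (S.mem x).labL = M.labL x
  tgtF : ∀ x, (S.mem x).tgtF = M.tgtF x
  labF : ∀ x, (S.mem x).labF = M.labF x
  slot : ∀ x, (S.mem x).slot = M.slot x
  slots : S.slots = M.slots
  fresh : S.fresh = M.fresh
  dol : S.regs.dol = M.dol
  tree : S.tree = M.tree
  heavyU : S.heavyU = M.heavyU
  heavyV : S.heavyV = M.heavyV

/-- Two records agree except for the links of the two lists. -/
def SameData (a b : Cell) : Prop :=
  a.chr = b.chr ∧ a.len = b.len ∧ a.tgtL = b.tgtL ∧ a.labL = b.labL ∧ a.tgtF = b.tgtF ∧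
    a.labF = b.labF ∧ a.slot = b.slot

theorem Models.relink {M : Model} {S S' : State} (h : Models M S) {us vs : List ℕ}
    (hU : LL us S'.regs.firstU S'.regs.lastU (fun x => (S'.mem x).prevU)
      (fun x => (S'.mem x).nextU))
    (hV : LL vs S'.regs.firstV S'.regs.lastV (fun x => (S'.mem x).prevV)
      (fun x => (S'.mem x).nextV))
    (ho : S'.order = us) (hd : ∀ y, SameData (S'.mem y) (S.mem y))
    (hs : S'.slots = S.slots ∧ S'.fresh = S.fresh ∧ S'.regs.dol = S.regs.dol ∧ S'.tree = S.tree ∧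
      S'.heavyU = S.heavyU ∧ S'.heavyV = S.heavyV) :
    Models { M with us := us, vs := vs } S' where
  listU := hU
  listV := hV
  order := ho
  chr x := (hd x).1.trans (h.chr x)
  len x := (hd x).2.1.trans (h.len x)
  tgtL x := (hd x).2.2.1.trans (h.tgtL x)
  labL x := (hd x).2.2.2.1.trans (h.labL x)
  tgtF x := (hd x).2.2.2.2.1.trans (h.tgtF x)
  labF x := (hd x).2.2.2.2.2.1.trans (h.labF x)
  slot x := (hd x).2.2.2.2.2.2.trans (h.slot x)
  slots := hs.1.trans h.slots
  fresh := hs.2.1.trans h.fresh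
  dol := hs.2.2.1.trans h.dol
  tree := hs.2.2.2.1.trans h.tree
  heavyU := hs.2.2.2.2.1.trans h.heavyU
  heavyV := hs.2.2.2.2.2.trans h.heavyV

theorem LL.congr {l : List ℕ} {first last first' last' : Option ℕ}
    {prev next prev' next' : ℕ → Option ℕ} (h : LL l first last prev next)
    (hf : first' = first) (hl : last' = last) (hp : ∀ y, prev' y = prev y)
    (hn : ∀ y, next' y = next y) : LL l first' last' prev' next' := by
  obtain rfl := funext hp
  obtain rfl := funext hn
  subst hf hl
  exact h

theorem insertAfter_append {A B : List ℕ} {w x : ℕ} (h : w ∉ A) :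
    insertAfter w x (A ++ w :: B) = A ++ w :: x :: B := by
  induction A with
  | nil => simp [insertAfter]
  | cons a A ih =>
    simp only [List.mem_cons, not_or] at h
    simp [insertAfter, Ne.symm h.1, ih h.2]

theorem notMem_left_of_nodup {A B : List ℕ} {x : ℕ} (h : (A ++ x :: B).Nodup) : x ∉ A := fun hx =>
  (List.nodup_append.mp h).2.2 x hx x (by simp) rfl

theorem notMem_right_of_nodup {A B : List ℕ} {x : ℕ} (h : (A ++ x :: B).Nodup) : x ∉ B :=
  (List.nodup_cons.mp (List.nodup_append.mp h).2.1).1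

theorem head_ne_of_nodup {A B : List ℕ} {w : ℕ} (h : (A ++ w :: B).Nodup) (y : ℕ)
    (hy : B.head? = some y) : y ≠ w := by
  rintro rfl
  exact notMem_right_of_nodup h (List.mem_of_mem_head? hy)

theorem last_ne_of_nodup {A B : List ℕ} {w : ℕ} (h : (A ++ w :: B).Nodup) (y : ℕ)
    (hy : A.getLast? = some y) : y ≠ w := by
  rintro rfl
  exact notMem_left_of_nodup h (List.mem_of_getLast? hy)

/-- The proof evaluates the program symbolically. The only branching is on whether `w` has a
successor, and each condition of `LL.insert` is a finite case distinction between `w`, `x` and this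
successor. The other list operations are treated in the same way. -/
theorem spec_insertU {M : Model} {S : State} (h : Models M S) {A B : List ℕ} {w x : ℕ}
    (hu : M.us = A ++ w :: B) (hx : x ∉ M.us) :
    Spec (insertU w x) S 9 1 (fun _ S' => Models { M with us := A ++ w :: x :: B } S') := by
  have hnd : (A ++ w :: B).Nodup := hu ▸ h.listU.nodup
  have hlk := (h.listU.link A w B hu).1
  have hw := notMem_left_of_nodup hnd
  have hwx : w ≠ x := by rintro rfl; simp [hu] at hx
  have hbw := head_ne_of_nodup hnd
  have hbx : B.head? ≠ some x := fun hh => hx (by simp [hu, List.mem_of_mem_head? hh])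
  -- The program tests the successor pointer, `LL.insert` tests `B = []`; this reconciles the two.
  have hlast : ∀ l, (if B = [] then some x else l) = if B.head? = none then some x else l := by
    simp
  have hU := h.listU
  rw [hu] at hU hx
  refine ⟨?_, ?_, h.relink (us := A ++ w :: x :: B) (LL.insert hU hx ?_ ?_ ?_ ?_)
    (h.listV.congr ?_ ?_ ?_ ?_) ?_ ?_ ?_⟩
  case refine_11 =>
    simp only [insertU, Bind.bind, orderInsert, read, modifyCell, write, modifyRegs, readRegs,
        writeRegs, hlk]
    cases hh : B.head? <;> simp [h.order, hu, insertAfter_append hw]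
  all_goals
    simp only [insertU, Bind.bind, orderInsert, read, modifyCell, write, modifyRegs, readRegs,
        writeRegs, hlk, hlast, SameData]
    cases hh : B.head? <;> simp only [Function.update_apply] <;> grind

theorem spec_insertV {M : Model} {S : State} (h : Models M S) {A B : List ℕ} {w x : ℕ}
    (hv : M.vs = A ++ w :: B) (hx : x ∉ M.vs) :
    Spec (insertV w x) S 9 0 (fun _ S' => Models { M with vs := A ++ w :: x :: B } S') := by
  have hnd : (A ++ w :: B).Nodup := hv ▸ h.listV.nodup
  have hlk := (h.listV.link A w B hv).1
  have hwx : w ≠ x := by rintro rfl; simp [hv] at hx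
  have hbw := head_ne_of_nodup hnd
  have hbx : B.head? ≠ some x := fun hh => hx (by simp [hv, List.mem_of_mem_head? hh])
  have hlast : ∀ l, (if B = [] then some x else l) = if B.head? = none then some x else l := by
    simp
  have hV := h.listV
  rw [hv] at hV hx
  refine ⟨?_, ?_, h.relink (vs := A ++ w :: x :: B) (h.listU.congr ?_ ?_ ?_ ?_)
    (LL.insert hV hx ?_ ?_ ?_ ?_) ?_ ?_ ?_⟩
  case refine_11 =>
    simp only [insertV, Bind.bind, read, modifyCell, write, modifyRegs, readRegs, writeRegs, hlk]
    cases hh : B.head? <;> simp [h.order]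
  all_goals
    simp only [insertV, Bind.bind, read, modifyCell, write, modifyRegs, readRegs,
        writeRegs, hlk, hlast, SameData]
    cases hh : B.head? <;> simp only [Function.update_apply] <;> grind

theorem spec_removeU {M : Model} {S : State} (h : Models M S) {A B : List ℕ} {x : ℕ}
    (hu : M.us = A ++ x :: B) :
    Spec (removeU x) S 5 1 (fun _ S' => Models { M with us := A ++ B } S') := by
  have hnd : (A ++ x :: B).Nodup := hu ▸ h.listU.nodup
  have hlk := (h.listU.link A x B hu).1
  have hlk' := (h.listU.link A x B hu).2
  have hw := notMem_left_of_nodup hnd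
  have hbx := head_ne_of_nodup hnd
  have hax := last_ne_of_nodup hnd
  have hlast : ∀ l l' : Option ℕ, (if B = [] then l' else l) = if B.head? = none then l' else l := by
    simp
  have hfirst : ∀ l l' : Option ℕ,
      (if A = [] then l' else l) = if A.getLast? = none then l' else l := by
    simp
  have hab : ∀ a, A.getLast? = some a → B.head? ≠ some a := by
    intro a ha hb
    exact (List.nodup_append.mp hnd).2.2 a (List.mem_of_getLast? ha) a
      (by simp [List.mem_of_mem_head? hb]) rfl
  have hU := h.listU
  rw [hu] at hU
  refine ⟨?_, ?_, h.relink (us := A ++ B) (LL.remove hU ?_ ?_ ?_ ?_)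
    (h.listV.congr ?_ ?_ ?_ ?_) ?_ ?_ ?_⟩
  case refine_11 =>
    simp only [removeU, Bind.bind, orderDelete, read, modifyCell, write, modifyRegs, readRegs,
        writeRegs, hlk, hlk']
    cases hh : B.head? <;> cases hh' : A.getLast? <;> simp [h.order, hu, List.erase_append_right _ hw]
  all_goals
    simp only [removeU, Bind.bind, orderDelete, read, modifyCell, write, modifyRegs, readRegs,
        writeRegs, hlk, hlk', hlast, hfirst, SameData]
    cases hh : B.head? <;> cases hh' : A.getLast? <;> simp only [Function.update_apply] <;> grind

theorem spec_removeV {M : Model} {S : State} (h : Models M S) {A B : List ℕ} {x : ℕ}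
    (hv : M.vs = A ++ x :: B) :
    Spec (removeV x) S 5 0 (fun _ S' => Models { M with vs := A ++ B } S') := by
  have hnd : (A ++ x :: B).Nodup := hv ▸ h.listV.nodup
  have hlk := (h.listV.link A x B hv).1
  have hlk' := (h.listV.link A x B hv).2
  have hbx := head_ne_of_nodup hnd
  have hax := last_ne_of_nodup hnd
  have hlast : ∀ l l' : Option ℕ, (if B = [] then l' else l) = if B.head? = none then l' else l := by
    simp
  have hfirst : ∀ l l' : Option ℕ,
      (if A = [] then l' else l) = if A.getLast? = none then l' else l := by
    simp
  have hab : ∀ a, A.getLast? = some a → B.head? ≠ some a := by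
    intro a ha hb
    exact (List.nodup_append.mp hnd).2.2 a (List.mem_of_getLast? ha) a
      (by simp [List.mem_of_mem_head? hb]) rfl
  have hV := h.listV
  rw [hv] at hV
  refine ⟨?_, ?_, h.relink (vs := A ++ B) (h.listU.congr ?_ ?_ ?_ ?_) (LL.remove hV ?_ ?_ ?_ ?_)
    ?_ ?_ ?_⟩
  case refine_11 =>
    simp only [removeV, Bind.bind, read, modifyCell, write, modifyRegs, readRegs,
        writeRegs, hlk, hlk']
    cases hh : B.head? <;> cases hh' : A.getLast? <;> simp [h.order]
  all_goals
    simp only [removeV, Bind.bind, read, modifyCell, write, modifyRegs, readRegs,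
        writeRegs, hlk, hlk', hlast, hfirst, SameData]
    cases hh : B.head? <;> cases hh' : A.getLast? <;> simp only [Function.update_apply] <;> grind

theorem spec_replaceV {M : Model} {S : State} (h : Models M S) {B : List ℕ} {y x : ℕ}
    (hv : M.vs = y :: B) (hx : x ∉ M.vs) :
    Spec (replaceV y x) S 7 0 (fun _ S' => Models { M with vs := x :: B } S') := by
  have hnd : ([] ++ y :: B).Nodup := hv ▸ h.listV.nodup
  have hlk := (h.listV.link [] y B hv).1
  have hlk' := (h.listV.link [] y B hv).2
  have hwx : y ≠ x := by rintro rfl; simp [hv] at hx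
  have hby := head_ne_of_nodup hnd
  have hbx : B.head? ≠ some x := fun hh => hx (by simp [hv, List.mem_of_mem_head? hh])
  have hlast : ∀ l l' : Option ℕ, (if B = [] then l' else l) = if B.head? = none then l' else l := by
    simp
  simp only [List.getLast?_nil] at hlk'
  have hV := h.listV
  rw [hv] at hV hx
  refine ⟨?_, ?_, h.relink (vs := x :: B) (h.listU.congr ?_ ?_ ?_ ?_)
    (LL.replaceHead hV hx ?_ ?_ ?_ ?_) ?_ ?_ ?_⟩
  case refine_11 =>
    simp only [replaceV, Bind.bind, read, modifyCell, write, modifyRegs, readRegs,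
        writeRegs, hlk, hlk']
    cases hh : B.head? <;> simp [h.order]
  all_goals
    simp only [replaceV, Bind.bind, read, modifyCell, write, modifyRegs, readRegs,
        writeRegs, hlk, hlk', hlast, SameData]
    cases hh : B.head? <;> simp only [Function.update_apply] <;> grind

/-! ## Positions in a sequence of intervals -/

/-- The starting position of the interval of `x` if the members of the list are the names of
consecutive intervals of the given lengths. -/
def pos (len : ℕ → ℕ) : List ℕ → ℕ → ℕ
  | [], _ => 0
  | a :: l, x => if x = a then 0 else len a + pos len l x

/-- The total length of the intervals. -/
def total (len : ℕ → ℕ) (l : List ℕ) : ℕ := (l.map len).sum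

@[simp] theorem total_nil (len : ℕ → ℕ) : total len [] = 0 := rfl
@[simp] theorem total_cons (len : ℕ → ℕ) (a : ℕ) (l : List ℕ) :
    total len (a :: l) = len a + total len l := by simp [total]
@[simp] theorem total_append (len : ℕ → ℕ) (l l' : List ℕ) :
    total len (l ++ l') = total len l + total len l' := by simp [total]

theorem total_perm {len : ℕ → ℕ} {l l' : List ℕ} (h : l.Perm l') : total len l = total len l' :=
  (h.map len).sum_eq

theorem total_congr {len len' : ℕ → ℕ} {l : List ℕ} (h : ∀ x ∈ l, len x = len' x) :
    total len l = total len' l := by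
  rw [total, total, List.map_congr_left h]

theorem pos_append_of_mem {len : ℕ → ℕ} {A B : List ℕ} {x : ℕ} (h : x ∈ A) :
    pos len (A ++ B) x = pos len A x := by
  induction A with
  | nil => simp at h
  | cons a A ih =>
    by_cases hx : x = a
    · simp [pos, hx]
    · simp only [List.mem_cons, hx, false_or] at h
      simp [pos, hx, ih h]

theorem pos_append_of_notMem {len : ℕ → ℕ} {A B : List ℕ} {x : ℕ} (h : x ∉ A) :
    pos len (A ++ B) x = total len A + pos len B x := by
  induction A with
  | nil => simp
  | cons a A ih =>
    simp only [List.mem_cons, not_or] at h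
    simp [pos, h.1, ih h.2, add_assoc]

theorem pos_middle {len : ℕ → ℕ} {A B : List ℕ} {x : ℕ} (h : x ∉ A) :
    pos len (A ++ x :: B) x = total len A := by
  simp [pos_append_of_notMem h, pos]

theorem pos_congr {len len' : ℕ → ℕ} {l : List ℕ} (h : ∀ x ∈ l, len x = len' x) (x : ℕ) :
    pos len l x = pos len' l x := by
  induction l with
  | nil => rfl
  | cons a l ih =>
    simp only [List.mem_cons, forall_eq_or_imp] at h
    simp [pos, h.1, ih h.2]

theorem pos_add_le_total {len : ℕ → ℕ} {l : List ℕ} {x : ℕ} (h : x ∈ l) :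
    pos len l x + len x ≤ total len l := by
  induction l with
  | nil => simp at h
  | cons a l ih =>
    by_cases hx : x = a
    · simp [pos, hx]
    · simp only [List.mem_cons, hx, false_or] at h
      have := ih h
      simp [pos, hx]; omega

theorem pos_before {len : ℕ → ℕ} {A B : List ℕ} {x y : ℕ} (hx : x ∉ A) (h : y ∈ A) :
    pos len (A ++ x :: B) y + len y ≤ pos len (A ++ x :: B) x := by
  rw [pos_middle hx, pos_append_of_mem h]
  exact pos_add_le_total h

theorem pos_after {len : ℕ → ℕ} {A B : List ℕ} {x y : ℕ} (hx : (A ++ x :: B).Nodup) (h : y ∈ B) :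
    pos len (A ++ x :: B) x + len x ≤ pos len (A ++ x :: B) y := by
  have hyA : y ∉ A := fun hy => (List.nodup_append.mp hx).2.2 y hy y (by simp [h]) rfl
  have hyx : y ≠ x := by rintro rfl; exact notMem_right_of_nodup hx h
  rw [pos_middle (notMem_left_of_nodup hx), pos_append_of_notMem hyA]
  simp [pos, hyx]

theorem pos_disjoint {len : ℕ → ℕ} {l : List ℕ} (hl : l.Nodup) {x y : ℕ} (hx : x ∈ l) (hy : y ∈ l)
    (hxy : x ≠ y) : pos len l x + len x ≤ pos len l y ∨ pos len l y + len y ≤ pos len l x := by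
  obtain ⟨A, B, rfl⟩ := List.append_of_mem hx
  simp only [List.mem_append, List.mem_cons, hxy.symm, false_or] at hy
  rcases hy with hy | hy
  · exact Or.inr (pos_before (notMem_left_of_nodup hl) hy)
  · exact Or.inl (pos_after hl hy)

/-- The half-open intervals of the members are disjoint, so a position lies in at most one of them.
-/
theorem pos_unique {len : ℕ → ℕ} {l : List ℕ} (hl : l.Nodup) {x y p : ℕ} (hx : x ∈ l) (hy : y ∈ l)
    (h1 : pos len l x ≤ p) (h2 : p < pos len l x + len x)
    (h3 : pos len l y ≤ p) (h4 : p < pos len l y + len y) : x = y := by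
  by_contra hxy
  have := pos_disjoint (len := len) hl hx hy hxy
  omega

theorem pos_inj {len : ℕ → ℕ} {l : List ℕ} (hl : l.Nodup) (hp : ∀ x ∈ l, 0 < len x) {x y : ℕ}
    (hx : x ∈ l) (hy : y ∈ l) (h : pos len l x = pos len l y) : x = y :=
  pos_unique hl hx hy h.le (by have := hp x hx; omega) le_rfl (by have := hp y hy; omega)

/-- The intervals cover all positions below the total length; removing the first interval shifts `p`
by its length. -/
theorem exists_pos {len : ℕ → ℕ} {l : List ℕ} (hl : l.Nodup) {p : ℕ} (h : p < total len l) :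
    ∃ x ∈ l, pos len l x ≤ p ∧ p < pos len l x + len x := by
  induction l generalizing p with
  | nil => simp at h
  | cons a l ih =>
    by_cases hp : p < len a
    · exact ⟨a, by simp, by simp [pos], by simpa [pos] using hp⟩
    · rw [List.nodup_cons] at hl
      obtain ⟨x, hx, h1, h2⟩ := ih hl.2 (p := p - len a) (by simp at h; omega)
      have hxa : x ≠ a := by rintro rfl; exact hl.1 hx
      exact ⟨x, by simp [hx], by simp [pos, hxa]; omega, by simp [pos, hxa]; omega⟩

/-! ## Edges -/

/-- The edge that starts at a member of `us` leads to the member of `vs` whose interval contains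
the start of the interval of the former, and is labelled with the offset. -/
def Edges (us vs : List ℕ) (len tgt lab : ℕ → ℕ) : Prop :=
  ∀ x ∈ us, tgt x ∈ vs ∧ pos len us x = pos len vs (tgt x) + lab x ∧ lab x < len (tgt x)

/-- This turns a pointer equation into inequalities between positions. Both the recognition of
incoming edges and the comparison with the sets `EL` and `EF` rest on it. -/
theorem Edges.tgt_eq_iff {us vs : List ℕ} {len tgt lab : ℕ → ℕ} (h : Edges us vs len tgt lab)
    (hv : vs.Nodup) {x v : ℕ} (hx : x ∈ us) (hvv : v ∈ vs) :
    tgt x = v ↔ pos len vs v ≤ pos len us x ∧ pos len us x < pos len vs v + len v := by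
  obtain ⟨h1, h2, h3⟩ := h x hx
  constructor
  · rintro rfl; omega
  · rintro ⟨h4, h5⟩
    exact pos_unique hv h1 hvv (p := pos len us x) (by omega) (by omega) h4 h5

/-- The number of edges from the members of `us` to `v`. -/
def indeg (us : List ℕ) (tgt : ℕ → ℕ) (v : ℕ) : ℕ := us.countP (fun y => tgt y = v)

/-- Starts increase along `us`, and the tails of the edges to `v` are the members whose start falls
into the interval of `v`. So they form a block, which begins right behind the members that start
before `v`. -/
theorem filter_eq_takeWhile {us vs A R : List ℕ} {len tgt lab : ℕ → ℕ}
    (h : Edges us vs len tgt lab) (hu : us.Nodup) (hv : vs.Nodup) {v : ℕ} (hvv : v ∈ vs)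
    (e : us = A ++ R) (hA : ∀ a ∈ A, pos len us a < pos len vs v)
    (hR : ∀ r ∈ R, pos len vs v ≤ pos len us r) :
    us.filter (fun y => tgt y = v) = R.takeWhile (fun y => tgt y = v) := by
  have key : ∀ x ∈ us, tgt x = v ↔
      pos len vs v ≤ pos len us x ∧ pos len us x < pos len vs v + len v :=
    fun x hx => h.tgt_eq_iff hv hx hvv
  have h1 : us.filter (fun y => tgt y = v) = R.filter (fun y => tgt y = v) := by
    nth_rewrite 1 [e]
    rw [List.filter_append, List.filter_eq_nil_iff.mpr, List.nil_append]
    intro a ha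
    have := hA a ha
    simp only [decide_eq_true_eq, key a (by simp [e, ha])]
    omega
  rw [h1]
  clear h1 hA
  induction R generalizing A with
  | nil => simp
  | cons r R ih =>
    have hr : r ∈ us := by simp [e]
    by_cases ht : tgt r = v
    · simp only [ht, decide_true, List.filter_cons_of_pos, List.takeWhile_cons_of_pos]
      rw [ih (A := A ++ [r]) (by simp [e]) (fun x hx => hR x (by simp [hx]))]
    · rw [List.takeWhile_cons_of_neg (by simpa using ht)]
      rw [List.filter_eq_nil_iff]
      intro x hx
      simp only [List.mem_cons] at hx
      rcases hx with rfl | hx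
      · simpa using ht
      · have hxu : x ∈ us := by simp [e, hx]
        simp only [decide_eq_true_eq, key x hxu]
        -- `r` starts at or after `v` without being a tail, hence beyond the end of `v`, and so does
        -- every later member.
        have h3 := hR r (by simp)
        have h4 : pos len us r + len r ≤ pos len us x := by
          rw [e]; exact pos_after (e ▸ hu) hx
        have h5 := (key r hr).not.mp ht
        omega

/-- The tails start at different positions, so the labels of their edges are distinct numbers below
`len v`. Consequently the fuel `len` in `splitNode` and `mergeNodes` never truncates a listing, and
a node of length `1` is the head of at most one edge. -/
theorem indeg_le_len {us vs : List ℕ} {len tgt lab : ℕ → ℕ} (h : Edges us vs len tgt lab)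
    (hu : us.Nodup) (hp : ∀ x ∈ us, 0 < len x) {v : ℕ} :
    indeg us tgt v ≤ len v := by
  rw [indeg, List.countP_eq_length_filter]
  have hn : ((us.filter (fun y => tgt y = v)).map lab).Nodup := by
    rw [List.nodup_map_iff_inj_on (hu.filter _)]
    intro x hx y hy hxy
    simp only [List.mem_filter, decide_eq_true_eq] at hx hy
    refine pos_inj hu hp hx.1 hy.1 ?_
    have h1 := (h x hx.1).2.1
    have h2 := (h y hy.1).2.1
    rw [hx.2] at h1
    rw [hy.2] at h2
    omega
  have hsub : ((us.filter (fun y => tgt y = v)).map lab).toFinset ⊆ Finset.range (len v) := by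
    intro a ha
    simp only [List.mem_toFinset, List.mem_map, List.mem_filter, decide_eq_true_eq] at ha
    obtain ⟨x, ⟨hx, hv⟩, rfl⟩ := ha
    have := (h x hx).2.2
    rw [hv] at this
    simpa using this
  have := Finset.card_le_card hsub
  rwa [List.toFinset_card_of_nodup hn, List.length_map, Finset.card_range] at this

/-! ## Invariant of the graph -/

/-- The model represents an LF-interval graph: `vs` is the stable sorting of `us` by characters, the
edges are right, and `dol` is the only node that carries the smallest character `dollar`. -/
structure Graph (M : Model) : Prop where
  nodupU : M.us.Nodup
  nodupV : M.vs.Nodup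
  mem_iff : ∀ x, x ∈ M.us ↔ x ∈ M.vs
  len_pos : ∀ x ∈ M.us, 0 < M.len x
  edgesL : Edges M.us M.vs M.len M.tgtL M.labL
  edgesF : Edges M.vs M.us M.len M.tgtF M.labF
  lt_fresh : ∀ x ∈ M.us, x < M.fresh
  sorted : M.vs.Pairwise (fun x y => M.chr x ≤ M.chr y)
  stable : ∀ a, M.vs.filter (fun x => M.chr x = a) = M.us.filter (fun x => M.chr x = a)
  dol_mem : M.dol ∈ M.us
  dol_chr : M.chr M.dol = dollar
  dol_len : M.len M.dol = 1
  dol_lt : ∀ x ∈ M.us, x ≠ M.dol → dollar < M.chr x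

theorem Graph.perm {M : Model} (h : Graph M) : M.us.Perm M.vs :=
  (List.perm_ext_iff_of_nodup h.nodupU h.nodupV).mpr h.mem_iff

theorem Graph.total_eq {M : Model} (h : Graph M) : total M.len M.us = total M.len M.vs :=
  total_perm h.perm

/-- The node `dol` is the first one of the list of `V`. -/
theorem Graph.vs_eq {M : Model} (h : Graph M) : ∃ V, M.vs = M.dol :: V := by
  have hd := (h.mem_iff _).mp h.dol_mem
  have hs := h.sorted
  have hl : ∀ x ∈ M.vs, x ≠ M.dol → dollar < M.chr x := fun x hx => h.dol_lt x ((h.mem_iff x).mpr hx)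
  have hc := h.dol_chr
  cases e : M.vs with
  | nil => simp [e] at hd
  | cons v V =>
    refine ⟨V, ?_⟩
    by_cases hv : v = M.dol
    · rw [hv]
    -- Another first node would carry a character larger than that of `dol` behind it, against the
    -- sorting.
    · exfalso
      rw [e] at hd hs hl
      simp only [List.mem_cons, Ne.symm hv, false_or] at hd
      have h1 := (List.pairwise_cons.mp hs).1 _ hd
      have h2 := hl v (by simp) hv
      omega

/-! ## Specifications of the reading operations -/

/-- One read per listed node and one for the node that ends the walk. The minimum with `fuel` keeps
a heaviness check within `O(α)` steps even at a node with up to `2 α` incoming edges. -/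
theorem spec_walkL {M : Model} {S : State} (h : Models M S) (v : ℕ) (fuel : ℕ) {A R : List ℕ}
    (e : M.us = A ++ R) :
    Spec (walkL v fuel R.head?) S (min fuel ((R.takeWhile (fun y => M.tgtL y = v)).length + 1)) 0
      (fun r S' => S' = S ∧ r = (R.takeWhile (fun y => M.tgtL y = v)).take fuel) := by
  induction fuel generalizing A R with
  | zero => exact (Spec.pure (by simp)).mono (by simp) le_rfl (fun _ _ h => h)
  | succ fuel ih =>
    cases R with
    | nil => exact (Spec.pure (by simp)).mono (by simp) le_rfl (fun _ _ h => h)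
    | cons r R =>
      have hn : (S.mem r).nextU = R.head? := (h.listU.link A r R e).1
      refine (Spec.bind spec_read (k' := min fuel
        ((((r :: R).takeWhile (fun y => M.tgtL y = v)).length))) (c' := 0) ?_).mono
        (k := 1 + _) (by omega) le_rfl (fun _ _ h => h)
      rintro _ _ ⟨rfl, rfl⟩
      rw [h.tgtL]
      by_cases ht : M.tgtL r = v
      · simp only [ht, if_true, decide_true, List.takeWhile_cons_of_pos, List.length_cons,
          List.take_succ_cons, hn]
        refine (Spec.bind (ih (A := A ++ [r]) (by simp [e])) (k' := 0) (c' := 0) ?_)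
        rintro _ _ ⟨rfl, rfl⟩
        exact Spec.pure ⟨rfl, rfl⟩
      · simp only [ht, if_false]
        exact (Spec.pure (by simp [ht])).mono (by simp) le_rfl (fun _ _ h => h)

theorem spec_walkF {M : Model} {S : State} (h : Models M S) (u : ℕ) (fuel : ℕ) {A R : List ℕ}
    (e : M.vs = A ++ R) :
    Spec (walkF u fuel R.head?) S (min fuel ((R.takeWhile (fun y => M.tgtF y = u)).length + 1)) 0
      (fun r S' => S' = S ∧ r = (R.takeWhile (fun y => M.tgtF y = u)).take fuel) := by
  induction fuel generalizing A R with
  | zero => exact (Spec.pure (by simp)).mono (by simp) le_rfl (fun _ _ h => h)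
  | succ fuel ih =>
    cases R with
    | nil => exact (Spec.pure (by simp)).mono (by simp) le_rfl (fun _ _ h => h)
    | cons r R =>
      have hn : (S.mem r).nextV = R.head? := (h.listV.link A r R e).1
      refine (Spec.bind spec_read (k' := min fuel
        ((((r :: R).takeWhile (fun y => M.tgtF y = u)).length))) (c' := 0) ?_).mono
        (k := 1 + _) (by omega) le_rfl (fun _ _ h => h)
      rintro _ _ ⟨rfl, rfl⟩
      rw [h.tgtF]
      by_cases ht : M.tgtF r = u
      · simp only [ht, if_true, decide_true, List.takeWhile_cons_of_pos, List.length_cons,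
          List.take_succ_cons, hn]
        refine (Spec.bind (ih (A := A ++ [r]) (by simp [e])) (k' := 0) (c' := 0) ?_)
        rintro _ _ ⟨rfl, rfl⟩
        exact Spec.pure ⟨rfl, rfl⟩
      · simp only [ht, if_false]
        exact (Spec.pure (by simp [ht])).mono (by simp) le_rfl (fun _ _ h => h)

/-- The tails of the edges to `v` follow the node at the head of the edge from `v`. -/
theorem filter_eq_takeWhile_of_edge {us vs A B : List ℕ} {len tgt lab tgt' lab' : ℕ → ℕ}
    (h : Edges us vs len tgt lab) (h' : Edges vs us len tgt' lab') (hu : us.Nodup) (hv : vs.Nodup)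
    {v : ℕ} (hp : ∀ x ∈ us, 0 < len x) (hvv : v ∈ vs) (e : us = A ++ tgt' v :: B) :
    us.filter (fun y => tgt y = v) =
      (if lab' v = 0 then tgt' v :: B else B).takeWhile (fun y => tgt y = v) := by
  obtain ⟨h1, h2, h3⟩ := h' v hvv
  split_ifs with h0
  · refine filter_eq_takeWhile h hu hv hvv e ?_ ?_
    · intro a ha
      have h5 : pos len us a + len a ≤ pos len us (tgt' v) := by
        rw [e]; exact pos_before (notMem_left_of_nodup (e ▸ hu)) ha
      have h6 := hp a (by simp [e, ha])
      omega
    · intro r hr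
      simp only [List.mem_cons] at hr
      rcases hr with rfl | hr
      · omega
      · have h5 : pos len us (tgt' v) + len (tgt' v) ≤ pos len us r := by
          rw [e]; exact pos_after (e ▸ hu) hr
        omega
  -- With a positive label the head starts strictly before `v`. It is therefore not a tail and
  -- belongs to the skipped prefix.
  · refine filter_eq_takeWhile h hu hv hvv (A := A ++ [tgt' v]) (by simp [e]) ?_ ?_
    · intro a ha
      simp only [List.mem_append, List.mem_singleton] at ha
      rcases ha with ha | rfl
      · have h5 : pos len us a + len a ≤ pos len us (tgt' v) := by
          rw [e]; exact pos_before (notMem_left_of_nodup (e ▸ hu)) ha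
        omega
      · omega
    · intro r hr
      have h5 : pos len us (tgt' v) + len (tgt' v) ≤ pos len us r := by
        rw [e]; exact pos_after (e ▸ hu) hr
      omega

/-- The `+ 2` pays for reading `v` and, if the label is positive, the head of its edge. -/
theorem spec_incomingL {M : Model} {S : State} (h : Models M S) (hg : Graph M) {v : ℕ}
    (hv : v ∈ M.vs) (fuel : ℕ) :
    Spec (incomingL v fuel) S (min fuel (indeg M.us M.tgtL v + 1) + 2) 0
      (fun r S' => S' = S ∧ r = (M.us.filter (fun y => M.tgtL y = v)).take fuel) := by
  have ht := (hg.edgesF v hv).1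
  obtain ⟨A, B, e⟩ := List.append_of_mem ht
  have hf := filter_eq_takeWhile_of_edge hg.edgesL hg.edgesF hg.nodupU hg.nodupV hg.len_pos hv e
  rw [indeg, List.countP_eq_length_filter, hf]
  refine (Spec.bind spec_read (c' := 0)
    (k' := min fuel (((if M.labF v = 0 then M.tgtF v :: B else B).takeWhile
      (fun y => M.tgtL y = v)).length + 1) + 1) ?_).mono (by omega) le_rfl (fun _ _ h => h)
  rintro _ _ ⟨rfl, rfl⟩
  rw [h.labF, h.tgtF]
  split_ifs with h0
  · exact (spec_walkL h v fuel (R := M.tgtF v :: B) e).mono (by omega) le_rfl (fun _ _ h => h)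
  · refine (Spec.bind spec_read (c' := 0) ?_).mono (k := 1 + _) (by rw [add_comm]) le_rfl
      (fun _ _ h => h)
    rintro _ _ ⟨rfl, rfl⟩
    rw [(h.listU.link A _ B e).1]
    exact spec_walkL h v fuel (A := A ++ [M.tgtF v]) (by simp [e])

theorem spec_incomingF {M : Model} {S : State} (h : Models M S) (hg : Graph M) {u : ℕ}
    (hu : u ∈ M.us) (fuel : ℕ) :
    Spec (incomingF u fuel) S (min fuel (indeg M.vs M.tgtF u + 1) + 2) 0
      (fun r S' => S' = S ∧ r = (M.vs.filter (fun y => M.tgtF y = u)).take fuel) := by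
  have ht := (hg.edgesL u hu).1
  obtain ⟨A, B, e⟩ := List.append_of_mem ht
  have hf := filter_eq_takeWhile_of_edge hg.edgesF hg.edgesL hg.nodupV hg.nodupU
    (fun x hx => hg.len_pos x ((hg.mem_iff x).mpr hx)) hu e
  rw [indeg, List.countP_eq_length_filter, hf]
  refine (Spec.bind spec_read (c' := 0)
    (k' := min fuel (((if M.labL u = 0 then M.tgtL u :: B else B).takeWhile
      (fun y => M.tgtF y = u)).length + 1) + 1) ?_).mono (by omega) le_rfl (fun _ _ h => h)
  rintro _ _ ⟨rfl, rfl⟩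
  rw [h.labL, h.tgtL]
  split_ifs with h0
  · exact (spec_walkF h u fuel (R := M.tgtL u :: B) e).mono (by omega) le_rfl (fun _ _ h => h)
  · refine (Spec.bind spec_read (c' := 0) ?_).mono (k := 1 + _) (by rw [add_comm]) le_rfl
      (fun _ _ h => h)
    rintro _ _ ⟨rfl, rfl⟩
    rw [(h.listV.link A _ B e).1]
    exact spec_walkF h u fuel (A := A ++ [M.tgtL u]) (by simp [e])

/-- The cost is expressed by the nodes that start at or before the sought position, so that a caller
can bound it by an in-degree. Each pass consumes one unit of fuel while the next node has length at
least one, hence `off < len u + fuel` is inherited. -/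
theorem spec_locate {M : Model} {S : State} (h : Models M S) (hp : ∀ x ∈ M.us, 0 < M.len x)
    (hn : M.us.Nodup) (fuel : ℕ) {A B : List ℕ} {u off : ℕ} (e : M.us = A ++ u :: B)
    (ho : off < M.len u + fuel) (ht : pos M.len M.us u + off < total M.len M.us) :
    Spec (locate fuel u off) S
      (1 + B.countP (fun y => pos M.len M.us y ≤ pos M.len M.us u + off)) 0
      (fun r S' => S' = S ∧ r.1 ∈ M.us ∧ pos M.len M.us u + off = pos M.len M.us r.1 + r.2 ∧
        r.2 < M.len r.1) := by
  induction fuel generalizing A B u off with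
  | zero =>
    exact (Spec.pure ⟨rfl, by simp [e], rfl, by simpa using ho⟩).mono (by simp) le_rfl
      (fun _ _ h => h)
  | succ fuel ih =>
    refine Spec.bind spec_read (c' := 0) ?_
    rintro _ _ ⟨rfl, rfl⟩
    rw [h.len, (h.listU.link A _ B e).1]
    by_cases hc : off < M.len u
    · rw [if_pos hc]
      exact (Spec.pure ⟨rfl, by simp [e], rfl, hc⟩).mono (by simp) le_rfl (fun _ _ h => h)
    · rw [if_neg hc]
      cases B with
      | nil =>
        -- The last node extends to the end of the list, so the sought position cannot lie beyond
        -- it.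
        exfalso
        have h1 := pos_middle (len := M.len) (B := []) (notMem_left_of_nodup (e ▸ hn))
        rw [e] at ht
        simp only [total_append, total_cons, total_nil] at ht
        omega
      | cons b B =>
        have hb := hp b (by simp [e])
        have hub : pos M.len M.us b = pos M.len M.us u + M.len u := by
          have e' : M.us = (A ++ [u]) ++ b :: B := by simp [e]
          have h1 : pos M.len M.us u = total M.len A := by
            rw [e]; exact pos_middle (notMem_left_of_nodup (e ▸ hn))
          have h2 : pos M.len M.us b = total M.len (A ++ [u]) := by
            rw [e']; exact pos_middle (notMem_left_of_nodup (e' ▸ hn))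
          rw [h1, h2]; simp
        have heq : pos M.len M.us b + (off - M.len u) = pos M.len M.us u + off := by omega
        have := ih (A := A ++ [u]) (B := B) (u := b) (off := off - M.len u) (by simp [e])
          (by omega) (by omega)
        rw [heq] at this
        simp only [List.head?_cons]
        refine this.mono ?_ le_rfl (fun _ _ h => h)
        rw [List.countP_cons_of_pos (by simp; omega)]
        omega

/-! ## Specifications of the writing operations -/

theorem Models.updateMem {M : Model} {S : State} (h : Models M S) {mem' : ℕ → Cell}
    {chr len tgtL labL tgtF labF : ℕ → ℕ} {slot : ℕ → Option ℕ}
    (hl : ∀ y, (mem' y).prevU = (S.mem y).prevU ∧ (mem' y).nextU = (S.mem y).nextU ∧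
      (mem' y).prevV = (S.mem y).prevV ∧ (mem' y).nextV = (S.mem y).nextV)
    (hd : ∀ y, (mem' y).chr = chr y ∧ (mem' y).len = len y ∧ (mem' y).tgtL = tgtL y ∧
      (mem' y).labL = labL y ∧ (mem' y).tgtF = tgtF y ∧ (mem' y).labF = labF y ∧
      (mem' y).slot = slot y) :
    Models { M with chr := chr, len := len, tgtL := tgtL, labL := labL, tgtF := tgtF,
                    labF := labF, slot := slot } { S with mem := mem' } where
  listU := h.listU.congr rfl rfl (fun y => (hl y).1) (fun y => (hl y).2.1)
  listV := h.listV.congr rfl rfl (fun y => (hl y).2.2.1) (fun y => (hl y).2.2.2)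
  order := h.order
  chr y := (hd y).1
  len y := (hd y).2.1
  tgtL y := (hd y).2.2.1
  labL y := (hd y).2.2.2.1
  tgtF y := (hd y).2.2.2.2.1
  labF y := (hd y).2.2.2.2.2.1
  slot y := (hd y).2.2.2.2.2.2
  slots := h.slots
  fresh := h.fresh
  dol := h.dol
  tree := h.tree
  heavyU := h.heavyU
  heavyV := h.heavyV

theorem LL.congr_mem {l : List ℕ} {first last : Option ℕ}
    {prev next prev' next' : ℕ → Option ℕ} (h : LL l first last prev next)
    (hp : ∀ y ∈ l, prev' y = prev y) (hn : ∀ y ∈ l, next' y = next y) :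
    LL l first last prev' next' := by
  refine ⟨h.nodup, h.first, h.last, ?_⟩
  rintro A x B rfl
  rw [hp x (by simp), hn x (by simp)]
  exact h.link A x B rfl

theorem spec_alloc {M : Model} {S : State} (h : Models M S) (hu : M.fresh ∉ M.us)
    (hv : M.fresh ∉ M.vs) (c : Cell) :
    Spec (alloc c) S 1 0 (fun r S' => r = M.fresh ∧ Models
      { M with
        chr := Function.update M.chr M.fresh c.chr
        len := Function.update M.len M.fresh c.len
        tgtL := Function.update M.tgtL M.fresh c.tgtL
        labL := Function.update M.labL M.fresh c.labL
        tgtF := Function.update M.tgtF M.fresh c.tgtF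
        labF := Function.update M.labF M.fresh c.labF
        slot := Function.update M.slot M.fresh c.slot
        fresh := M.fresh + 1 } S') := by
  refine ⟨le_rfl, le_rfl, h.fresh, ?_⟩
  have hne : ∀ {l : List ℕ}, M.fresh ∉ l → ∀ y ∈ l, y ≠ M.fresh := by
    rintro l hl y hy rfl; exact hl hy
  constructor
  case listU =>
    refine h.listU.congr_mem ?_ ?_ <;> intro y hy <;>
      simp [alloc, h.fresh, hne hu y hy]
  case listV =>
    refine h.listV.congr_mem ?_ ?_ <;> intro y hy <;>
      simp [alloc, h.fresh, hne hv y hy]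
  all_goals first
    | intro y
      simp only [alloc, Function.update_apply, h.fresh]
      split_ifs <;> simp [h.chr, h.len, h.tgtL, h.labL, h.tgtF, h.labF, h.slot]
    | simp [alloc, h.slots, h.fresh, h.dol, h.tree, h.heavyU, h.heavyV, h.order]

/-- The effect of `replaceInTree` on the model. -/
def Model.replaceInTree (M : Model) (y x a : ℕ) : Model :=
  match M.slot y with
  | some s => { M with
      slots := Function.update M.slots s (x, a)
      slot := Function.update (Function.update M.slot y none) x (some s) }
  | none => M

theorem spec_replaceInTree {M : Model} {S : State} (h : Models M S) (y x a : ℕ) :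
    Spec (replaceInTree y x a) S 6 0 (fun _ S' => Models (M.replaceInTree y x a) S') := by
  refine (Spec.bind spec_read (c' := 0) (k' := 5) ?_)
  rintro _ _ ⟨rfl, rfl⟩
  rw [h.slot, Model.replaceInTree]
  cases hs : M.slot y with
  | none => exact (Spec.pure h).mono (by simp) le_rfl (fun _ _ h => h)
  | some s =>
    refine ⟨le_rfl, le_rfl, ?_⟩
    simp only [Bind.bind, modifyCell, read, write, writeSlot]
    constructor
    case listU => refine h.listU.congr rfl rfl ?_ ?_ <;> intro z <;>
                    simp only [Function.update_apply] <;> grind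
    case listV => refine h.listV.congr rfl rfl ?_ ?_ <;> intro z <;>
                    simp only [Function.update_apply] <;> grind
    all_goals first
      | intro z
        have h1 := h.chr z
        have h2 := h.len z
        have h3 := h.tgtL z
        have h4 := h.labL z
        have h5 := h.tgtF z
        have h6 := h.labF z
        have h7 := h.slot z
        simp only [Function.update_apply]
        grind
      | simp [h.slots, h.fresh, h.dol, h.tree, h.heavyU, h.heavyV, h.order]

theorem Graph.fresh_notMem {M : Model} (h : Graph M) : M.fresh ∉ M.us := fun hm =>
  lt_irrefl _ (h.lt_fresh _ hm)

theorem Graph.fresh_notMemV {M : Model} (h : Graph M) : M.fresh ∉ M.vs := fun hm =>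
  h.fresh_notMem ((h.mem_iff _).mpr hm)

theorem spec_setLen {M : Model} {S : State} (h : Models M S) (j d : ℕ) :
    Spec (modifyCell j (fun c => { c with len := d })) S 2 0
      (fun _ S' => Models { M with len := Function.update M.len j d } S') := by
  refine spec_modifyCell.mono le_rfl le_rfl ?_
  rintro _ _ rfl
  refine h.updateMem (chr := M.chr) (tgtL := M.tgtL) (labL := M.labL) (tgtF := M.tgtF)
    (labF := M.labF) (slot := M.slot) ?_ ?_ <;> intro y <;> simp only [Function.update_apply] <;>
    split_ifs <;> simp_all [h.chr, h.len, h.tgtL, h.labL, h.tgtF, h.labF, h.slot]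

theorem spec_forM_tgtF {M : Model} {S : State} (h : Models M S) {l : List ℕ} (hl : l.Nodup)
    {f : Cell → Cell} (p q : ℕ → ℕ → ℕ)
    (hf : ∀ c, f c = { c with tgtF := p c.tgtF c.labF, labF := q c.tgtF c.labF }) :
    Spec (l.forM fun v => modifyCell v f) S (2 * l.length) 0 (fun _ S' => Models
      { M with
        tgtF := fun y => if y ∈ l then p (M.tgtF y) (M.labF y) else M.tgtF y
        labF := fun y => if y ∈ l then q (M.tgtF y) (M.labF y) else M.labF y } S') := by
  refine (spec_forM_modifyCell hl).mono le_rfl le_rfl ?_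
  rintro _ _ rfl
  refine h.updateMem (chr := M.chr) (len := M.len) (tgtL := M.tgtL) (labL := M.labL)
    (slot := M.slot) ?_ ?_ <;> intro y <;> simp only [hf] <;>
    split_ifs <;> simp [h.chr, h.len, h.tgtL, h.labL, h.tgtF, h.labF, h.slot]

theorem spec_forM_tgtL {M : Model} {S : State} (h : Models M S) {l : List ℕ} (hl : l.Nodup)
    {f : Cell → Cell} (p q : ℕ → ℕ → ℕ)
    (hf : ∀ c, f c = { c with tgtL := p c.tgtL c.labL, labL := q c.tgtL c.labL }) :
    Spec (l.forM fun v => modifyCell v f) S (2 * l.length) 0 (fun _ S' => Models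
      { M with
        tgtL := fun y => if y ∈ l then p (M.tgtL y) (M.labL y) else M.tgtL y
        labL := fun y => if y ∈ l then q (M.tgtL y) (M.labL y) else M.labL y } S') := by
  refine (spec_forM_modifyCell hl).mono le_rfl le_rfl ?_
  rintro _ _ rfl
  refine h.updateMem (chr := M.chr) (len := M.len) (tgtF := M.tgtF) (labF := M.labF)
    (slot := M.slot) ?_ ?_ <;> intro y <;> simp only [hf] <;>
    split_ifs <;> simp [h.chr, h.len, h.tgtL, h.labL, h.tgtF, h.labF, h.slot]

/-- The effect of `splitNode` on the model, except for the B-tree. The second part of `v_j` starts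
`off` positions after the start of `u_h`. -/
def Model.split (M : Model) (j d z h off : ℕ) : Model :=
  { M with
    us := insertAfter j M.fresh M.us
    vs := insertAfter j M.fresh M.vs
    chr := Function.update M.chr M.fresh (M.chr j)
    len := Function.update (Function.update M.len M.fresh (M.len j - d)) j d
    tgtL := fun y => if y ∈ M.us ∧ M.tgtL y = j ∧ d ≤ M.labL y then M.fresh
      else Function.update M.tgtL M.fresh z y
    labL := fun y => if y ∈ M.us ∧ M.tgtL y = j ∧ d ≤ M.labL y then M.labL y - d
      else Function.update M.labL M.fresh 0 y
    tgtF := fun y => if (y ∈ M.vs ∨ y = M.fresh) ∧ Function.update M.tgtF M.fresh h y = j ∧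
        d ≤ Function.update M.labF M.fresh off y then M.fresh
      else Function.update M.tgtF M.fresh h y
    labF := fun y => if (y ∈ M.vs ∨ y = M.fresh) ∧ Function.update M.tgtF M.fresh h y = j ∧
        d ≤ Function.update M.labF M.fresh off y then Function.update M.labF M.fresh off y - d
      else Function.update M.labF M.fresh off y
    slot := Function.update M.slot M.fresh none
    fresh := M.fresh + 1 }

/-- Besides a constant number of records, the program visits the tails of the edges to `u_j` and to
`v_j` and the nodes passed by `locate`. Each of these groups has at most `K` members. -/
theorem spec_splitNode {M : Model} {S : State} (h : Models M S) (hg : Graph M) {j d z K : ℕ}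
    (hj : j ∈ M.us) (hd : d < M.len j) (hF : indeg M.vs M.tgtF j ≤ K)
    (hL : indeg M.us M.tgtL j ≤ K) :
    Spec (splitNode j d z) S (7 * K + 37) 1 (fun r S' => r = M.fresh ∧ ∃ h off, h ∈ M.us ∧
      pos M.len M.vs j + d = pos M.len M.us h + off ∧ off < M.len h ∧
      Models ((M.split j d z h off).replaceInTree j M.fresh (M.chr j)) S') := by
  have hjv := (hg.mem_iff j).mp hj
  have hfu := hg.fresh_notMem
  have hfv := hg.fresh_notMemV
  have hjf : j ≠ M.fresh := by rintro rfl; exact hfu hj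
  have hlenF : indeg M.vs M.tgtF j ≤ M.len j :=
    indeg_le_len hg.edgesF hg.nodupV (fun x hx => hg.len_pos x ((hg.mem_iff x).mpr hx))
  have hlenL : indeg M.us M.tgtL j ≤ M.len j := indeg_le_len hg.edgesL hg.nodupU hg.len_pos
  have hlenF' := hlenF
  have hlenL' := hlenL
  rw [indeg, List.countP_eq_length_filter] at hlenF' hlenL'
  obtain ⟨ht, hpos, hlab⟩ := hg.edgesF j hjv
  obtain ⟨A, B, e⟩ := List.append_of_mem ht
  obtain ⟨A1, B1, e1⟩ := List.append_of_mem hj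
  obtain ⟨A2, B2, e2⟩ := List.append_of_mem hjv
  -- the number of nodes passed by `locate`
  have hloc : B.countP (fun y => pos M.len M.us y ≤ pos M.len M.us (M.tgtF j) + (M.labF j + d)) ≤
      K := by
    refine le_trans ?_ hL
    rw [indeg, e, List.countP_append, List.countP_cons]
    refine le_trans (List.countP_mono_left (q := fun y => decide (M.tgtL y = j)) ?_) (by omega)
    intro y hy hle
    have h5 := pos_after (len := M.len) (e ▸ hg.nodupU : (A ++ M.tgtF j :: B).Nodup) hy
    rw [decide_eq_true_eq] at hle ⊢
    rw [← e] at h5 hle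
    -- A node behind the head of the edge from `v_j` that starts no later than the cut starts inside
    -- the interval of `v_j`; so it is a tail of an edge to `v_j`.
    rw [hg.edgesL.tgt_eq_iff hg.nodupV (by simp [e, hy]) hjv]
    omega
  have hlt : pos M.len M.us (M.tgtF j) + (M.labF j + d) < total M.len M.us := by
    have := pos_add_le_total (len := M.len) hjv
    rw [hg.total_eq]
    omega
  -- The listings are complete, because their fuel is the length of the node.
  have hinF : ∀ {k}, M.len j = k → List.take k (M.vs.filter (fun y => M.tgtF y = j)) =
      M.vs.filter (fun y => M.tgtF y = j) := by
    rintro k rfl; exact List.take_of_length_le hlenF'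
  have hinL : ∀ {k}, M.len j = k → List.take k (M.us.filter (fun y => M.tgtL y = j)) =
      M.us.filter (fun y => M.tgtL y = j) := by
    rintro k rfl; exact List.take_of_length_le hlenL'
  unfold splitNode
  refine Spec.mono (k := 1 + ((K + 3) + ((K + 3) + ((1 + K) + (1 + (9 + (9 + (2 + ((2 * (K + 1)) +
    (2 * K + (6 + 0)))))))))))
    (c := 0 + (0 + (0 + (0 + (0 + (1 + (0 + (0 + (0 + (0 + (0 + 0)))))))))))
    (Q := fun r S' => r = M.fresh ∧ ∃ h off, h ∈ M.us ∧
      pos M.len M.vs j + d = pos M.len M.us h + off ∧ off < M.len h ∧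
      Models ((M.split j d z h off).replaceInTree j M.fresh (M.chr j)) S')
    (Spec.bind spec_read ?_) (by omega) (by omega) (fun _ _ h => h)
  rintro _ _ ⟨rfl, rfl⟩
  refine Spec.bind ((spec_incomingF h hg hj _).mono (by omega) le_rfl (fun _ _ h => h)) ?_
  rintro _ _ ⟨rfl, rfl⟩
  refine Spec.bind ((spec_incomingL h hg hjv _).mono (by omega) le_rfl (fun _ _ h => h)) ?_
  rintro _ _ ⟨rfl, rfl⟩
  rw [hinF (h.len j).symm, hinL (h.len j).symm, h.len, h.tgtF, h.labF, h.chr]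
  refine Spec.bind ((spec_locate h hg.len_pos hg.nodupU _ e (by omega) hlt).mono (by omega) le_rfl
    (fun _ _ h => h)) ?_
  rintro ⟨t, off⟩ _ ⟨rfl, ht', hpos', hoff⟩
  dsimp only at ht' hpos' hoff ⊢
  refine Spec.bind (spec_alloc h hfu hfv _) ?_
  rintro _ S1 ⟨rfl, h1⟩
  refine Spec.bind (spec_insertU h1 (A := A1) (B := B1) e1 hfu) ?_
  rintro _ S2 h2
  refine Spec.bind (spec_insertV h2 (A := A2) (B := B2) e2 hfv) ?_
  rintro _ S3 h3
  refine Spec.bind (spec_setLen h3 j d) ?_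
  rintro _ S4 h4
  -- The cut of `v_j` may lie inside `u_j` itself, so the edge of the new `v`-node is redirected
  -- together with the old ones.
  have hnd : (M.vs.filter (fun y => M.tgtF y = j) ++ [M.fresh]).Nodup := by
    rw [List.nodup_append]
    refine ⟨hg.nodupV.filter _, by simp, ?_⟩
    intro a ha b hb hab
    simp only [List.mem_singleton] at hb
    subst hb; subst hab
    exact hfv (List.mem_filter.mp ha).1
  refine Spec.bind ((spec_forM_tgtF h4 hnd (fun t o => if t = j ∧ d ≤ o then M.fresh else t)
    (fun t o => if t = j ∧ d ≤ o then o - d else o) ?_).mono ?_ le_rfl (fun _ _ h => h)) ?_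
  · intro c; split_ifs <;> rfl
  · rw [List.length_append, ← List.countP_eq_length_filter]
    simp only [indeg] at hF
    simp; omega
  rintro _ S5 h5
  refine Spec.bind ((spec_forM_tgtL h5 (hg.nodupU.filter _)
    (fun t o => if d ≤ o then M.fresh else t) (fun t o => if d ≤ o then o - d else o) ?_).mono
    ?_ le_rfl (fun _ _ h => h)) ?_
  · intro c; split_ifs <;> rfl
  · rw [← List.countP_eq_length_filter]
    simp only [indeg] at hL
    omega
  rintro _ S6 h6
  have h6' : Models (M.split j d z t off) S6 := by
    convert h6 using 1
    have i1 : insertAfter j M.fresh M.us = A1 ++ j :: M.fresh :: B1 := by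
      have hnd1 := hg.nodupU
      rw [e1] at hnd1 ⊢; exact insertAfter_append (notMem_left_of_nodup hnd1)
    have i2 : insertAfter j M.fresh M.vs = A2 ++ j :: M.fresh :: B2 := by
      have hnd1 := hg.nodupV
      rw [e2] at hnd1 ⊢; exact insertAfter_append (notMem_left_of_nodup hnd1)
    simp only [Model.split, i1, i2, List.mem_append, List.mem_filter,
        List.mem_singleton, decide_eq_true_eq]
    congr 1 <;> funext y <;> by_cases hy : y = M.fresh <;>
      simp [hy, hfu, hfv] <;> grind
  refine Spec.bind (spec_replaceInTree h6' j M.fresh (M.chr j)) ?_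
  rintro _ S7 h7
  exact Spec.pure ⟨rfl, t, off, ht', by omega, hoff, h7⟩

/-- The effect of `mergeNodes` on the model, except for the B-tree. -/
def Model.merge (M : Model) (p q : ℕ) : Model :=
  { M with
    us := M.us.erase q
    vs := M.vs.erase q
    len := Function.update M.len p (M.len p + M.len q)
    tgtL := fun y => if y ∈ M.us ∧ M.tgtL y = q then p else M.tgtL y
    labL := fun y => if y ∈ M.us ∧ M.tgtL y = q then M.len p + M.labL y else M.labL y
    tgtF := fun y => if y ∈ M.vs ∧ M.tgtF y = q then p else M.tgtF y
    labF := fun y => if y ∈ M.vs ∧ M.tgtF y = q then M.len p + M.labF y else M.labF y }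

theorem erase_append_cons {A B : List ℕ} {x : ℕ} (h : (A ++ x :: B).Nodup) :
    (A ++ x :: B).erase x = A ++ B := by
  simp [List.erase_append_right _ (notMem_left_of_nodup h)]

/-- Only edges into the absorbed node are rewritten. The cost depends on the in-degrees of `q`
alone, however many edges lead to `p`. -/
theorem spec_mergeNodes {M : Model} {S : State} (h : Models M S) (hg : Graph M) {p q K : ℕ}
    (hq : q ∈ M.us) (hF : indeg M.vs M.tgtF q ≤ K) (hL : indeg M.us M.tgtL q ≤ K) :
    Spec (mergeNodes p q) S (6 * K + 26) 1 (fun _ S' =>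
      Models ((M.merge p q).replaceInTree q p (M.chr p)) S') := by
  have hqv := (hg.mem_iff q).mp hq
  have hlenF : indeg M.vs M.tgtF q ≤ M.len q :=
    indeg_le_len hg.edgesF hg.nodupV (fun x hx => hg.len_pos x ((hg.mem_iff x).mpr hx))
  have hlenL : indeg M.us M.tgtL q ≤ M.len q := indeg_le_len hg.edgesL hg.nodupU hg.len_pos
  rw [indeg, List.countP_eq_length_filter] at hlenF hlenL
  obtain ⟨A1, B1, e1⟩ := List.append_of_mem hq
  obtain ⟨A2, B2, e2⟩ := List.append_of_mem hqv
  have hinF : ∀ {k}, M.len q = k → List.take k (M.vs.filter (fun y => M.tgtF y = q)) =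
      M.vs.filter (fun y => M.tgtF y = q) := by
    rintro k rfl; exact List.take_of_length_le hlenF
  have hinL : ∀ {k}, M.len q = k → List.take k (M.us.filter (fun y => M.tgtL y = q)) =
      M.us.filter (fun y => M.tgtL y = q) := by
    rintro k rfl; exact List.take_of_length_le hlenL
  unfold mergeNodes
  refine Spec.mono (k := 1 + (1 + ((K + 3) + ((K + 3) + (2 * K + (2 * K + (5 + (5 + (2 + 6)))))))))
    (c := 0 + (0 + (0 + (0 + (0 + (0 + (1 + (0 + (0 + 0)))))))))
    (Q := fun _ S' => Models ((M.merge p q).replaceInTree q p (M.chr p)) S')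
    (Spec.bind spec_read ?_) (by omega) (by omega) (fun _ _ h => h)
  rintro _ _ ⟨rfl, rfl⟩
  refine Spec.bind spec_read ?_
  rintro _ _ ⟨rfl, rfl⟩
  refine Spec.bind ((spec_incomingF h hg hq _).mono (by omega) le_rfl (fun _ _ h => h)) ?_
  rintro _ _ ⟨rfl, rfl⟩
  refine Spec.bind ((spec_incomingL h hg hqv _).mono (by omega) le_rfl (fun _ _ h => h)) ?_
  rintro _ _ ⟨rfl, rfl⟩
  rw [hinF (h.len q).symm, hinL (h.len q).symm, h.len, h.len, h.chr]
  refine Spec.bind ((spec_forM_tgtF h (hg.nodupV.filter _) (fun _ _ => p)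
    (fun _ o => M.len p + o) (fun _ => rfl)).mono ?_ le_rfl (fun _ _ h => h)) ?_
  · rw [← List.countP_eq_length_filter]
    simp only [indeg] at hF
    omega
  rintro _ S1 h1
  refine Spec.bind ((spec_forM_tgtL h1 (hg.nodupU.filter _) (fun _ _ => p)
    (fun _ o => M.len p + o) (fun _ => rfl)).mono ?_ le_rfl (fun _ _ h => h)) ?_
  · rw [← List.countP_eq_length_filter]
    simp only [indeg] at hL
    omega
  rintro _ S2 h2
  refine Spec.bind (spec_removeU h2 e1) ?_
  rintro _ S3 h3
  refine Spec.bind (spec_removeV h3 e2) ?_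
  rintro _ S4 h4
  refine Spec.bind (spec_setLen h4 p _) ?_
  rintro _ S5 h5
  have h5' : Models (M.merge p q) S5 := by
    convert h5 using 1
    have i1 : M.us.erase q = A1 ++ B1 := by
      have hnd1 := hg.nodupU
      rw [e1] at hnd1 ⊢; exact erase_append_cons hnd1
    have i2 : M.vs.erase q = A2 ++ B2 := by
      have hnd1 := hg.nodupV
      rw [e2] at hnd1 ⊢; exact erase_append_cons hnd1
    simp only [Model.merge, i1, i2, List.mem_filter, decide_eq_true_eq]
  exact spec_replaceInTree h5' q p (M.chr p)

/-- The effect of `replaceAndInsert` on the model, except for the B-tree, if the new lists are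
`us` and `vs`. -/
def Model.insertDollar (M : Model) (c : ℕ) (us vs : List ℕ) : Model :=
  { M with
    us := us
    vs := vs
    chr := Function.update (Function.update M.chr M.fresh dollar) M.dol c
    len := Function.update M.len M.fresh 1
    tgtL := Function.update (Function.update M.tgtL M.fresh M.dol) (M.tgtF M.dol) M.fresh
    labL := Function.update M.labL M.fresh 0
    tgtF := Function.update (Function.update M.tgtF M.fresh (M.tgtF M.dol)) M.dol M.fresh
    labF := Function.update (Function.update M.labF M.fresh (M.labF M.dol)) M.dol 0
    slot := Function.update M.slot M.fresh none
    fresh := M.fresh + 1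
    dol := M.fresh }

theorem spec_setTgtL {M : Model} {S : State} (h : Models M S) (j x : ℕ) :
    Spec (modifyCell j (fun c => { c with tgtL := x })) S 2 0
      (fun _ S' => Models { M with tgtL := Function.update M.tgtL j x } S') := by
  refine spec_modifyCell.mono le_rfl le_rfl ?_
  rintro _ _ rfl
  refine h.updateMem (chr := M.chr) (len := M.len) (labL := M.labL) (tgtF := M.tgtF)
    (labF := M.labF) (slot := M.slot) ?_ ?_ <;> intro y <;> simp only [Function.update_apply] <;>
    split_ifs <;> simp_all [h.chr, h.len, h.tgtL, h.labL, h.tgtF, h.labF, h.slot]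

theorem spec_setChr {M : Model} {S : State} (h : Models M S) (j c x : ℕ) :
    Spec (modifyCell j (fun d => { d with chr := c, tgtF := x, labF := 0 })) S 2 0
      (fun _ S' => Models { M with
        chr := Function.update M.chr j c
        tgtF := Function.update M.tgtF j x
        labF := Function.update M.labF j 0 } S') := by
  refine spec_modifyCell.mono le_rfl le_rfl ?_
  rintro _ _ rfl
  refine h.updateMem (len := M.len) (tgtL := M.tgtL) (labL := M.labL)
    (slot := M.slot) ?_ ?_ <;> intro y <;> simp only [Function.update_apply] <;>
    split_ifs <;> simp_all [h.chr, h.len, h.tgtL, h.labL, h.tgtF, h.labF, h.slot]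

theorem spec_setDol {M : Model} {S : State} (h : Models M S) (x : ℕ) :
    Spec (modifyRegs (fun r => { r with dol := x })) S 2 0
      (fun _ S' => Models { M with dol := x } S') :=
  ⟨le_rfl, le_rfl, { h with dol := rfl }⟩

theorem spec_replaceAndInsert {M : Model} {S : State} (h : Models M S) (hg : Graph M)
    {c w : ℕ} {U1 U2 V1 V2 : List ℕ} (eU : M.us = U1 ++ w :: U2)
    (eV : M.vs = M.dol :: (V1 ++ V2)) :
    Spec (replaceAndInsert c w V2.head?) S 41 1 (fun _ S' =>
      Models ((M.insertDollar c (U1 ++ w :: M.fresh :: U2)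
        (M.fresh :: (V1 ++ M.dol :: V2))).replaceInTree M.dol M.fresh dollar) S') := by
  have hfu := hg.fresh_notMem
  have hfv := hg.fresh_notMemV
  have hdf : M.dol ≠ M.fresh := by
    intro hh; exact hfu (hh ▸ hg.dol_mem)
  have hnV := hg.nodupV
  -- The new `dollar` node already stands at the front of `V` when the node `(c, 1)` is inserted, so
  -- there is always a predecessor `g`, and both branches of the program find it.
  obtain ⟨G, g, hG⟩ : ∃ G g, M.fresh :: V1 = G ++ [g] := by
    rcases List.eq_nil_or_concat (M.fresh :: V1) with hh | ⟨G, g, hh⟩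
    · simp at hh
    · exact ⟨G, g, by simpa using hh⟩
  have eG : ∀ W, M.fresh :: (V1 ++ W) = G ++ g :: W := by
    intro W
    rw [← List.cons_append, hG]; simp
  have hdn : M.dol ∉ M.fresh :: (V1 ++ V2) := by
    rw [eV, List.nodup_cons] at hnV
    simp only [List.mem_cons, hdf, false_or]
    exact hnV.1
  unfold replaceAndInsert
  refine Spec.mono (k := 1 + (1 + (1 + (9 + (7 + (10 + (2 + (2 + (6 + 2)))))))))
    (c := 0 + (0 + (0 + (1 + (0 + (0 + (0 + (0 + (0 + 0)))))))))
    (Q := fun _ S' => Models ((M.insertDollar c (U1 ++ w :: M.fresh :: U2)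
        (M.fresh :: (V1 ++ M.dol :: V2))).replaceInTree M.dol M.fresh dollar) S')
    (Spec.bind spec_readRegs ?_) (by omega) (by omega) (fun _ _ h => h)
  rintro _ _ ⟨rfl, rfl⟩
  dsimp only
  rw [h.dol]
  refine Spec.bind spec_read ?_
  rintro _ _ ⟨rfl, rfl⟩
  rw [h.tgtF, h.labF]
  refine Spec.bind (spec_alloc h hfu hfv _) ?_
  rintro _ S1 ⟨rfl, h1⟩
  refine Spec.bind (spec_insertU h1 (A := U1) (B := U2) eU hfu) ?_
  rintro _ S2 h2
  refine Spec.bind (spec_replaceV h2 (B := V1 ++ V2) eV hfv) ?_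
  rintro _ S3 h3
  -- insertion of the old dollar node into the list of `V`
  have ins := spec_insertV h3 (A := G) (B := V2) (w := g) (x := M.dol) (eG V2) hdn
  rw [← eG] at ins
  refine Spec.mono (k := 1 + (9 + (2 + (2 + (6 + 2))))) (c := 0 + (0 + (0 + (0 + (0 + 0)))))
    (Q := fun _ S' => Models ((M.insertDollar c (U1 ++ w :: M.fresh :: U2)
        (M.fresh :: (V1 ++ M.dol :: V2))).replaceInTree M.dol M.fresh dollar) S')
    ?_ (by omega) (by omega) (fun _ _ h => h)
  cases V2
  case' nil =>
    refine Spec.bind spec_readRegs ?_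
    rintro _ _ ⟨rfl, rfl⟩
    have hl := h3.listV.last
    simp only [eG, List.getLast?_append, List.getLast?_singleton, Option.some_or] at hl
    rw [hl]
    refine Spec.bind ins ?_
  case' cons z V2 =>
    refine Spec.bind spec_read ?_
    rintro _ _ ⟨rfl, rfl⟩
    have hl := (h3.listV.link (G ++ [g]) z V2 (by simp [eG])).2
    simp only [List.getLast?_append, List.getLast?_singleton, Option.some_or] at hl
    rw [hl]
    refine Spec.bind ins ?_
  all_goals
    rintro _ S4 h4
    refine Spec.bind (spec_setTgtL h4 _ _) ?_
    rintro _ S5 h5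
    refine Spec.bind (spec_setChr h5 _ _ _) ?_
    rintro _ S6 h6
    refine Spec.bind (spec_replaceInTree h6 M.dol M.fresh dollar) ?_
    rintro _ S7 h7
    refine (spec_setDol h7 M.fresh).mono le_rfl le_rfl ?_
    rintro _ S8 h8
    convert h8 using 1
    simp only [Model.insertDollar, Model.replaceInTree]
    split <;> rfl

/-! ## The operations preserve the invariant of the graph -/

theorem nodup_insert {A B : List ℕ} {x : ℕ} (h : (A ++ B).Nodup) (hx : x ∉ A ++ B) :
    (A ++ x :: B).Nodup :=
  List.perm_middle.nodup_iff.mpr (List.nodup_cons.mpr ⟨hx, h⟩)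

/-- The two parts cover exactly the old interval of `j`, so no other interval moves. -/
theorem pos_split {A B : List ℕ} {len : ℕ → ℕ} {j n d : ℕ} (hd : d < len j)
    (hnd : (A ++ j :: B).Nodup) (hn : n ∉ A ++ j :: B) :
    (∀ y ∈ A ++ j :: B, pos (Function.update (Function.update len n (len j - d)) j d)
      (A ++ j :: n :: B) y = pos len (A ++ j :: B) y) ∧
    pos (Function.update (Function.update len n (len j - d)) j d) (A ++ j :: n :: B) n =
      pos len (A ++ j :: B) j + d := by
  have hjA := notMem_left_of_nodup hnd
  have hjB := notMem_right_of_nodup hnd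
  simp only [List.mem_append, List.mem_cons, not_or] at hn
  have hA : ∀ y ∈ A, len y = Function.update (Function.update len n (len j - d)) j d y := by
    intro y hy
    rw [Function.update_of_ne (by rintro rfl; exact hjA hy),
      Function.update_of_ne (by rintro rfl; exact hn.1 hy)]
  have hB : ∀ y ∈ B, len y = Function.update (Function.update len n (len j - d)) j d y := by
    intro y hy
    rw [Function.update_of_ne (by rintro rfl; exact hjB hy),
      Function.update_of_ne (by rintro rfl; exact hn.2.2 hy)]
  constructor
  · intro y hy
    by_cases hyA : y ∈ A
    · rw [pos_append_of_mem hyA, pos_append_of_mem hyA, pos_congr hA]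
    · rw [pos_append_of_notMem hyA, pos_append_of_notMem hyA, total_congr hA]
      congr 1
      by_cases hyj : y = j
      · simp [pos, hyj]
      · simp only [List.mem_append, hyA, List.mem_cons, hyj, false_or] at hy
        have hyn : y ≠ n := by rintro rfl; exact hn.2.2 hy
        simp only [pos, hyj, hyn, if_false, ← pos_congr hB, Function.update_self,
          Function.update_of_ne hn.2.1]
        omega
  · rw [pos_append_of_notMem hn.1, pos_middle hjA, total_congr hA]
    simp [pos, hn.2.1]

/-- The hypothesis `h` locates each start in the unsplit target list, as offset `o` in `t`. If it
falls behind the cut of `j`, the edge leads to the second part, with an offset smaller by `d`. The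
lemma serves for both kinds of edges. -/
theorem Edges.split {A B A' B' : List ℕ} {len tgt lab : ℕ → ℕ} {j n d : ℕ}
    (hd : d < len j) (hu : (A ++ j :: B).Nodup) (hn : n ∉ A ++ j :: B)
    (hv : (A' ++ j :: B').Nodup) (hnv : n ∉ A' ++ j :: B')
    (h : ∀ x ∈ A ++ j :: n :: B, ∃ t o, t ∈ A' ++ j :: B' ∧
      (if x = n then pos len (A ++ j :: B) j + d else pos len (A ++ j :: B) x) =
        pos len (A' ++ j :: B') t + o ∧ o < len t ∧
      tgt x = (if t = j ∧ d ≤ o then n else t) ∧ lab x = (if t = j ∧ d ≤ o then o - d else o)) :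
    Edges (A ++ j :: n :: B) (A' ++ j :: n :: B')
      (Function.update (Function.update len n (len j - d)) j d) tgt lab := by
  obtain ⟨p1, p2⟩ := pos_split hd hu hn
  obtain ⟨q1, q2⟩ := pos_split hd hv hnv
  intro x hx
  obtain ⟨t, o, ht, e, ho, h1, h2⟩ := h x hx
  have hjn : j ≠ n := by rintro rfl; simp at hn
  have hpx : pos (Function.update (Function.update len n (len j - d)) j d) (A ++ j :: n :: B) x =
      pos len (A' ++ j :: B') t + o := by
    rw [← e]
    split_ifs with hxn
    · rw [hxn, p2]
    · refine p1 x ?_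
      simpa [hxn] using hx
  rw [hpx, h1, h2]
  by_cases hc : t = j ∧ d ≤ o
  · rw [if_pos hc, if_pos hc, q2]
    obtain ⟨rfl, hdo⟩ := hc
    rw [Function.update_of_ne hjn.symm, Function.update_self]
    exact ⟨by simp, by omega, by omega⟩
  · rw [if_neg hc, if_neg hc, q1 t ht]
    refine ⟨?_, rfl, ?_⟩
    · simp only [List.mem_append, List.mem_cons] at ht ⊢
      tauto
    · by_cases htj : t = j
      · subst htj
        rw [Function.update_self]
        simp only [true_and, not_le] at hc
        exact hc
      · have htn : t ≠ n := by rintro rfl; exact hnv ht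
        rwa [Function.update_of_ne htj, Function.update_of_ne htn]

/-- The second part carries the character of `j` and follows it in both lists. So a character class
changes by the same operation in `U` and in `V`, and stability survives. -/
theorem filter_split {A B : List ℕ} {chr : ℕ → ℕ} {j n : ℕ} (a : ℕ) (hn : n ∉ A ++ j :: B)
    (hj : j ∉ A) :
    (A ++ j :: n :: B).filter (fun x => Function.update chr n (chr j) x = a) =
      if chr j = a then insertAfter j n ((A ++ j :: B).filter (fun x => chr x = a))
      else (A ++ j :: B).filter (fun x => chr x = a) := by
  simp only [List.mem_append, List.mem_cons, not_or] at hn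
  have hA : A.filter (fun x => Function.update chr n (chr j) x = a) =
      A.filter (fun x => chr x = a) := by
    refine List.filter_congr fun x hx => ?_
    rw [Function.update_of_ne (by rintro rfl; exact hn.1 hx)]
  have hB : B.filter (fun x => Function.update chr n (chr j) x = a) =
      B.filter (fun x => chr x = a) := by
    refine List.filter_congr fun x hx => ?_
    rw [Function.update_of_ne (by rintro rfl; exact hn.2.2 hx)]
  rw [List.filter_append, List.filter_cons, List.filter_cons, hA, hB, List.filter_append,
    List.filter_cons, Function.update_self, Function.update_of_ne (Ne.symm hn.2.1)]
  split_ifs with h1 h2 h2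
  · rw [insertAfter_append]
    simp [hj]
  all_goals simp_all

/-- `z` is the F-interval that starts at the cut of `u_j`, which gives the edge of the second part
of `u_j` without a search; `h` and `off` tell where the cut of `v_j` falls in `U`. -/
theorem Graph.split {M : Model} (hg : Graph M) {j d z h off : ℕ} (hj : j ∈ M.us)
    (hd0 : 0 < d) (hd : d < M.len j) (hz : z ∈ M.vs) (ez : pos M.len M.us j + d = pos M.len M.vs z)
    (hh : h ∈ M.us) (eh : pos M.len M.vs j + d = pos M.len M.us h + off) (ho : off < M.len h) :
    Graph (M.split j d z h off) := by
  have hjv := (hg.mem_iff j).mp hj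
  have hfu := hg.fresh_notMem
  have hfv := hg.fresh_notMemV
  have hjf : j ≠ M.fresh := by rintro rfl; exact hfu hj
  have hmem := hg.mem_iff
  have hzp : 0 < M.len z := hg.len_pos z ((hmem z).mpr hz)
  -- A node that is cut into two non-empty parts has length at least two.
  have hjd : j ≠ M.dol := by
    rintro rfl
    have := hg.dol_len
    omega
  obtain ⟨A, B, e1⟩ := List.append_of_mem hj
  obtain ⟨A', B', e2⟩ := List.append_of_mem hjv
  have hnU := hg.nodupU
  have hnV := hg.nodupV
  have hEL := hg.edgesL
  have hEF := hg.edgesF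
  have hst := hg.stable
  have hso := hg.sorted
  have hgl := hg.lt_fresh
  have hlen := hg.len_pos
  have hdm := hg.dol_mem
  have hdl := hg.dol_lt
  have i1 : insertAfter j M.fresh M.us = A ++ j :: M.fresh :: B := by
    rw [e1] at hnU ⊢; exact insertAfter_append (notMem_left_of_nodup hnU)
  have i2 : insertAfter j M.fresh M.vs = A' ++ j :: M.fresh :: B' := by
    rw [e2] at hnV ⊢; exact insertAfter_append (notMem_left_of_nodup hnV)
  have hdf : M.dol ≠ M.fresh := by intro hh; exact hfu (hh ▸ hg.dol_mem)
  constructor <;> simp only [Model.split, i1, i2]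
  case edgesL =>
    rw [e1] at hnU hfu hj ez hEL eh hgl hlen ⊢
    rw [e2] at hnV hfv hjv hz ez eh hEL
    refine Edges.split hd hnU hfu hnV hfv ?_
    intro x hx
    by_cases hxf : x = M.fresh
    -- The label is `0` and `d` is positive, so this edge is not redirected again.
    · refine ⟨z, 0, hz, by simp [hxf, ez], hzp, ?_, ?_⟩
      · simp only [hxf, hfu, false_and, if_false, Function.update_self]
        rw [if_neg (by omega)]
      · simp only [hxf, hfu, false_and, if_false, Function.update_self]
        rw [if_neg (by omega)]
    · have hxu : x ∈ A ++ j :: B := by simpa [hxf] using hx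
      obtain ⟨t1, t2, t3⟩ := hEL x hxu
      refine ⟨M.tgtL x, M.labL x, t1, by simpa [hxf] using t2, t3, ?_, ?_⟩ <;>
        simp only [hxu, true_and, Function.update_of_ne hxf]
  case edgesF =>
    rw [e1] at hnU hfu hj ez hEF eh hh
    rw [e2] at hnV hfv hjv hz ez eh hEF ⊢
    refine Edges.split hd hnV hfv hnU hfu ?_
    intro x hx
    by_cases hxf : x = M.fresh
    · refine ⟨h, off, hh, by simp [hxf, eh], ho, ?_, ?_⟩ <;>
      simp only [hxf, or_true, true_and, Function.update_self]
    · have hxu : x ∈ A' ++ j :: B' := by simpa [hxf] using hx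
      obtain ⟨t1, t2, t3⟩ := hEF x hxu
      refine ⟨M.tgtF x, M.labF x, t1, by simpa [hxf] using t2, t3, ?_, ?_⟩ <;>
        simp only [hxu, true_or, true_and, Function.update_of_ne hxf]
  case nodupU =>
    rw [e1] at hnU hfu
    have := nodup_insert (A := A ++ [j]) (B := B) (x := M.fresh) (by simpa using hnU)
      (by simpa using hfu)
    simpa using this
  case nodupV =>
    rw [e2] at hnV hfv
    have := nodup_insert (A := A' ++ [j]) (B := B') (x := M.fresh) (by simpa using hnV)
      (by simpa using hfv)
    simpa using this
  case mem_iff =>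
    intro x
    have := hmem x
    rw [e1, e2] at this
    simp only [List.mem_append, List.mem_cons] at this ⊢
    tauto
  case len_pos =>
    intro x hx
    rw [e1] at hlen
    simp only [Function.update_apply]
    split_ifs with h1 h2
    · exact hd0
    · omega
    · exact hlen x (by simpa [h2] using hx)
  case lt_fresh =>
    intro x hx
    rw [e1] at hgl
    by_cases hxf : x = M.fresh
    · omega
    · have := hgl x (by simpa [hxf] using hx)
      omega
  case sorted =>
    have hs : M.vs.Pairwise (fun x y => Function.update M.chr M.fresh (M.chr j) x ≤
        Function.update M.chr M.fresh (M.chr j) y) := by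
      refine hso.imp_of_mem fun {x y} hx hy hxy => ?_
      rw [Function.update_of_ne (by rintro rfl; exact hfv hx),
        Function.update_of_ne (by rintro rfl; exact hfv hy)]
      exact hxy
    have hjn : Function.update M.chr M.fresh (M.chr j) M.fresh =
        Function.update M.chr M.fresh (M.chr j) j := by
      rw [Function.update_self, Function.update_of_ne hjf]
    rw [e2] at hs
    rw [List.pairwise_append, List.pairwise_cons] at hs ⊢
    rw [List.pairwise_cons, hjn]
    obtain ⟨s1, ⟨s2, s3⟩, s4⟩ := hs
    refine ⟨s1, ⟨?_, s2, s3⟩, ?_⟩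
    · intro y hy
      simp only [List.mem_cons] at hy
      rcases hy with rfl | hy
      · exact hjn.ge
      · exact s2 y hy
    · intro y hy w hw
      simp only [List.mem_cons] at hw
      rcases hw with rfl | rfl | hw
      · exact s4 y hy w (by simp)
      · rw [hjn]; exact s4 y hy j (by simp)
      · exact s4 y hy w (by simp [hw])
  case stable =>
    intro a
    rw [e1] at hnU hfu
    rw [e2] at hnV hfv
    rw [filter_split a hfu (notMem_left_of_nodup hnU), filter_split a hfv (notMem_left_of_nodup hnV),
      ← e1, ← e2, hst a]
  case dol_mem =>
    rw [e1] at hdm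
    simp only [List.mem_append, List.mem_cons] at hdm ⊢
    tauto
  case dol_chr => rw [Function.update_of_ne hdf]; exact hg.dol_chr
  case dol_len =>
    rw [Function.update_of_ne hjd.symm, Function.update_of_ne hdf]; exact hg.dol_len
  case dol_lt =>
    intro x hx hxd
    rw [e1] at hdl hj
    by_cases hxf : x = M.fresh
    · rw [hxf, Function.update_self]
      exact hdl j hj hjd
    · rw [Function.update_of_ne hxf]
      exact hdl x (by simpa [hxf] using hx) hxd

theorem Graph.replaceInTree {M : Model} (hg : Graph M) (y x a : ℕ) :
    Graph (M.replaceInTree y x a) := by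
  unfold Model.replaceInTree
  split
  · exact { hg with }
  · exact hg

theorem pos_merge {A B : List ℕ} {len : ℕ → ℕ} {p q : ℕ} (hnd : (A ++ p :: q :: B).Nodup) {y : ℕ}
    (hy : y ∈ A ++ p :: B) :
    pos (Function.update len p (len p + len q)) (A ++ p :: B) y = pos len (A ++ p :: q :: B) y := by
  have hpA := notMem_left_of_nodup hnd
  have hpB : p ∉ B := fun h => notMem_right_of_nodup hnd (by simp [h])
  have hqn : q ∉ A ++ [p] ∧ q ∉ B := by
    have h : ((A ++ [p]) ++ q :: B).Nodup := by simpa using hnd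
    exact ⟨notMem_left_of_nodup h, notMem_right_of_nodup h⟩
  have hA : ∀ x ∈ A, Function.update len p (len p + len q) x = len x := by
    intro x hx
    rw [Function.update_of_ne (by rintro rfl; exact hpA hx)]
  have hB : ∀ x ∈ B, Function.update len p (len p + len q) x = len x := by
    intro x hx
    rw [Function.update_of_ne (by rintro rfl; exact hpB hx)]
  by_cases hyA : y ∈ A
  · rw [pos_append_of_mem hyA, pos_append_of_mem hyA, pos_congr hA]
  · rw [pos_append_of_notMem hyA, pos_append_of_notMem hyA, total_congr hA]
    congr 1
    by_cases hyp : y = p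
    · simp [pos, hyp]
    · simp only [List.mem_append, hyA, List.mem_cons, hyp, false_or] at hy
      have hyq : y ≠ q := by rintro rfl; exact hqn.2 hy
      simp only [pos, hyp, hyq, if_false, pos_congr hB, Function.update_self]
      omega

/-- The intervals of `p` and `q` are adjacent in both lists. Their union starts where `p` does, so
offsets in `q` grow by `len p`, and the edge that starts at `q` disappears with it. -/
theorem Edges.merge {A B A' B' : List ℕ} {len tgt lab tgt' lab' : ℕ → ℕ} {p q : ℕ}
    (h : Edges (A ++ p :: q :: B) (A' ++ p :: q :: B') len tgt lab)
    (hu : (A ++ p :: q :: B).Nodup) (hv : (A' ++ p :: q :: B').Nodup)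
    (h1 : ∀ y ∈ A ++ p :: q :: B, tgt' y = if tgt y = q then p else tgt y)
    (h2 : ∀ y ∈ A ++ p :: q :: B, lab' y = if tgt y = q then len p + lab y else lab y) :
    Edges (A ++ p :: B) (A' ++ p :: B') (Function.update len p (len p + len q)) tgt' lab' := by
  intro x hx
  have hx' : x ∈ A ++ p :: q :: B := by
    simp only [List.mem_append, List.mem_cons] at hx ⊢; tauto
  obtain ⟨t1, t2, t3⟩ := h x hx'
  have hpA := notMem_left_of_nodup hv
  have hqp : q ∉ A' ++ [p] := by
    have h : ((A' ++ [p]) ++ q :: B').Nodup := by simpa using hv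
    exact notMem_left_of_nodup h
  have hposq : pos len (A' ++ p :: q :: B') q = pos len (A' ++ p :: q :: B') p + len p := by
    have := pos_middle (len := len) (A := A' ++ [p]) (B := B') (x := q) hqp
    rw [pos_middle hpA]
    simpa using this
  rw [pos_merge hu hx, h1 x hx', h2 x hx']
  split_ifs with hq
  · refine ⟨by simp, ?_, ?_⟩
    · rw [pos_merge hv (by simp), t2, hq, hposq, add_assoc]
    · rw [hq] at t3
      rw [Function.update_self]; omega
  · have ht : tgt x ∈ A' ++ p :: B' := by
      simp only [List.mem_append, List.mem_cons] at t1 ⊢; tauto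
    refine ⟨ht, by rw [pos_merge hv ht, t2], ?_⟩
    rw [Function.update_apply]
    split_ifs with hp
    · rw [hp] at t3; omega
    · exact t3

theorem Graph.merge {M : Model} (hg : Graph M) {p q : ℕ} {A B A' B' : List ℕ}
    (e1 : M.us = A ++ p :: q :: B) (e2 : M.vs = A' ++ p :: q :: B')
    (hp : p ≠ M.dol) (hq : q ≠ M.dol) : Graph (M.merge p q) := by
  have hnU := hg.nodupU
  have hnV := hg.nodupV
  have i1 : M.us.erase q = A ++ p :: B := by
    have := erase_append_cons (A := A ++ [p]) (B := B) (x := q) (by simpa [e1] using hnU)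
    simpa [e1] using this
  have i2 : M.vs.erase q = A' ++ p :: B' := by
    have := erase_append_cons (A := A' ++ [p]) (B := B') (x := q) (by simpa [e2] using hnV)
    simpa [e2] using this
  have hsU : (M.us.erase q).Sublist M.us := List.erase_sublist
  have hsV : (M.vs.erase q).Sublist M.vs := List.erase_sublist
  constructor
  case nodupU => exact hnU.sublist hsU
  case nodupV => exact hnV.sublist hsV
  case mem_iff =>
    intro x
    simp only [Model.merge, hnU.mem_erase_iff, hnV.mem_erase_iff, hg.mem_iff]
  case len_pos =>
    intro x hx
    have := hg.len_pos x (hsU.mem hx)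
    simp only [Model.merge, Function.update_apply]
    split_ifs with h
    · subst h; omega
    · exact this
  case edgesL =>
    simp only [Model.merge, i1, i2]
    refine Edges.merge (e1 ▸ e2 ▸ hg.edgesL) (e1 ▸ hnU) (e2 ▸ hnV) ?_ ?_ <;> intro y hy <;>
      simp only [e1, hy, true_and]
  case edgesF =>
    simp only [Model.merge, i1, i2]
    refine Edges.merge (e1 ▸ e2 ▸ hg.edgesF) (e2 ▸ hnV) (e1 ▸ hnU) ?_ ?_ <;> intro y hy <;>
      simp only [e2, hy, true_and]
  case lt_fresh => exact fun x hx => hg.lt_fresh x (hsU.mem hx)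
  case sorted => exact hg.sorted.sublist hsV
  case stable =>
    intro a
    change (M.vs.erase q).filter (fun x => M.chr x = a) = (M.us.erase q).filter (fun x => M.chr x = a)
    -- Erasing from a duplicate-free list is filtering, and filters commute.
    rw [hnU.erase_eq_filter, hnV.erase_eq_filter, List.filter_comm, hg.stable a, List.filter_comm]
  case dol_mem => exact (hnU.mem_erase_iff).mpr ⟨Ne.symm hq, hg.dol_mem⟩
  case dol_chr => exact hg.dol_chr
  case dol_len =>
    simp only [Model.merge, Function.update_of_ne (Ne.symm hp)]
    exact hg.dol_len
  case dol_lt => exact fun x hx hd => hg.dol_lt x (hsU.mem hx) hd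

/-- By `hP`, `M.fresh` in `U` and `M.dol` in `V` are intervals of length `1` with the common start
`P = total M.len U1`; the `+ 1` stands for the node at the front of `V`. Starts at or beyond `P`
move by one in both lists, earlier ones stay. Since `P` is a boundary in both lists, the start of a
tail and the start of its head lie on the same side, so labels survive. `A` and `B` matter only for
the stability of the class of `c`. -/
theorem Graph.insertDollar {M : Model} (hg : Graph M) {c : ℕ} (hc : dollar < c)
    {U1 U2 V1 V2 A B : List ℕ} (eU : M.us = U1 ++ U2) (eA : M.us = A ++ M.dol :: B)
    (eV : M.vs = M.dol :: (V1 ++ V2)) (hP : total M.len U1 = total M.len V1 + 1)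
    (h1 : ∀ y ∈ V1, M.chr y ≤ c) (h2 : ∀ y ∈ V2, c ≤ M.chr y)
    (f1 : V1.filter (fun x => M.chr x = c) = A.filter (fun x => M.chr x = c))
    (f2 : V2.filter (fun x => M.chr x = c) = B.filter (fun x => M.chr x = c)) :
    Graph (M.insertDollar c (U1 ++ M.fresh :: U2) (M.fresh :: (V1 ++ M.dol :: V2))) := by
  have hnU := hg.nodupU
  have hnV := hg.nodupV
  have hmem := hg.mem_iff
  have hfu := hg.fresh_notMem
  have hfv := hg.fresh_notMemV
  have hdf : M.dol ≠ M.fresh := by intro hh; exact hfu (hh ▸ hg.dol_mem)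
  have hdV : M.dol ∉ V1 ∧ M.dol ∉ V2 := by
    rw [eV, List.nodup_cons] at hnV
    simpa using hnV.1
  have hfV : M.fresh ∉ V1 ∧ M.fresh ∉ V2 := by
    rw [eV] at hfv
    simp at hfv
    exact hfv.2
  have hfU : M.fresh ∉ U1 ∧ M.fresh ∉ U2 := by
    rw [eU] at hfu
    simpa using hfu
  have hlen : ∀ {l : List ℕ}, M.fresh ∉ l → ∀ y ∈ l, Function.update M.len M.fresh 1 y = M.len y := by
    intro l hl y hy
    rw [Function.update_of_ne (by rintro rfl; exact hl hy)]
  have hposV : ∀ v ∈ M.vs, 0 < M.len v := fun v hv => hg.len_pos v ((hmem v).mpr hv)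
  have hdp : pos M.len M.vs M.dol = 0 := by simp [eV, pos]
  -- positions in `U`
  have pU : ∀ y ∈ M.us, pos (Function.update M.len M.fresh 1) (U1 ++ M.fresh :: U2) y =
      pos M.len M.us y + if pos M.len M.us y < total M.len U1 then 0 else 1 := by
    intro y hy
    have hyf : y ≠ M.fresh := by rintro rfl; exact hfu hy
    by_cases hy1 : y ∈ U1
    · rw [pos_append_of_mem hy1, pos_congr (hlen hfU.1), eU, pos_append_of_mem hy1]
      have := pos_add_le_total (len := M.len) hy1
      have := hg.len_pos y hy
      rw [if_pos (by omega)]; rfl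
    · rw [pos_append_of_notMem hy1, total_congr (hlen hfU.1), eU, pos_append_of_notMem hy1]
      simp only [pos, hyf, if_false, pos_congr (hlen hfU.2), Function.update_self]
      rw [if_neg (by omega)]; omega
  have pUx : pos (Function.update M.len M.fresh 1) (U1 ++ M.fresh :: U2) M.fresh =
      total M.len U1 := by rw [pos_middle hfU.1, total_congr (hlen hfU.1)]
  -- An interval of `U` that starts before the boundary also ends before it; `cV` is the counterpart
  -- for `V`.
  have cU : ∀ y ∈ M.us, pos M.len M.us y < total M.len U1 →
      pos M.len M.us y + M.len y ≤ total M.len U1 := by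
    intro y hy hlt
    by_cases hy1 : y ∈ U1
    · rw [eU, pos_append_of_mem hy1]
      exact pos_add_le_total hy1
    · rw [eU, pos_append_of_notMem hy1] at hlt; omega
  -- positions in `V`
  have pV : ∀ y ∈ M.vs, y ≠ M.dol →
      pos (Function.update M.len M.fresh 1) (M.fresh :: (V1 ++ M.dol :: V2)) y =
      pos M.len M.vs y + if pos M.len M.vs y < total M.len U1 then 0 else 1 := by
    intro y hy hyd
    have hyf : y ≠ M.fresh := by rintro rfl; exact hfv hy
    have hyl := hposV y hy
    have hdl : Function.update M.len M.fresh 1 M.dol = 1 := by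
      rw [Function.update_of_ne hdf, hg.dol_len]
    by_cases hy1 : y ∈ V1
    · simp only [eV, pos, hyd, hyf, if_false, pos_append_of_mem hy1, pos_congr (hlen hfV.1),
        Function.update_self, hg.dol_len]
      have := pos_add_le_total (len := M.len) hy1
      rw [if_pos (by omega)]; rfl
    · simp only [eV, pos, hyd, hyf, if_false, pos_append_of_notMem hy1, total_congr (hlen hfV.1),
        pos_congr (hlen hfV.2), Function.update_self, hg.dol_len, hdl]
      rw [if_neg (by omega)]; omega
  have pVx : pos (Function.update M.len M.fresh 1) (M.fresh :: (V1 ++ M.dol :: V2)) M.fresh = 0 := by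
    simp [pos]
  have pVd : pos (Function.update M.len M.fresh 1) (M.fresh :: (V1 ++ M.dol :: V2)) M.dol =
      total M.len U1 := by
    simp only [pos, hdf, if_false, pos_middle hdV.1, Function.update_self, total_congr (hlen hfV.1)]
    omega
  have cV : ∀ y ∈ M.vs, pos M.len M.vs y < total M.len U1 →
      pos M.len M.vs y + M.len y ≤ total M.len U1 := by
    intro y hy hlt
    have hdl := hg.dol_len
    by_cases hyd : y = M.dol
    · subst hyd; omega
    · by_cases hy1 : y ∈ V1
      · have := pos_add_le_total (len := M.len) hy1
        simp only [eV, pos, hyd, if_false, pos_append_of_mem hy1]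
        omega
      · simp only [eV, pos, hyd, if_false, pos_append_of_notMem hy1] at hlt
        omega
  have memU : ∀ y, y ∈ U1 ++ M.fresh :: U2 ↔ y = M.fresh ∨ y ∈ M.us := by
    intro y; rw [eU]; simp only [List.mem_append, List.mem_cons]; tauto
  have memV : ∀ y, y ∈ M.fresh :: (V1 ++ M.dol :: V2) ↔ y = M.fresh ∨ y ∈ M.vs := by
    intro y; rw [eV]; simp only [List.mem_append, List.mem_cons]; tauto
  have hd0 := hg.edgesF M.dol ((hmem _).mp hg.dol_mem)
  -- the only edge that leads to the old node
  have ht0 : ∀ y ∈ M.us, M.tgtL y = M.dol ↔ y = M.tgtF M.dol := by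
    intro y hy
    rw [hg.edgesL.tgt_eq_iff hnV hy ((hmem _).mp hg.dol_mem), hdp, hg.dol_len]
    obtain ⟨a1, a2, a3⟩ := hd0
    rw [hdp] at a2
    constructor
    · rintro ⟨_, b2⟩
      exact pos_inj hnU hg.len_pos hy a1 (by omega)
    · rintro rfl; omega
  have hchr : ∀ {l : List ℕ}, M.fresh ∉ l → M.dol ∉ l → ∀ y ∈ l,
      Function.update (Function.update M.chr M.fresh dollar) M.dol c y = M.chr y := by
    intro l h1 h2 y hy
    rw [Function.update_of_ne (by rintro rfl; exact h2 hy),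
      Function.update_of_ne (by rintro rfl; exact h1 hy)]
  have hdA : M.dol ∉ A ∧ M.dol ∉ B := by
    rw [eA] at hnU
    exact ⟨notMem_left_of_nodup hnU, notMem_right_of_nodup hnU⟩
  have hfA : M.fresh ∉ A ∧ M.fresh ∉ B := by
    rw [eA] at hfu
    simp at hfu
    exact ⟨hfu.1, hfu.2.2⟩
  constructor <;> simp only [Model.insertDollar]
  case nodupU => exact nodup_insert (eU ▸ hnU) (eU ▸ hfu)
  case nodupV =>
    rw [eV, List.nodup_cons] at hnV
    refine List.nodup_cons.mpr ⟨?_, nodup_insert hnV.2 hnV.1⟩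
    simp [hfV, hdf.symm]
  case mem_iff => intro x; rw [memU, memV, hmem]
  case len_pos =>
    intro x hx
    rw [Function.update_apply]
    split_ifs with h
    · exact one_pos
    · exact hg.len_pos x (((memU x).mp hx).resolve_left h)
  case lt_fresh =>
    intro x hx
    rcases (memU x).mp hx with h | h
    · omega
    · have := hg.lt_fresh x h; omega
  case edgesL =>
    intro x hx
    rw [memU] at hx
    rcases hx with rfl | hx
    · have hne : M.fresh ≠ M.tgtF M.dol := by intro h; exact hfu (h ▸ hd0.1)
      simp only [Function.update_of_ne hne, Function.update_self, pUx, pVd,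
        Function.update_of_ne hdf, hg.dol_len]
      exact ⟨by simp, by simp, by simp⟩
    · have hxf : x ≠ M.fresh := by rintro rfl; exact hfu hx
      obtain ⟨t1, t2, t3⟩ := hg.edgesL x hx
      by_cases hx0 : x = M.tgtF M.dol
      · have hd := (ht0 x hx).mpr hx0
        rw [hd, hdp] at t2
        rw [hd, hg.dol_len] at t3
        rw [← hx0, Function.update_self, Function.update_of_ne hxf, pVx, Function.update_self, pU x hx]
        refine ⟨by simp, ?_, t3⟩
        rw [if_pos (by omega)]
        omega
      · rw [Function.update_of_ne hx0, Function.update_of_ne hxf, Function.update_of_ne hxf]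
        have hd : M.tgtL x ≠ M.dol := fun h => hx0 ((ht0 x hx).mp h)
        have htf : M.tgtL x ≠ M.fresh := fun h => hfv (h ▸ t1)
        rw [memV, pU x hx, pV _ t1 hd, Function.update_of_ne htf]
        refine ⟨Or.inr t1, ?_, t3⟩
        have := cV _ t1
        split_ifs <;> omega
  case edgesF =>
    intro x hx
    rw [memV] at hx
    by_cases hxd : x = M.dol
    · rw [hxd, Function.update_self, Function.update_self, Function.update_self, pVd, pUx]
      exact ⟨by simp, rfl, one_pos⟩
    · rw [Function.update_of_ne hxd, Function.update_of_ne hxd]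
      rcases hx with rfl | hx
      · rw [Function.update_self, Function.update_self, pVx, memU]
        obtain ⟨a1, a2, a3⟩ := hd0
        have htf : M.tgtF M.dol ≠ M.fresh := fun h => hfu (h ▸ a1)
        rw [pU _ a1, Function.update_of_ne htf]
        refine ⟨Or.inr a1, ?_, a3⟩
        rw [if_pos (by omega)]; omega
      · have hxf : x ≠ M.fresh := by rintro rfl; exact hfv hx
        obtain ⟨t1, t2, t3⟩ := hg.edgesF x hx
        have htf : M.tgtF x ≠ M.fresh := fun h => hfu (h ▸ t1)
        rw [Function.update_of_ne hxf, Function.update_of_ne hxf, memU, pV x hx hxd, pU _ t1,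
          Function.update_of_ne htf]
        refine ⟨Or.inr t1, ?_, t3⟩
        have := cU _ t1
        split_ifs <;> omega
  case sorted =>
    have hs := hg.sorted
    rw [eV, List.pairwise_cons] at hs
    have hs2 : (V1 ++ V2).Pairwise (fun x y =>
        Function.update (Function.update M.chr M.fresh dollar) M.dol c x ≤
        Function.update (Function.update M.chr M.fresh dollar) M.dol c y) := by
      refine hs.2.imp_of_mem fun {x y} hx hy hxy => ?_
      rw [hchr (l := V1 ++ V2) (by simp [hfV]) (by simp [hdV]) x hx,
        hchr (l := V1 ++ V2) (by simp [hfV]) (by simp [hdV]) y hy]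
      exact hxy
    rw [List.pairwise_append] at hs2
    rw [List.pairwise_cons, List.pairwise_append, List.pairwise_cons]
    obtain ⟨s1, s2, s3⟩ := hs2
    refine ⟨?_, s1, ⟨?_, s2⟩, ?_⟩
    · intro y hy
      rw [Function.update_of_ne hdf.symm, Function.update_self]
      simp only [List.mem_append, List.mem_cons] at hy
      have hlt : ∀ y ∈ V1 ++ V2, dollar < M.chr y := by
        intro y hy
        refine hg.dol_lt y ((hmem y).mpr (by rw [eV]; exact List.mem_cons_of_mem _ hy)) ?_
        rintro rfl
        simp [hdV] at hy
      rcases hy with hy | rfl | hy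
      · rw [hchr hfV.1 hdV.1 y hy]; exact (hlt y (by simp [hy])).le
      · rw [Function.update_self]; exact hc.le
      · rw [hchr hfV.2 hdV.2 y hy]; exact (hlt y (by simp [hy])).le
    · intro y hy
      rw [Function.update_self, hchr hfV.2 hdV.2 y hy]
      exact h2 y hy
    · intro y hy w hw
      simp only [List.mem_cons] at hw
      rcases hw with rfl | hw
      · rw [Function.update_self, hchr hfV.1 hdV.1 y hy]
        exact h1 y hy
      · exact s3 y hy w hw
  case stable =>
    intro a
    have hF : ∀ {l : List ℕ}, M.fresh ∉ l → M.dol ∉ l →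
        l.filter (fun x => Function.update (Function.update M.chr M.fresh dollar) M.dol c x = a) =
        l.filter (fun x => M.chr x = a) := by
      intro l h1 h2
      refine List.filter_congr fun x hx => ?_
      rw [hchr h1 h2 x hx]
    -- The class of `dollar` now consists of the new node alone, which is invisible in all other
    -- classes.
    have hus : (U1 ++ M.fresh :: U2).filter (fun x =>
          Function.update (Function.update M.chr M.fresh dollar) M.dol c x = a) =
        if a = dollar then [M.fresh] else M.us.filter (fun x =>
          Function.update (Function.update M.chr M.fresh dollar) M.dol c x = a) := by
      rw [List.filter_append, List.filter_cons, Function.update_of_ne hdf.symm,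
        Function.update_self]
      split_ifs with ha1 ha2 ha2
      · have hnil : ∀ {l : List ℕ}, (∀ y ∈ l, y ∈ M.us) → l.filter (fun x =>
            Function.update (Function.update M.chr M.fresh dollar) M.dol c x = a) = [] := by
          intro l hl
          rw [List.filter_eq_nil_iff]
          intro y hy
          have hyf : y ≠ M.fresh := by rintro rfl; exact hfu (hl _ hy)
          rw [ha2, Function.update_apply, Function.update_of_ne hyf]
          split_ifs with hyd
          · simp; omega
          · have := hg.dol_lt y (hl y hy) hyd
            simp; omega
        rw [hnil (fun y hy => by simp [eU, hy]), hnil (fun y hy => by simp [eU, hy])]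
        rfl
      · simp at ha1; omega
      · simp at ha1; omega
      · rw [eU, List.filter_append]
    change (M.fresh :: (V1 ++ M.dol :: V2)).filter (fun x =>
        Function.update (Function.update M.chr M.fresh dollar) M.dol c x = a) =
      (U1 ++ M.fresh :: U2).filter (fun x =>
        Function.update (Function.update M.chr M.fresh dollar) M.dol c x = a)
    rw [hus, List.filter_cons, List.filter_append, List.filter_cons, Function.update_of_ne hdf.symm,
      Function.update_self, Function.update_self, hF hfV.1 hdV.1, hF hfV.2 hdV.2, eA,
      List.filter_append, List.filter_cons, Function.update_self, hF hfA.1 hdA.1, hF hfA.2 hdA.2]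
    have hst := hg.stable a
    rw [eV, eA, List.filter_cons, List.filter_append, List.filter_append, List.filter_cons,
      hg.dol_chr] at hst
    -- Only the class of `c` gains a member; `f1` and `f2` put it at the same place in both lists.
    by_cases hac : a = c
    · subst hac
      have hda : dollar ≠ a := by omega
      simp [hda, hda.symm, f1, f2]
    · by_cases had : a = dollar
      · subst had
        have hca : c ≠ dollar := by omega
        simp only [decide_true, if_true, hca, decide_false]
        have hnil : (V1 ++ V2).filter (fun x => M.chr x = dollar) = [] := by
          rw [List.filter_eq_nil_iff]
          intro y hy
          have := hg.dol_lt y ((hmem y).mpr (by rw [eV]; exact List.mem_cons_of_mem _ hy)) (by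
            rintro rfl; simp [hdV] at hy)
          simp; omega
        rw [List.filter_append] at hnil
        simp [hnil]
      · have hda : dollar ≠ a := Ne.symm had
        have hca : c ≠ a := Ne.symm hac
        simp only [hda, decide_false, hca, had, if_false] at hst ⊢
        simpa using hst
  case dol_mem => rw [memU]; exact Or.inl rfl
  case dol_chr => rw [Function.update_of_ne hdf.symm, Function.update_self]
  case dol_len => rw [Function.update_self]
  case dol_lt =>
    intro x hx hxf
    rw [Function.update_apply, Function.update_of_ne hxf]
    split_ifs with hxd
    · exact hc
    · exact hg.dol_lt x (((memU x).mp hx).resolve_left hxf) hxd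

/-! ## Suffix arrays -/

theorem suffixArray_perm (t : List ℕ) : (suffixArray t).Perm (List.range t.length) :=
  List.mergeSort_perm _ _

theorem suffixArray_nodup (t : List ℕ) : (suffixArray t).Nodup :=
  (suffixArray_perm t).nodup_iff.mpr List.nodup_range

theorem mem_suffixArray {t : List ℕ} {x : ℕ} : x ∈ suffixArray t ↔ x < t.length := by
  rw [(suffixArray_perm t).mem_iff, List.mem_range]

theorem length_suffixArray (t : List ℕ) : (suffixArray t).length = t.length := by
  rw [(suffixArray_perm t).length_eq, List.length_range]

theorem length_bwt (t : List ℕ) : (bwt t).length = t.length := by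
  rw [bwt, List.length_map, length_suffixArray]

theorem drop_inj {t : List ℕ} {x y : ℕ} (hx : x < t.length) (hy : y < t.length)
    (h : t.drop x = t.drop y) : x = y := by
  have := congrArg List.length h
  simp only [List.length_drop] at this
  omega

theorem suffixArray_pairwise (t : List ℕ) :
    (suffixArray t).Pairwise (fun x y => t.drop x < t.drop y) := by
  have h : (suffixArray t).Pairwise (fun x y => decide (t.drop x ≤ t.drop y) = true) :=
    List.pairwise_mergeSort (fun a b c h1 h2 => by
      simp only [decide_eq_true_eq] at *; exact le_trans h1 h2) (fun a b => by
      simp only [Bool.or_eq_true, decide_eq_true_eq]; exact le_total _ _) _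
  have h2 := h.and (suffixArray_nodup t)
  refine h2.imp_of_mem fun {x y} hx hy hxy => ?_
  rw [mem_suffixArray] at hx hy
  obtain ⟨h3, h4⟩ := hxy
  rw [decide_eq_true_eq] at h3
  exact lt_of_le_of_ne h3 fun h => h4 (drop_inj hx hy h)

/-- A strictly sorted permutation is unique, so it suffices to guess a suffix array and to check it.
-/
theorem eq_suffixArray {t l : List ℕ} (hp : l.Perm (List.range t.length))
    (hs : l.Pairwise (fun x y => t.drop x < t.drop y)) : l = suffixArray t := by
  refine List.Perm.eq_of_pairwise (le := fun x y => t.drop x < t.drop y) ?_ hs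
    (suffixArray_pairwise t) (hp.trans (suffixArray_perm t).symm)
  intro a b _ _ h1 h2
  exact absurd h1 (not_lt_of_gt h2)

/-- In a strictly sorted list the index of a member is the number of smaller members. -/
theorem idxOf_suffixArray {t : List ℕ} {x : ℕ} (hx : x < t.length) :
    (suffixArray t).idxOf x = (suffixArray t).countP (fun y => t.drop y < t.drop x) := by
  obtain ⟨A, B, e⟩ := List.append_of_mem (mem_suffixArray.mpr hx)
  have hs := suffixArray_pairwise t
  have hn := suffixArray_nodup t
  rw [e] at hs hn ⊢
  rw [List.pairwise_append, List.pairwise_cons] at hs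
  have hxA : x ∉ A := fun h => (List.nodup_append.mp hn).2.2 x h x (by simp) rfl
  rw [List.idxOf_append_of_notMem hxA, List.idxOf_cons_self, List.countP_append, List.countP_cons,
    List.countP_eq_length.mpr, List.countP_eq_zero.mpr]
  · simp
  · intro y hy
    have := hs.2.1.1 y hy
    simpa using this.le
  · intro y hy
    simpa using hs.2.2 y hy x (by simp)

theorem prevPos_lt {t : List ℕ} {x : ℕ} (hx : x < t.length) : prevPos t x < t.length := by
  unfold prevPos; split_ifs <;> omega

/-- `prevPos` is a cyclic shift. A count over all suffixes may thus run over their predecessors,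
which turns ranks of suffixes into counts of BWT characters. -/
theorem map_prevPos_perm (t : List ℕ) :
    ((suffixArray t).map (prevPos t)).Perm (suffixArray t) := by
  refine (List.perm_ext_iff_of_nodup ?_ (suffixArray_nodup t)).mpr ?_
  · rw [List.nodup_map_iff_inj_on (suffixArray_nodup t)]
    intro x hx y hy
    rw [mem_suffixArray] at hx hy
    unfold prevPos; split_ifs <;> omega
  · intro x
    simp only [List.mem_map, mem_suffixArray]
    constructor
    · rintro ⟨y, hy, rfl⟩; exact prevPos_lt hy
    · intro hx
      by_cases h : x + 1 < t.length
      · exact ⟨x + 1, h, by simp [prevPos]⟩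
      · exact ⟨0, by omega, by simp [prevPos]; omega⟩

/-! ## The LF function as a rank -/

/-- The character before position `x`. -/
def prevChr (t : List ℕ) (x : ℕ) : ℕ := t.getD (prevPos t x) 0

theorem bwt_eq (t : List ℕ) : bwt t = (suffixArray t).map (prevChr t) := rfl

theorem IsText.length_pos {t : List ℕ} (ht : IsText t) : 0 < t.length := by
  obtain ⟨w, rfl, _⟩ := ht; simp

theorem IsText.prevChr_zero {t : List ℕ} (ht : IsText t) : prevChr t 0 = dollar := by
  obtain ⟨w, rfl, _⟩ := ht
  simp [prevChr, prevPos, List.getD_eq_getElem?_getD]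

theorem IsText.prevChr_pos {t : List ℕ} (ht : IsText t) {x : ℕ} (hx : x < t.length) (h0 : x ≠ 0) :
    dollar < prevChr t x := by
  obtain ⟨w, rfl, hw⟩ := ht
  have h1 : x - 1 < w.length := by simp at hx; omega
  simp only [prevChr, prevPos, h0, if_false, List.getD_eq_getElem?_getD]
  rw [List.getElem?_append_left h1, List.getElem?_eq_getElem h1]
  exact hw _ (List.getElem_mem h1)

theorem drop_prevPos {t : List ℕ} {x : ℕ} (hx : x < t.length) :
    t.drop (prevPos t x) = prevChr t x :: if x = 0 then [] else t.drop x := by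
  have h := prevPos_lt hx
  rw [List.drop_eq_getElem_cons h, prevChr, List.getD_eq_getElem?_getD,
    List.getElem?_eq_getElem h, Option.getD_some]
  congr 1
  unfold prevPos
  split_ifs with h0
  · rw [List.drop_eq_nil_iff]; omega
  · congr 1; omega

/-- Compare first characters, then the rest. The exceptional position `0`, whose predecessor is the
last position, is the only one preceded by `dollar`, so it never ties with another position. -/
theorem IsText.drop_prevPos_lt_iff {t : List ℕ} (ht : IsText t) {x y : ℕ} (hx : x < t.length)
    (hy : y < t.length) : t.drop (prevPos t x) < t.drop (prevPos t y) ↔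
      prevChr t x < prevChr t y ∨ (prevChr t x = prevChr t y ∧ t.drop x < t.drop y) := by
  rw [drop_prevPos hx, drop_prevPos hy, List.cons_lt_cons_iff]
  have h0 := ht.prevChr_zero
  by_cases hx0 : x = 0 <;> by_cases hy0 : y = 0
  · subst hx0; subst hy0; simp
  · subst hx0
    have := ht.prevChr_pos hy hy0
    simp [h0, this]
  · subst hy0
    have := ht.prevChr_pos hx hx0
    have h1 : ¬ prevChr t x < prevChr t 0 := by omega
    have h2 : prevChr t x ≠ prevChr t 0 := by omega
    simp [h1, h2]
  · simp [hx0, hy0]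

/-- LF is a rank: the suffixes below the extended one are those with a smaller preceding character
and, among equal characters, those that come earlier in the sorted order. -/
theorem IsText.lf_eq {t : List ℕ} (ht : IsText t) {A B : List ℕ} {a : ℕ}
    (hb : bwt t = A ++ a :: B) :
    lf t A.length = A.countP (· ≤ a) + B.countP (· < a) := by
  rw [bwt_eq, List.map_eq_append_iff] at hb
  obtain ⟨S, S', e, rfl, hS'⟩ := hb
  rw [List.map_eq_cons_iff] at hS'
  obtain ⟨x, S'', rfl, rfl, rfl⟩ := hS'
  have hx : x < t.length := mem_suffixArray.mp (by simp [e])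
  have hget : (suffixArray t).getD (S.map (prevChr t)).length 0 = x := by
    simp [e, List.getD_eq_getElem?_getD]
  rw [lf, hget, idxOf_suffixArray (prevPos_lt hx), ← (map_prevPos_perm t).countP_eq, List.countP_map]
  have hs := suffixArray_pairwise t
  have hmem : ∀ y ∈ S ++ x :: S'', y < t.length := fun y hy => mem_suffixArray.mp (e ▸ hy)
  rw [e] at hs ⊢
  rw [List.pairwise_append, List.pairwise_cons] at hs
  rw [List.countP_append, List.countP_cons, List.countP_map, List.countP_map]
  have h1 : S.countP ((fun y => decide (t.drop y < t.drop (prevPos t x))) ∘ prevPos t) =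
      S.countP ((fun b => decide (b ≤ prevChr t x)) ∘ prevChr t) := by
    refine List.countP_congr fun y hy => ?_
    have := hs.2.2 y hy x (by simp)
    simp only [Function.comp, decide_eq_true_eq, ht.drop_prevPos_lt_iff (hmem y (by simp [hy])) hx, this,
      and_true]
    omega
  have h2 : S''.countP ((fun y => decide (t.drop y < t.drop (prevPos t x))) ∘ prevPos t) =
      S''.countP ((fun b => decide (b < prevChr t x)) ∘ prevChr t) := by
    refine List.countP_congr fun y hy => ?_
    have := not_lt_of_gt (hs.2.1.1 y hy)
    simp only [Function.comp, decide_eq_true_eq, ht.drop_prevPos_lt_iff (hmem y (by simp [hy])) hx,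
      this, and_false, or_false]
  rw [h1, h2]
  simp

theorem IsText.cons {t : List ℕ} (ht : IsText t) {c : ℕ} (hc : dollar < c) : IsText (c :: t) := by
  obtain ⟨w, rfl, hw⟩ := ht
  exact ⟨c :: w, rfl, by simpa [hc] using hw⟩

/-- A fixed point would be a position that cyclically precedes itself. The fact excludes one place
for the new `dollar` node in `Placement.prev_adjacent`. -/
theorem lf_ne_self {t : List ℕ} (ht : 2 ≤ t.length) {i : ℕ} (hi : i < t.length) : lf t i ≠ i := by
  have hi' : i < (suffixArray t).length := by rwa [length_suffixArray]
  intro h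
  rw [lf, List.getD_eq_getElem?_getD, List.getElem?_eq_getElem hi', Option.getD_some] at h
  have hx : (suffixArray t)[i] < t.length := mem_suffixArray.mp (List.getElem_mem hi')
  have hp := mem_suffixArray.mpr (prevPos_lt hx)
  have h1 := List.getElem_idxOf (List.idxOf_lt_length_iff.mpr hp)
  have h2 : (suffixArray t)[i] = prevPos t (suffixArray t)[i] := by
    conv_rhs => rw [← h1]
    congr 1
    exact h.symm
  unfold prevPos at h2
  split_ifs at h2 <;> omega

/-- Extension of a text to the left. -/
theorem IsText.bwt_cons {t : List ℕ} (ht : IsText t) {c : ℕ} (hc : dollar < c) {B₁ B₂ : List ℕ}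
    (hb : bwt t = B₁ ++ dollar :: B₂) :
    ∃ X Y, B₁ ++ c :: B₂ = X ++ Y ∧ bwt (c :: t) = X ++ dollar :: Y ∧
      X.length = B₁.countP (· ≤ c) + B₂.countP (· < c) + 1 := by
  have h0 := ht.prevChr_zero
  rw [bwt_eq, List.map_eq_append_iff] at hb
  obtain ⟨S, S', e, rfl, hS'⟩ := hb
  rw [List.map_eq_cons_iff] at hS'
  obtain ⟨x, S'', rfl, hxd, rfl⟩ := hS'
  have hmem : ∀ y ∈ S ++ x :: S'', y < t.length := fun y hy => mem_suffixArray.mp (e ▸ hy)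
  have hx0 : x = 0 := by
    by_contra h
    have := ht.prevChr_pos (hmem x (by simp)) h
    omega
  subst hx0
  have hnd := suffixArray_nodup t
  have hpw := suffixArray_pairwise t
  -- `p` selects the suffixes that come before the new suffix `c :: t`; filtering keeps the order,
  -- so the old suffix array is the concatenation of both parts.
  set p : ℕ → Bool := fun y => decide (t.drop y < c :: t) with hp
  set S₁ := (suffixArray t).filter p with hS1
  set S₂ := (suffixArray t).filter (fun y => !p y) with hS2
  have hmem' : ∀ y ∈ suffixArray t, y < t.length := fun y hy => mem_suffixArray.mp hy
  have m1 : ∀ y ∈ S₁, t.drop y < c :: t := fun y hy => by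
    have := (List.mem_filter.mp hy).2; simpa [hp] using this
  have m2 : ∀ y ∈ S₂, c :: t < t.drop y := fun y hy => by
    obtain ⟨h1, h2⟩ := List.mem_filter.mp hy
    simp only [hp, Bool.not_eq_true', decide_eq_false_iff_not, not_lt] at h2
    refine lt_of_le_of_ne h2 fun h => ?_
    have := congrArg List.length h
    simp at this
    omega
  have hperm : (S₁ ++ S₂).Perm (suffixArray t) := List.filter_append_perm _ _
  have e12 : S₁ ++ S₂ = suffixArray t := by
    refine eq_suffixArray (hperm.trans (suffixArray_perm t)) ?_
    rw [List.pairwise_append]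
    exact ⟨hpw.filter _, hpw.filter _, fun a ha b hb => (m1 a ha).trans (m2 b hb)⟩
  -- Position `y` of `t` is position `y + 1` of `c :: t` and has the same suffix; only the whole
  -- text is a new suffix.
  have e' : suffixArray (c :: t) = S₁.map Nat.succ ++ 0 :: S₂.map Nat.succ := by
    symm
    refine eq_suffixArray ?_ ?_
    · refine List.perm_middle.trans ?_
      rw [← List.map_append, List.length_cons, List.range_succ_eq_map]
      exact ((hperm.trans (suffixArray_perm t)).map _).cons _
    · rw [List.pairwise_append, List.pairwise_cons, List.pairwise_map, List.pairwise_map]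
      refine ⟨hpw.filter _, ⟨?_, hpw.filter _⟩, ?_⟩
      · simpa using m2
      · intro a ha b hb
        obtain ⟨a', ha', rfl⟩ := List.mem_map.mp ha
        simp only [List.mem_cons, List.mem_map] at hb
        rcases hb with rfl | ⟨b', hb', rfl⟩
        · simpa using m1 a' ha'
        · simpa using (m1 a' ha').trans (m2 b' hb')
  -- The preceding characters after the extension: only the first position of `t`, cyclically
  -- preceded by `dollar` before, changes and is now preceded by `c`.
  set g : ℕ → ℕ := fun y => if y = 0 then c else prevChr t y with hg
  have hchr : ∀ y, prevChr (c :: t) (Nat.succ y) = g y := by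
    intro y
    cases y with
    | zero => simp [prevChr, prevPos, hg]
    | succ y => simp [prevChr, prevPos, hg]
  have hmap : ∀ l : List ℕ, (l.map Nat.succ).map (prevChr (c :: t)) = l.map g := by
    intro l
    rw [List.map_map]
    exact List.map_congr_left fun y _ => hchr y
  have hgS : ∀ l : List ℕ, 0 ∉ l → l.map (prevChr t) = l.map g := by
    intro l hl
    refine List.map_congr_left fun y hy => ?_
    have : y ≠ 0 := by rintro rfl; exact hl hy
    simp [hg, this]
  have hn0 := hnd
  rw [e] at hn0
  have n1 : 0 ∉ S := fun h => (List.nodup_append.mp hn0).2.2 0 h 0 (by simp) rfl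
  have n2 : 0 ∉ S'' := (List.nodup_cons.mp (List.nodup_append.mp hn0).2.1).1
  refine ⟨S₁.map g, S₂.map g, ?_, ?_, ?_⟩
  · rw [← List.map_append, e12, e, List.map_append, List.map_cons, hgS _ n1, hgS _ n2]
    simp [hg]
  · rw [bwt_eq, e', List.map_append, List.map_cons, hmap, hmap, (ht.cons hc).prevChr_zero]
  -- The rank of the new suffix is counted over predecessors, so that it can be read off the old
  -- BWT.
  · rw [List.length_map, hS1, ← List.countP_eq_length_filter, ← (map_prevPos_perm t).countP_eq,
      List.countP_map, e, List.countP_append, List.countP_cons, List.countP_map, List.countP_map]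
    rw [e, List.pairwise_append, List.pairwise_cons] at hpw
    have key : ∀ y, y < t.length → y ≠ 0 → (t.drop (prevPos t y) < c :: t ↔
        prevChr t y < c ∨ (prevChr t y = c ∧ t.drop y < t.drop 0)) := by
      intro y hy hy0
      rw [drop_prevPos hy, List.cons_lt_cons_iff]
      simp [hy0]
    have k1 : S.countP (p ∘ prevPos t) = S.countP ((fun b => decide (b ≤ c)) ∘ prevChr t) := by
      refine List.countP_congr fun y hy => ?_
      have h1 := hpw.2.2 y hy 0 (by simp)
      have h2 : y ≠ 0 := by rintro rfl; exact n1 hy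
      simp only [hp, Function.comp, decide_eq_true_eq, key y (hmem y (by simp [hy])) h2, h1,
        and_true]
      omega
    have k2 : S''.countP (p ∘ prevPos t) = S''.countP ((fun b => decide (b < c)) ∘ prevChr t) := by
      refine List.countP_congr fun y hy => ?_
      have h1 := not_lt_of_gt (hpw.2.1.1 y hy)
      have h2 : y ≠ 0 := by rintro rfl; exact n2 hy
      simp only [hp, Function.comp, decide_eq_true_eq, key y (hmem y (by simp [hy])) h2, h1,
        and_false, or_false]
    -- The suffix that consists of `dollar` alone precedes `c :: t`; it accounts for the summand
    -- `1`.
    have k3 : (p ∘ prevPos t) 0 = true := by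
      simp only [hp, Function.comp, decide_eq_true_eq]
      rw [drop_prevPos (hmem 0 (by simp)), List.cons_lt_cons_iff, h0]
      exact Or.inl hc
    rw [k1, k2, if_pos k3]
    omega

theorem IsText.drop {T : List ℕ} (hT : IsText T) {δ : ℕ} (h1 : 1 ≤ δ) :
    IsText (suffixOfLength T δ) := by
  obtain ⟨w, rfl, hw⟩ := hT
  refine ⟨w.drop ((w ++ [dollar]).length - δ), ?_, fun a ha => hw a (List.mem_of_mem_drop ha)⟩
  rw [suffixOfLength, List.drop_append_of_le_length]
  simp; omega

theorem suffixOfLength_succ {T : List ℕ} {δ c : ℕ} (h : δ < T.length)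
    (hc : T[T.length - δ - 1]? = some c) :
    suffixOfLength T (δ + 1) = c :: suffixOfLength T δ := by
  have h1 : T.length - δ - 1 < T.length := by omega
  rw [List.getElem?_eq_getElem h1, Option.some_inj] at hc
  rw [suffixOfLength, suffixOfLength, ← Nat.sub_sub, List.drop_eq_getElem_cons h1, hc]
  congr 2
  omega

/-- `1 ≤ δ` keeps the character away from the end of the text. -/
theorem IsText.dollar_lt {T : List ℕ} (hT : IsText T) {δ c : ℕ} (h1 : 1 ≤ δ) (h : δ < T.length)
    (hc : T[T.length - δ - 1]? = some c) : dollar < c := by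
  obtain ⟨w, rfl, hw⟩ := hT
  rw [List.getElem?_append_left (by simp at h ⊢; omega)] at hc
  exact hw c (List.mem_of_getElem? hc)

/-! ## Positions in `V` and the LF function -/

/-- The string spelled by a sequence of repetitions. -/
def flat (chr len : ℕ → ℕ) (l : List ℕ) : List ℕ := l.flatMap (fun x => List.replicate (len x) (chr x))

theorem flat_append (chr len : ℕ → ℕ) (l l' : List ℕ) :
    flat chr len (l ++ l') = flat chr len l ++ flat chr len l' := List.flatMap_append

theorem flat_cons (chr len : ℕ → ℕ) (x : ℕ) (l : List ℕ) :
    flat chr len (x :: l) = List.replicate (len x) (chr x) ++ flat chr len l := rfl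

theorem flat_congr {chr len chr' len' : ℕ → ℕ} {l : List ℕ}
    (h : ∀ x ∈ l, chr x = chr' x ∧ len x = len' x) : flat chr len l = flat chr' len' l := by
  unfold flat
  rw [List.flatMap_def, List.flatMap_def]
  congr 1
  refine List.map_congr_left fun x hx => ?_
  rw [(h x hx).1, (h x hx).2]

theorem length_flat (chr len : ℕ → ℕ) (l : List ℕ) : (flat chr len l).length = total len l := by
  induction l with
  | nil => rfl
  | cons a l ih => simp [flat_cons, ih]

theorem countP_flat (chr len : ℕ → ℕ) (p : ℕ → Bool) (l : List ℕ) :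
    (flat chr len l).countP p = total len (l.filter (fun x => p (chr x))) := by
  induction l with
  | nil => rfl
  | cons a l ih =>
    rw [flat_cons, List.countP_append, ih, List.countP_replicate, List.filter_cons]
    split_ifs <;> simp

/-- In the stable sorting, `x` is preceded by the nodes with smaller characters, wherever they are
in `us`, and by those with its own character that precede it in `us`. The lists have no duplicates,
so comparing members suffices. -/
theorem total_eq_of_stable {us vs A B V₁ V₂ : List ℕ} {chr len : ℕ → ℕ} {x : ℕ}
    (hu : us.Nodup) (hp : us.Perm vs)
    (hs : vs.Pairwise (fun x y => chr x ≤ chr y))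
    (hst : ∀ a, vs.filter (fun x => chr x = a) = us.filter (fun x => chr x = a))
    (eU : us = A ++ x :: B) (eV : vs = V₁ ++ x :: V₂) :
    total len V₁ = total len (A.filter (fun y => chr y ≤ chr x)) +
      total len (B.filter (fun y => chr y < chr x)) := by
  have hv := hp.nodup_iff.mp hu
  rw [← total_append]
  refine total_perm ((List.perm_ext_iff_of_nodup ?_ ?_).mpr ?_)
  · rw [eV] at hv; exact (List.nodup_append.mp hv).1
  · have h : (A ++ B).Nodup := by
      rw [eU] at hu
      exact hu.sublist (List.Sublist.append_left (List.sublist_cons_self _ _) _)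
    exact h.sublist (List.Sublist.append List.filter_sublist List.filter_sublist)
  intro y
  rw [List.mem_append, List.mem_filter, List.mem_filter, decide_eq_true_eq, decide_eq_true_eq]
  have hst' := hst (chr x)
  rw [eU, eV, List.filter_append, List.filter_append, List.filter_cons_of_pos (by simp),
    List.filter_cons_of_pos (by simp)] at hst'
  have hf := (append_cons_inj hst' (by
    have := hv.filter (fun y => chr y = chr x)
    rw [eV, List.filter_append, List.filter_cons_of_pos (by simp)] at this
    exact this)).1
  have hfm : y ∈ V₁ ∧ chr y = chr x ↔ y ∈ A ∧ chr y = chr x := by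
    have : y ∈ V₁.filter (fun y => chr y = chr x) ↔ y ∈ A.filter (fun y => chr y = chr x) := by
      rw [hf]
    simpa [List.mem_filter] using this
  have hmem : y ∈ us ↔ y ∈ vs := hp.mem_iff
  rw [eU, eV] at hmem
  simp only [List.mem_append, List.mem_cons] at hmem
  rw [eV, List.pairwise_append, List.pairwise_cons] at hs
  have s1 : y ∈ V₁ → chr y ≤ chr x := fun h => hs.2.2 y h x (by simp)
  have s2 : y ∈ V₂ → chr x ≤ chr y := fun h => hs.2.1.1 y h
  by_cases hyx : y = x
  · subst hyx
    rw [eU] at hu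
    rw [eV] at hv
    simp [notMem_left_of_nodup hu, notMem_right_of_nodup hu, notMem_left_of_nodup hv]
  · simp only [hyx, false_or] at hmem
    constructor
    · intro h
      rcases (s1 h).lt_or_eq with h1 | h1
      · rcases hmem.mpr (Or.inl h) with h2 | h2
        · exact Or.inl ⟨h2, h1.le⟩
        · exact Or.inr ⟨h2, h1⟩
      · exact Or.inl ⟨(hfm.mp ⟨h, h1⟩).1, h1.le⟩
    · have aux : chr y < chr x → (y ∈ A ∨ y ∈ B) → y ∈ V₁ := by
        intro h1 h2
        rcases hmem.mp h2 with h3 | h3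
        · exact h3
        · have := s2 h3; omega
      rintro (⟨h1, h2⟩ | ⟨h1, h2⟩)
      · rcases h2.lt_or_eq with h3 | h3
        · exact aux h3 (Or.inl h1)
        · exact (hfm.mpr ⟨h1, h3⟩).1
      · exact aux h2 (Or.inr h1)

/-- The F-intervals start where the nodes of the sorted list start. -/
theorem lf_pos {t us vs : List ℕ} {chr len : ℕ → ℕ} (ht : IsText t) (hf : flat chr len us = bwt t)
    (hu : us.Nodup) (hp : us.Perm vs) (hs : vs.Pairwise (fun x y => chr x ≤ chr y))
    (hst : ∀ a, vs.filter (fun x => chr x = a) = us.filter (fun x => chr x = a))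
    {x o : ℕ} (hx : x ∈ us) (ho : o < len x) :
    lf t (pos len us x + o) = pos len vs x + o := by
  obtain ⟨A, B, eU⟩ := List.append_of_mem hx
  obtain ⟨V₁, V₂, eV⟩ := List.append_of_mem (hp.mem_iff.mp hx)
  have htot := total_eq_of_stable (len := len) hu hp hs hst eU eV
  have hv := hp.nodup_iff.mp hu
  -- The run of `x` is cut around its character at offset `o`, to which `IsText.lf_eq` applies.
  have e : bwt t = (flat chr len A ++ List.replicate o (chr x)) ++ chr x ::
      (List.replicate (len x - o - 1) (chr x) ++ flat chr len B) := by
    rw [← hf, eU, flat_append, flat_cons]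
    have : len x = o + ((len x - o - 1) + 1) := by omega
    conv_lhs => rw [this, List.replicate_add, List.replicate_succ]
    simp
  have h1 := ht.lf_eq e
  rw [List.length_append, List.length_replicate, length_flat] at h1
  rw [eU] at hu
  rw [eV] at hv
  rw [eU, eV, pos_middle (notMem_left_of_nodup hu), pos_middle (notMem_left_of_nodup hv), h1, htot,
    List.countP_append, List.countP_append, countP_flat, countP_flat, List.countP_replicate,
    List.countP_replicate]
  simp
  omega

/-- Only the first position is cyclically preceded by `dollar`. -/
theorem bwt_dollar {t : List ℕ} (ht : IsText t) :
    (bwt t).count dollar = 1 ∧ ∀ a ∈ bwt t, dollar ≤ a := by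
  rw [bwt_eq]
  constructor
  · rw [List.count_eq_countP, List.countP_map]
    have h1 : (suffixArray t).countP ((fun a => a == dollar) ∘ prevChr t) =
        (suffixArray t).count 0 := by
      rw [List.count_eq_countP]
      refine List.countP_congr fun y hy => ?_
      rw [mem_suffixArray] at hy
      simp only [Function.comp, beq_iff_eq]
      constructor
      · intro h
        by_contra h0
        have := ht.prevChr_pos hy h0
        omega
      · rintro rfl; exact ht.prevChr_zero
    rw [h1, List.count_eq_one_of_mem (suffixArray_nodup t) (mem_suffixArray.mpr ht.length_pos)]
  · intro a ha
    obtain ⟨y, hy, rfl⟩ := List.mem_map.mp ha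
    rw [mem_suffixArray] at hy
    by_cases h0 : y = 0
    · subst h0; exact ht.prevChr_zero.ge
    · exact (ht.prevChr_pos hy h0).le

theorem exists_dollar {t us : List ℕ} {chr len : ℕ → ℕ} (ht : IsText t)
    (hf : flat chr len us = bwt t) (hp : ∀ x ∈ us, 0 < len x) :
    ∃ d ∈ us, chr d = dollar ∧ len d = 1 ∧ ∀ x ∈ us, x ≠ d → dollar < chr x := by
  obtain ⟨h1, h2⟩ := bwt_dollar ht
  rw [← hf] at h1 h2
  have hm : dollar ∈ flat chr len us := by
    rw [← List.count_pos_iff, h1]; exact one_pos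
  obtain ⟨d, hd, hd2⟩ := List.mem_flatMap.mp hm
  have hdc : chr d = dollar := (List.eq_of_mem_replicate hd2).symm
  have hge : ∀ x ∈ us, dollar ≤ chr x := by
    intro x hx
    refine h2 _ (List.mem_flatMap.mpr ⟨x, hx, ?_⟩)
    rw [List.mem_replicate]
    exact ⟨(hp x hx).ne', rfl⟩
  obtain ⟨A, B, rfl⟩ := List.append_of_mem hd
  rw [flat_append, flat_cons, List.count_append, List.count_append, hdc, List.count_replicate_self]
    at h1
  have hdl := hp d hd
  have h0 : ∀ l : List ℕ, (∀ x ∈ l, 0 < len x) → (flat chr len l).count dollar = 0 →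
      ∀ x ∈ l, chr x ≠ dollar := by
    intro l hl hc x hx hxd
    rw [List.count_eq_zero] at hc
    refine hc (List.mem_flatMap.mpr ⟨x, hx, ?_⟩)
    rw [List.mem_replicate]
    exact ⟨(hl x hx).ne', hxd.symm⟩
  refine ⟨d, hd, hdc, by omega, fun x hx hxd => ?_⟩
  refine lt_of_le_of_ne (hge x hx) (Ne.symm ?_)
  simp only [List.mem_append, List.mem_cons, hxd, false_or] at hx
  rcases hx with hx | hx
  · exact h0 A (fun y hy => hp y (by simp [hy])) (by omega) x hx
  · exact h0 B (fun y hy => hp y (by simp [hy])) (by omega) x hx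

/-- The labels of the nodes. -/
def labels (chr len : ℕ → ℕ) (us : List ℕ) : List (ℕ × ℕ) := us.map (fun x => (chr x, len x))

theorem length_labels (chr len : ℕ → ℕ) (us : List ℕ) : (labels chr len us).length = us.length :=
  List.length_map _

theorem isDBWT_labels {t us : List ℕ} {chr len : ℕ → ℕ} :
    IsDBWT t (labels chr len us) ↔ (∀ x ∈ us, 0 < len x) ∧ flat chr len us = bwt t := by
  simp [IsDBWT, labels, flat, List.flatMap_map]

theorem start_labels {us : List ℕ} {chr len : ℕ → ℕ} (i : ℕ) :
    start (labels chr len us) i = total len (us.take i) := by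
  simp [start, labels, total, ← List.map_take, Function.comp_def]

theorem start_eq_pos {us : List ℕ} {chr len : ℕ → ℕ} (hu : us.Nodup) {i : ℕ} (hi : i < us.length) :
    start (labels chr len us) i = pos len us us[i] := by
  have e : us = us.take i ++ us[i] :: us.drop (i + 1) := by
    rw [← List.drop_eq_getElem_cons, List.take_append_drop]
  have hn : us[i] ∉ us.take i := by
    have hu' := hu
    rw [e] at hu'
    exact notMem_left_of_nodup hu'
  have h := pos_middle (len := len) (B := us.drop (i + 1)) hn
  rw [← e] at h
  rw [start_labels, h]

theorem start_succ {us : List ℕ} {chr len : ℕ → ℕ} (hu : us.Nodup) {i : ℕ} (hi : i < us.length) :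
    start (labels chr len us) (i + 1) = pos len us us[i] + len us[i] := by
  rw [← start_eq_pos (chr := chr) hu hi, start_labels, start_labels, List.take_succ_eq_append_getElem hi,
    total_append, total_cons, total_nil, add_zero]

/-! ## Models and stored graphs -/

/-- The repetitions that the model represents. -/
def Model.labels (M : Model) : List (ℕ × ℕ) := RComp.labels M.chr M.len M.us

/-- The nodes that the B-tree of the model holds, in its order. -/
def Model.treeNodes (M : Model) : List ℕ := M.tree.inorder.map (fun s => (M.slots s).1)

/-- The B-tree is valid, its elements and the nodes point to each other, and its nodes have the
order of the list of `V`. -/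
structure TreeInv (m : ℕ) (M : Model) : Prop where
  valid : M.tree.IsBTree m
  nodup : M.tree.inorder.Nodup
  slot : ∀ x ∈ M.us, ∀ s, M.slot x = some s ↔ s ∈ M.tree.inorder ∧ (M.slots s).1 = x
  key : ∀ s ∈ M.tree.inorder, (M.slots s).2 = M.chr (M.slots s).1
  sub : M.treeNodes.Sublist M.vs

/-- Different characters are ordered by the sorting; two nodes with equal characters form a sublist
of a class, hence of `us`. This is the order of the B-tree keys. -/
theorem pairwise_stable {us vs : List ℕ} {chr : ℕ → ℕ}
    (hs : vs.Pairwise (fun x y => chr x ≤ chr y))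
    (hst : ∀ a, vs.filter (fun x => chr x = a) = us.filter (fun x => chr x = a)) :
    vs.Pairwise (fun x y => chr x < chr y ∨ (chr x = chr y ∧
      ∃ i j, ∃ (hi : i < us.length) (hj : j < us.length), us[i] = x ∧ us[j] = y ∧ i < j)) := by
  have hus : us.Pairwise (fun x y =>
      ∃ i j, ∃ (hi : i < us.length) (hj : j < us.length), us[i] = x ∧ us[j] = y ∧ i < j) := by
    rw [List.pairwise_iff_getElem]
    intro i j hi hj hij
    exact ⟨i, j, hi, hj, rfl, rfl, hij⟩
  rw [List.pairwise_iff_forall_sublist] at hs hus ⊢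
  intro x y hxy
  rcases (hs hxy).lt_or_eq with h | h
  · exact Or.inl h
  · refine Or.inr ⟨h, hus ?_⟩
    have h1 := hxy.filter (fun z => chr z = chr x)
    rw [hst] at h1
    simp only [h, decide_true, List.filter_cons_of_pos, List.filter_nil] at h1
    exact h1.trans List.filter_sublist

theorem pairwise_pos {len : ℕ → ℕ} {l : List ℕ} (hl : l.Nodup) (hp : ∀ x ∈ l, 0 < len x) :
    l.Pairwise (fun x y => pos len l x < pos len l y) := by
  rw [List.pairwise_iff_getElem]
  intro i j hi hj hij
  have hij' : l[i] ≠ l[j] := fun h => hij.ne ((hl.getElem_inj_iff).mp h)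
  have h1 := start_eq_pos (chr := len) (len := len) hl hi
  have h2 := start_eq_pos (chr := len) (len := len) hl hj
  rw [start_labels] at h1 h2
  have h3 : total len (l.take i) ≤ total len (l.take j) := by
    have : l.take j = l.take i ++ (l.drop i).take (j - i) := by
      rw [← List.take_add, Nat.add_sub_cancel' hij.le]
    rw [this, total_append]; omega
  rcases h3.lt_or_eq with h | h
  · omega
  · exact absurd (pos_inj hl hp (List.getElem_mem hi) (List.getElem_mem hj) (by omega)) hij'

theorem indeg_eq_of_perm {l l' : List ℕ} (h : l.Perm l') (tgt : ℕ → ℕ) (v : ℕ) :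
    indeg l tgt v = indeg l' tgt v := h.countP_eq _

theorem ncard_eq_countP {l : List ℕ} (hl : l.Nodup) {n : ℕ} (hn : n = l.length) (p : ℕ → Bool)
    {s : Set (Fin n)} (hs : ∀ i : Fin n, i ∈ s ↔ p (l[(i : ℕ)]'(hn ▸ i.2)) = true) :
    s.ncard = l.countP p := by
  rw [List.countP_eq_length_filter, ← List.toFinset_card_of_nodup (hl.filter _),
    ← Set.ncard_coe_finset]
  refine Set.ncard_congr (fun i _ => l[(i : ℕ)]'(hn ▸ i.2)) ?_ ?_ ?_
  · intro i hi
    simpa using (hs i).mp hi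
  · intro i j _ _ h
    exact Fin.ext ((hl.getElem_inj_iff).mp h)
  · intro x hx
    simp only [List.coe_toFinset, List.mem_filter, Set.mem_ofPred_eq] at hx
    obtain ⟨i, hi, rfl⟩ := List.getElem_of_mem hx.1
    exact ⟨⟨i, hn ▸ hi⟩, (hs _).mpr hx.2, rfl⟩

-- Intervals, edges and heavy nodes in terms of positions

section
variable {t : List ℕ} {M : Model}

theorem Graph.lf_pos (ht : IsText t) (hg : Graph M) (hf : flat M.chr M.len M.us = bwt t)
    {x o : ℕ} (hx : x ∈ M.us) (ho : o < M.len x) :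
    lf t (pos M.len M.us x + o) = pos M.len M.vs x + o :=
  RComp.lf_pos ht hf hg.nodupU hg.perm hg.sorted hg.stable hx ho

theorem Graph.start_eq (hg : Graph M) {i : ℕ} (hi : i < M.us.length) :
    start M.labels i = pos M.len M.us M.us[i] := start_eq_pos hg.nodupU hi

theorem Graph.start_succ_eq (hg : Graph M) {i : ℕ} (hi : i < M.us.length) :
    start M.labels (i + 1) = pos M.len M.us M.us[i] + M.len M.us[i] := start_succ hg.nodupU hi

theorem Graph.lf_start (ht : IsText t) (hg : Graph M) (hf : flat M.chr M.len M.us = bwt t)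
    {i : ℕ} (hi : i < M.us.length) :
    lf t (start M.labels i) = pos M.len M.vs M.us[i] ∧
    lf t (start M.labels (i + 1) - 1) = pos M.len M.vs M.us[i] + M.len M.us[i] - 1 := by
  have hx := List.getElem_mem hi
  have hp := hg.len_pos _ hx
  rw [Model.labels, start_succ hg.nodupU hi, start_eq_pos hg.nodupU hi]
  refine ⟨hg.lf_pos ht hf (o := 0) hx hp, ?_⟩
  rw [Nat.add_sub_assoc hp, hg.lf_pos ht hf hx (by omega), Nat.add_sub_assoc hp]

theorem Graph.mem_uInterval (hg : Graph M) {i p : ℕ} (hi : i < M.us.length) :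
    p ∈ uInterval M.labels i ↔ pos M.len M.us M.us[i] ≤ p ∧
      p < pos M.len M.us M.us[i] + M.len M.us[i] := by
  have hp := hg.len_pos _ (List.getElem_mem hi)
  rw [uInterval, Model.labels, start_succ hg.nodupU hi, start_eq_pos hg.nodupU hi, Set.mem_Icc]
  omega

theorem Graph.mem_fInterval (ht : IsText t) (hg : Graph M) (hf : flat M.chr M.len M.us = bwt t)
    {i p : ℕ} (hi : i < M.us.length) :
    p ∈ fInterval t M.labels i ↔ pos M.len M.vs M.us[i] ≤ p ∧
      p < pos M.len M.vs M.us[i] + M.len M.us[i] := by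
  have hp := hg.len_pos _ (List.getElem_mem hi)
  rw [fInterval, (hg.lf_start ht hf hi).1, (hg.lf_start ht hf hi).2, Set.mem_Icc]
  omega

theorem Graph.mem_EL (ht : IsText t) (hg : Graph M) (hf : flat M.chr M.len M.us = bwt t)
    {i j : ℕ} (hi : i < M.us.length) (hj : j < M.us.length) :
    start M.labels i ∈ fInterval t M.labels j ↔ M.tgtL M.us[i] = M.us[j] := by
  rw [hg.mem_fInterval ht hf hj, hg.edgesL.tgt_eq_iff hg.nodupV (List.getElem_mem hi)
    ((hg.mem_iff _).mp (List.getElem_mem hj)), Model.labels, start_eq_pos hg.nodupU hi]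

theorem Graph.mem_EF (ht : IsText t) (hg : Graph M) (hf : flat M.chr M.len M.us = bwt t)
    {i j : ℕ} (hi : i < M.us.length) (hj : j < M.us.length) :
    lf t (start M.labels j) ∈ uInterval M.labels i ↔ M.tgtF M.us[j] = M.us[i] := by
  rw [hg.mem_uInterval hi, hg.edgesF.tgt_eq_iff hg.nodupU
    ((hg.mem_iff _).mp (List.getElem_mem hj)) (List.getElem_mem hi), (hg.lf_start ht hf hj).1]

/-- The index set follows the order of `U`, the in-degree is counted along `V`; the lists are
permutations of each other, so the counts agree. -/
theorem Graph.heavyU_iff (ht : IsText t) (hg : Graph M) (hf : flat M.chr M.len M.us = bwt t)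
    (α : ℕ) (i : Fin M.labels.length) (hi : (i : ℕ) < M.us.length) :
    HeavyU α t M.labels i ↔ α ≤ indeg M.vs M.tgtF M.us[(i : ℕ)] := by
  rw [HeavyU, ← indeg_eq_of_perm hg.perm, indeg]
  have hlen : M.labels.length = M.us.length := length_labels _ _ _
  refine iff_of_eq (congrArg (α ≤ ·) (ncard_eq_countP hg.nodupU hlen _ ?_))
  intro j
  rw [Set.mem_ofPred_eq, decide_eq_true_eq]
  exact hg.mem_EF ht hf hi _

theorem Graph.heavyV_iff (ht : IsText t) (hg : Graph M) (hf : flat M.chr M.len M.us = bwt t)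
    (α : ℕ) (i : Fin M.labels.length) (hi : (i : ℕ) < M.us.length) :
    HeavyV α t M.labels i ↔ α ≤ indeg M.us M.tgtL M.us[(i : ℕ)] := by
  rw [HeavyV, indeg]
  have hlen : M.labels.length = M.us.length := length_labels _ _ _
  refine iff_of_eq (congrArg (α ≤ ·) (ncard_eq_countP hg.nodupU hlen _ ?_))
  intro j
  rw [Set.mem_ofPred_eq, decide_eq_true_eq]
  exact hg.mem_EL ht hf _ hi

theorem labels_getElem {i : ℕ} (hi : i < M.us.length) (h : i < M.labels.length) :
    M.labels[i] = (M.chr M.us[i], M.len M.us[i]) := by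
  simp [Model.labels, labels]

theorem Graph.getD_bwt (hg : Graph M) (hf : flat M.chr M.len M.us = bwt t) {i : ℕ}
    (hi : i < M.us.length) : (bwt t).getD (start M.labels i) 0 = M.chr M.us[i] := by
  have e : M.us = M.us.take i ++ M.us[i] :: M.us.drop (i + 1) := by
    rw [← List.drop_eq_getElem_cons, List.take_append_drop]
  have hp := hg.len_pos _ (List.getElem_mem hi)
  have hb : bwt t = flat M.chr M.len (M.us.take i) ++ (List.replicate (M.len M.us[i]) (M.chr M.us[i])
      ++ flat M.chr M.len (M.us.drop (i + 1))) := by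
    rw [← hf, ← flat_cons, ← flat_append, ← e]
  rw [hb, Model.labels, start_labels, List.getD_eq_getElem?_getD, ← length_flat M.chr,
    List.getElem?_append_right le_rfl, Nat.sub_self, List.getElem?_append_left (by simpa using hp)]
  simp [hp]

/-- The suffix at index `LF(i)` starts at the very position whose character is `L[i]`, so both nodes
of a pair have the same label. -/
theorem getD_fcol_lf {i : ℕ} (hi : i < t.length) :
    (fcol t).getD (lf t i) 0 = (bwt t).getD i 0 := by
  have hi' : i < (suffixArray t).length := by rwa [length_suffixArray]
  have hx : (suffixArray t)[i] < t.length := mem_suffixArray.mp (List.getElem_mem hi')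
  have hp := mem_suffixArray.mpr (prevPos_lt hx)
  have e : (suffixArray t).getD i 0 = (suffixArray t)[i] := by
    rw [List.getD_eq_getElem?_getD, List.getElem?_eq_getElem hi', Option.getD_some]
  rw [lf, e, fcol, bwt, List.getD_eq_getElem?_getD, List.getD_eq_getElem?_getD, List.getElem?_map,
    List.getElem?_map, List.getElem?_eq_getElem hi',
    List.getElem?_eq_getElem (List.idxOf_lt_length_iff.mpr hp), List.getElem_idxOf]
  rfl

/-- A represented graph is stored. -/
theorem storesAt_of_models {α m : ℕ} {S : State} (ht : IsText t) (h : Models M S) (hg : Graph M)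
    (hT : TreeInv m M) (hf : flat M.chr M.len M.us = bwt t)
    (nU : M.heavyU.Nodup) (hU : ∀ x, x ∈ M.heavyU ↔ x ∈ M.us ∧ α ≤ indeg M.vs M.tgtF x)
    (nV : M.heavyV.Nodup) (hV : ∀ x, x ∈ M.heavyV ↔ x ∈ M.us ∧ α ≤ indeg M.us M.tgtL x) :
    StoresAt α m t M.labels S
      (fun i => M.us[(i : ℕ)]'(length_labels M.chr M.len M.us ▸ i.2)) := by
  have hlen : M.labels.length = M.us.length := length_labels _ _ _
  have hlt : ∀ i : Fin M.labels.length, (i : ℕ) < M.us.length := fun i => hlen ▸ i.2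
  have hofn : List.ofFn (fun i : Fin M.labels.length => M.us[(i : ℕ)]'(hlt i)) = M.us := by
    apply List.ext_getElem
    · simp [hlen]
    · intro i h1 h2; simp
  have hstart : ∀ i : Fin M.labels.length, start M.labels i < t.length := by
    intro i
    have h1 := pos_add_le_total (len := M.len) (List.getElem_mem (hlt i))
    have h2 := hg.len_pos _ (List.getElem_mem (hlt i))
    rw [hg.start_eq (hlt i), ← length_bwt, ← hf, length_flat]
    omega
  constructor
  case node_inj =>
    intro i j hij
    exact Fin.ext ((hg.nodupU.getElem_inj_iff).mp hij)
  case node_lt => intro i; rw [h.fresh]; exact hg.lt_fresh _ (List.getElem_mem _)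
  case labelU =>
    intro i
    simp only [lfGraph, h.chr, h.len, hg.getD_bwt hf (hlt i)]
    rw [hg.start_succ_eq (hlt i), hg.start_eq (hlt i),
      Nat.add_sub_cancel_left]
  case labelV =>
    intro i
    have hp := hg.len_pos _ (List.getElem_mem (hlt i))
    simp only [lfGraph, h.chr, h.len, getD_fcol_lf (hstart i), hg.getD_bwt hf (hlt i)]
    rw [(hg.lf_start ht hf (hlt i)).1, (hg.lf_start ht hf (hlt i)).2]
    congr 1
    omega
  case edgeL => intro i j; rw [h.tgtL]; exact hg.mem_EL ht hf (hlt i) (hlt j)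
  case edgeF => intro i j; rw [h.tgtF]; exact hg.mem_EF ht hf (hlt i) (hlt j)
  case edgeLabelL =>
    intro i j hij
    have h1 := (hg.mem_EL ht hf (hlt i) (hlt j)).mp hij
    have h2 := (hg.edgesL _ (List.getElem_mem (hlt i))).2.1
    simp only [h.labL, lfGraph, (hg.lf_start ht hf (hlt j)).1]
    rw [hg.start_eq (hlt i), h2, h1]
    omega
  case edgeLabelF =>
    intro i j hij
    have h1 := (hg.mem_EF ht hf (hlt i) (hlt j)).mp hij
    have h2 := (hg.edgesF _ ((hg.mem_iff _).mp (List.getElem_mem (hlt j)))).2.1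
    simp only [h.labF, lfGraph, (hg.lf_start ht hf (hlt j)).1]
    rw [hg.start_eq (hlt i), h2, h1]
    omega
  case listU => rw [hofn]; exact isLinkedList_iff.mpr h.listU
  case listV =>
    have hlv : M.labels.length = M.vs.length := hlen.trans hg.perm.length_eq
    -- The permutation assigns to each place in `V` the index of this node in `U`.
    have hex : ∀ r : Fin M.labels.length, ∃ i : Fin M.labels.length,
        M.us[(i : ℕ)]'(hlt i) = M.vs[(r : ℕ)]'(hlv ▸ r.2) := by
      intro r
      obtain ⟨i, hi, e⟩ := List.getElem_of_mem ((hg.mem_iff _).mpr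
        (List.getElem_mem (l := M.vs) (n := r) (hlv ▸ r.2)))
      exact ⟨⟨i, hlen ▸ hi⟩, e⟩
    choose π hπ using hex
    have hinj : Function.Injective π := by
      intro r s hrs
      have : M.vs[(r : ℕ)]'(hlv ▸ r.2) = M.vs[(s : ℕ)]'(hlv ▸ s.2) := by
        rw [← hπ r, ← hπ s, hrs]
      exact Fin.ext ((hg.nodupV.getElem_inj_iff).mp this)
    refine ⟨Equiv.ofBijective π (Finite.injective_iff_bijective.mp hinj), ?_, ?_⟩
    · intro r s hrs
      simp only [Equiv.ofBijective_apply, (hg.lf_start ht hf (hlt _)).1, hπ]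
      exact List.pairwise_iff_getElem.mp (pairwise_pos hg.nodupV
        (fun x hx => hg.len_pos x ((hg.mem_iff x).mpr hx))) _ _ _ _ hrs
    · have : List.ofFn (fun r : Fin M.labels.length => M.us[((Equiv.ofBijective π
          (Finite.injective_iff_bijective.mp hinj) r : Fin _) : ℕ)]'(hlt _)) = M.vs := by
        apply List.ext_getElem
        · simp [hlv]
        · intro i h1 h2
          simp only [List.getElem_ofFn, Equiv.ofBijective_apply, hπ]
      rw [this]
      exact isLinkedList_iff.mpr h.listV
  case dollarNode =>
    intro i hi
    rw [h.dol]
    by_contra hne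
    have := hg.dol_lt _ (List.getElem_mem (hlt i)) (Ne.symm hne)
    have h2 := labels_getElem (hlt i) i.2
    rw [Fin.getElem_fin] at hi
    rw [h2] at hi
    dsimp only at hi
    omega
  case heavyU_nodup => rw [h.heavyU]; exact nU
  case heavyV_nodup => rw [h.heavyV]; exact nV
  case heavyU_mem =>
    intro x
    rw [h.heavyU, hU]
    constructor
    · rintro ⟨h1, h2⟩
      obtain ⟨i, hi, rfl⟩ := List.getElem_of_mem h1
      exact ⟨⟨i, hlen ▸ hi⟩, (hg.heavyU_iff ht hf α _ hi).mpr h2, rfl⟩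
    · rintro ⟨i, h1, rfl⟩
      exact ⟨List.getElem_mem _, (hg.heavyU_iff ht hf α _ (hlt i)).mp h1⟩
  case heavyV_mem =>
    intro x
    rw [h.heavyV, hV]
    constructor
    · rintro ⟨h1, h2⟩
      obtain ⟨i, hi, rfl⟩ := List.getElem_of_mem h1
      exact ⟨⟨i, hlen ▸ hi⟩, (hg.heavyV_iff ht hf α _ hi).mpr h2, rfl⟩
    · rintro ⟨i, h1, rfl⟩
      exact ⟨List.getElem_mem _, (hg.heavyV_iff ht hf α _ (hlt i)).mp h1⟩
  case order_eq => rw [hofn]; exact h.order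
  case tree_valid => rw [h.tree]; exact hT.valid
  case tree_slots => rw [h.tree]; exact hT.nodup
  case tree_slot =>
    intro i s
    rw [h.slot, h.tree, h.slots]
    exact hT.slot _ (List.getElem_mem _) s
  case tree_key =>
    intro s hs
    rw [h.tree] at hs
    have hx : (M.slots s).1 ∈ M.us := (hg.mem_iff _).mpr
      (hT.sub.mem (List.mem_map.mpr ⟨s, hs, rfl⟩))
    obtain ⟨i, hi, e⟩ := List.getElem_of_mem hx
    refine ⟨⟨i, hlen ▸ hi⟩, ?_⟩
    rw [h.slots, Fin.getElem_fin, labels_getElem hi]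
    exact Prod.ext e.symm (by rw [hT.key s hs, e])
  case tree_sorted =>
    have h1 := (pairwise_stable hg.sorted hg.stable).sublist hT.sub
    have h2 : S.treeNodes = M.treeNodes := by
      rw [State.treeNodes, Model.treeNodes, h.tree, h.slots]
    rw [h2]
    refine h1.imp_of_mem fun {x y} hx hy hxy => ?_
    obtain ⟨i, hi, rfl⟩ := List.getElem_of_mem ((hg.mem_iff _).mpr (hT.sub.mem hx))
    obtain ⟨j, hj, rfl⟩ := List.getElem_of_mem ((hg.mem_iff _).mpr (hT.sub.mem hy))
    refine ⟨⟨i, hlen ▸ hi⟩, ⟨j, hlen ▸ hj⟩, rfl, rfl, ?_⟩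
    rw [KeyLT, Fin.getElem_fin, Fin.getElem_fin, labels_getElem hi, labels_getElem hj]
    rcases hxy with hxy | ⟨hc, i', j', hi', hj', e1, e2, hij⟩
    · exact Or.inl hxy
    · refine Or.inr ⟨hc, ?_⟩
      have a1 := (hg.nodupU.getElem_inj_iff).mp e1
      have a2 := (hg.nodupU.getElem_inj_iff).mp e2
      change i < j
      omega

end

/-- Merge sort is stable: a class of `us` is a sublist of the sorted list, hence of the same class
there, and both have the same length. -/
theorem exists_stable (us : List ℕ) (chr : ℕ → ℕ) : ∃ vs : List ℕ, us.Perm vs ∧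
    vs.Pairwise (fun x y => chr x ≤ chr y) ∧
    ∀ a, vs.filter (fun x => chr x = a) = us.filter (fun x => chr x = a) := by
  have htr : ∀ a b c : ℕ, decide (chr a ≤ chr b) = true → decide (chr b ≤ chr c) = true →
      decide (chr a ≤ chr c) = true := by
    intro a b c h1 h2
    simp only [decide_eq_true_eq] at *; omega
  have hto : ∀ a b : ℕ, (decide (chr a ≤ chr b) || decide (chr b ≤ chr a)) = true := by
    intro a b
    simp only [Bool.or_eq_true, decide_eq_true_eq]; omega
  refine ⟨us.mergeSort (fun x y => decide (chr x ≤ chr y)), (List.mergeSort_perm _ _).symm, ?_, ?_⟩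
  · have := List.pairwise_mergeSort htr hto us
    exact this.imp fun h => by simpa using h
  · intro a
    have h1 : (us.filter (fun x => chr x = a)).Sublist
        (us.mergeSort (fun x y => decide (chr x ≤ chr y))) := by
      refine List.sublist_mergeSort htr hto ?_ List.filter_sublist
      rw [List.pairwise_filter]
      refine List.pairwise_of_forall fun x y h1 h2 => ?_
      simp only [decide_eq_true_eq] at *; omega
    have h2 := h1.filter (fun x => chr x = a)
    rw [List.filter_filter] at h2
    simp only [Bool.and_self] at h2
    refine (h2.eq_of_length ?_).symm
    rw [← List.countP_eq_length_filter, ← List.countP_eq_length_filter]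
    exact ((List.mergeSort_perm _ _).countP_eq _).symm

theorem getD_bwt_start {t : List ℕ} {D : List (ℕ × ℕ)} (hD : IsDBWT t D) {i : ℕ}
    (hi : i < D.length) : (bwt t).getD (start D i) 0 = D[i].1 ∧
      start D (i + 1) - start D i = D[i].2 := by
  constructor
  · have e : D = D.take i ++ D[i] :: D.drop (i + 1) := by
      rw [← List.drop_eq_getElem_cons, List.take_append_drop]
    have hp := hD.1 _ (List.getElem_mem hi)
    have hl : start D i = ((D.take i).flatMap (fun r => List.replicate r.2 r.1)).length := by
      simp [start, List.length_flatMap]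
    have hb : bwt t = (D.take i).flatMap (fun r => List.replicate r.2 r.1) ++
        (List.replicate D[i].2 D[i].1 ++
          (D.drop (i + 1)).flatMap (fun r => List.replicate r.2 r.1)) := by
      rw [← hD.2]
      conv_lhs => rw [e, List.flatMap_append, List.flatMap_cons]
    rw [hb, hl, List.getD_eq_getElem?_getD,
      List.getElem?_append_right le_rfl, Nat.sub_self, List.getElem?_append_left (by simpa using hp)]
    simp [hp]
  · have : start D (i + 1) = start D i + D[i].2 := by
      rw [start, start, List.take_succ_eq_append_getElem hi, List.map_append, List.sum_append]
      simp
    omega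

/-- A stored graph is represented by a model. -/
theorem exists_model {α m : ℕ} {t : List ℕ} {D : List (ℕ × ℕ)} {S : State}
    {node : Fin D.length → ℕ} (ht : IsText t) (hD : IsDBWT t D) (h : StoresAt α m t D S node) :
    ∃ M, Models M S ∧ Graph M ∧ TreeInv m M ∧ flat M.chr M.len M.us = bwt t ∧ D = M.labels ∧
      M.us = List.ofFn node := by
  obtain ⟨π, hπ, hlv⟩ := h.listV
  set us := List.ofFn node with hus
  set vs := List.ofFn (fun r => node (π r)) with hvs
  set chr := fun x => (S.mem x).chr with hchr
  set len := fun x => (S.mem x).len with hlen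
  have hlen_us : us.length = D.length := by simp [hus]
  have hmem : ∀ x, x ∈ us ↔ ∃ i, node i = x := by intro x; simp [hus, List.mem_ofFn]
  have hmemv : ∀ x, x ∈ vs ↔ ∃ i, node i = x := by
    intro x; simp only [hvs, List.mem_ofFn]
    exact ⟨fun ⟨i, hi⟩ => ⟨π i, hi⟩, fun ⟨i, hi⟩ => ⟨π.symm i, by simpa using hi⟩⟩
  have hlab : ∀ i : Fin D.length, (chr (node i), len (node i)) = D[i] := by
    intro i
    have := h.labelU i
    obtain ⟨h1, h2⟩ := getD_bwt_start hD i.2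
    simp only [lfGraph] at this
    rw [h1, h2] at this
    exact this
  have hDl : D = labels chr len us := by
    apply List.ext_getElem
    · rw [length_labels, hlen_us]
    · intro i h1 h2
      have := hlab ⟨i, h1⟩
      simp only [labels, hus, List.getElem_map, List.getElem_ofFn]
      exact this.symm
  have hD' : IsDBWT t (labels chr len us) := hDl ▸ hD
  obtain ⟨hpos, hflat⟩ := isDBWT_labels.mp hD'
  have nU : us.Nodup := List.nodup_ofFn.mpr h.node_inj
  have nV : vs.Nodup := List.nodup_ofFn.mpr (fun i j hij => π.injective (h.node_inj hij))
  have hperm : us.Perm vs := (List.perm_ext_iff_of_nodup nU nV).mpr fun x => by rw [hmem, hmemv]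
  have hget : ∀ i : Fin D.length, us[(i : ℕ)]'(hlen_us.symm ▸ i.2) = node i := by
    intro i; simp [hus]
  have hst : ∀ i : Fin D.length, start D i = pos len us (node i) := by
    intro i
    refine (congrArg (fun E => start E (i : ℕ)) hDl).trans ?_
    rw [start_eq_pos nU (hlen_us.symm ▸ i.2), hget]
  have hst' : ∀ i : Fin D.length, start D (i + 1) = pos len us (node i) + len (node i) := by
    intro i
    refine (congrArg (fun E => start E ((i : ℕ) + 1)) hDl).trans ?_
    rw [start_succ nU (hlen_us.symm ▸ i.2), hget]
  -- the list of `V` is the stable sorting of the list of `U`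
  obtain ⟨hsort, hstab⟩ : vs.Pairwise (fun x y => chr x ≤ chr y) ∧
      ∀ a, vs.filter (fun x => chr x = a) = us.filter (fun x => chr x = a) := by
    obtain ⟨ws, w1, w2, w3⟩ := exists_stable us chr
    have hlfw : ∀ i : Fin D.length, lf t (start D i) = pos len ws (node i) := by
      intro i
      have hi : node i ∈ us := (hmem _).mpr ⟨i, rfl⟩
      rw [hst]
      exact RComp.lf_pos ht hflat nU w1 w2 w3 (o := 0) hi (hpos _ hi)
    -- The LF values that order `vs` are the starting positions in the stable sorting `ws`, so both
    -- are the same permutation, sorted by these positions.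
    have hwv : vs = ws := by
      refine List.Perm.eq_of_pairwise (le := fun x y => pos len ws x < pos len ws y) ?_ ?_ ?_
        (hperm.symm.trans w1)
      · intro a b _ _ h1 h2; omega
      · rw [hvs, List.pairwise_ofFn]
        intro i j hij
        have := hπ hij
        simpa only [hlfw] using this
      · exact pairwise_pos (w1.nodup_iff.mp nU) fun x hx => hpos x (w1.mem_iff.mpr hx)
    rw [hwv]
    exact ⟨w2, w3⟩
  have hlf : ∀ i : Fin D.length, ∀ o < len (node i),
      lf t (pos len us (node i) + o) = pos len vs (node i) + o := fun i o ho =>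
    RComp.lf_pos ht hflat nU hperm hsort hstab ((hmem _).mpr ⟨i, rfl⟩) ho
  have hlp : ∀ i, 0 < len (node i) := fun i => hpos _ ((hmem _).mpr ⟨i, rfl⟩)
  have hlf0 : ∀ i : Fin D.length, lf t (start D i) = pos len vs (node i) := fun i => by
    rw [hst]; exact hlf i 0 (hlp i)
  have hF : ∀ (i : Fin D.length) p, p ∈ fInterval t D i ↔
      pos len vs (node i) ≤ p ∧ p < pos len vs (node i) + len (node i) := by
    intro i p
    have := hlp i
    rw [fInterval, hlf0, hst', Nat.add_sub_assoc this, hlf i _ (by omega), Set.mem_Icc]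
    omega
  have hU : ∀ (i : Fin D.length) p, p ∈ uInterval D i ↔
      pos len us (node i) ≤ p ∧ p < pos len us (node i) + len (node i) := by
    intro i p
    have := hlp i
    rw [uInterval, hst, hst', Set.mem_Icc]
    omega
  have htot : total len us = total len vs := total_perm hperm
  obtain ⟨d, hd1, hd2, hd3, hd4⟩ := exists_dollar ht hflat hpos
  have hdol : S.regs.dol = d := by
    obtain ⟨i, rfl⟩ := (hmem d).mp hd1
    refine h.dollarNode i ?_
    rw [← hlab]
    exact hd2
  refine ⟨⟨us, vs, chr, len, fun x => (S.mem x).tgtL, fun x => (S.mem x).labL,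
    fun x => (S.mem x).tgtF, fun x => (S.mem x).labF, fun x => (S.mem x).slot, S.slots, S.fresh,
    S.regs.dol, S.tree, S.heavyU, S.heavyV⟩, ?_, ?_, ?_, hflat, hDl, rfl⟩
  · exact ⟨isLinkedList_iff.mp h.listU, isLinkedList_iff.mp hlv, h.order_eq, fun _ => rfl,
      fun _ => rfl, fun _ => rfl, fun _ => rfl, fun _ => rfl, fun _ => rfl, fun _ => rfl, rfl, rfl,
      rfl, rfl, rfl, rfl⟩
  · constructor <;> dsimp only
    case nodupU => exact nU
    case nodupV => exact nV
    case mem_iff => intro x; rw [hmem, hmemv]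
    case len_pos => exact hpos
    case edgesL =>
      intro x hx
      obtain ⟨i, rfl⟩ := (hmem x).mp hx
      have h1 := pos_add_le_total (len := len) hx
      obtain ⟨y, hy, h2, h3⟩ := exists_pos (len := len) nV (p := pos len us (node i)) (by
        have := hlp i; omega)
      obtain ⟨j, rfl⟩ := (hmemv y).mp hy
      have hE : (i, j) ∈ (lfGraph t D).EL := by
        change start D i ∈ fInterval t D j
        rw [hF, hst]; exact ⟨h2, h3⟩
      have h5 := h.edgeLabelL i j hE
      simp only [lfGraph] at h5
      rw [hlf0, hst] at h5
      beta_reduce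
      rw [(h.edgeL i j).mp hE, h5]
      exact ⟨hy, by omega, by omega⟩
    case edgesF =>
      intro x hx
      obtain ⟨i, rfl⟩ := (hmemv x).mp hx
      have h1 := pos_add_le_total (len := len) hx
      obtain ⟨y, hy, h2, h3⟩ := exists_pos (len := len) nU (p := pos len vs (node i)) (by
        have := hlp i; omega)
      obtain ⟨j, rfl⟩ := (hmem y).mp hy
      have hE : (i, j) ∈ (lfGraph t D).EF := by
        change lf t (start D i) ∈ uInterval D j
        rw [hU, hlf0]; exact ⟨h2, h3⟩
      have h5 := h.edgeLabelF j i hE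
      simp only [lfGraph] at h5
      rw [hlf0, hst] at h5
      beta_reduce
      rw [(h.edgeF j i).mp hE, h5]
      exact ⟨hy, by omega, by omega⟩
    case lt_fresh =>
      intro x hx
      obtain ⟨i, rfl⟩ := (hmem x).mp hx
      exact h.node_lt i
    case sorted => exact hsort
    case stable => exact hstab
    case dol_mem => rw [hdol]; exact hd1
    case dol_chr => rw [hdol]; exact hd2
    case dol_len => rw [hdol]; exact hd3
    case dol_lt => rw [hdol]; exact hd4
  · constructor <;> dsimp only
    case valid => exact h.tree_valid
    case nodup => exact h.tree_slots
    case slot =>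
      intro x hx s
      obtain ⟨i, rfl⟩ := (hmem x).mp hx
      exact h.tree_slot i s
    case key =>
      intro s hs
      obtain ⟨i, hi⟩ := h.tree_key s hs
      rw [hi]
      exact (congrArg Prod.fst (hlab i)).symm
    case sub =>
      -- The tree and the list of `V` are both ordered by keys, and this order is asymmetric; so the
      -- tree nodes are what remains of `vs` after filtering.
      have hr : ∀ x y, (∃ i j, node i = x ∧ node j = y ∧ KeyLT D i j) →
          ¬ ∃ i j, node i = y ∧ node j = x ∧ KeyLT D i j := by
        rintro x y ⟨i, j, rfl, rfl, h1⟩ ⟨i', j', h2, h3, h4⟩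
        obtain rfl := h.node_inj h2
        obtain rfl := h.node_inj h3
        rw [KeyLT, Fin.lt_def] at h1 h4
        omega
      have hvp : vs.Pairwise (fun x y => ∃ i j, node i = x ∧ node j = y ∧ KeyLT D i j) := by
        refine (pairwise_stable hsort hstab).imp_of_mem fun {x y} hx hy hxy => ?_
        obtain ⟨i, rfl⟩ := (hmemv x).mp hx
        obtain ⟨j, rfl⟩ := (hmemv y).mp hy
        refine ⟨i, j, rfl, rfl, ?_⟩
        rw [KeyLT, ← hlab i, ← hlab j]
        rcases hxy with hxy | ⟨hc, i', j', hi', hj', e1, e2, hij⟩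
        · exact Or.inl hxy
        · refine Or.inr ⟨hc, ?_⟩
          rw [← hget i] at e1
          rw [← hget j] at e2
          have a1 := (nU.getElem_inj_iff).mp e1
          have a2 := (nU.getElem_inj_iff).mp e2
          rw [Fin.lt_def]
          omega
      have htn := h.tree_sorted
      have hsub : ∀ x ∈ S.treeNodes, x ∈ vs := by
        intro x hx
        obtain ⟨s, hs, rfl⟩ := List.mem_map.mp hx
        obtain ⟨i, hi⟩ := h.tree_key s hs
        rw [hi, hmemv]
        exact ⟨i, rfl⟩
      have hnd : S.treeNodes.Nodup := by
        refine htn.imp fun {x y} hxy => ?_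
        rintro rfl
        exact hr _ _ hxy hxy
      have heq : S.treeNodes = vs.filter (fun x => decide (x ∈ S.treeNodes)) := by
        refine List.Perm.eq_of_pairwise ?_ htn (hvp.filter _) ?_
        · intro a b _ _ h1 h2
          exact absurd h2 (hr _ _ h1)
        · refine (List.perm_ext_iff_of_nodup hnd (nV.filter _)).mpr fun x => ?_
          rw [List.mem_filter, decide_eq_true_eq]
          exact ⟨fun hx => ⟨hsub x hx, hx⟩, fun hx => hx.2⟩
      change S.treeNodes.Sublist vs
      rw [heq]
      exact List.filter_sublist

/-! ## The B-tree -/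

/-- By `hs`, a node occupies at most one slot, so overwriting this slot replaces precisely that
node. -/
theorem Model.replaceInTree_treeNodes {M : Model} {y x a : ℕ}
    (hs : ∀ s, M.slot y = some s ↔ s ∈ M.tree.inorder ∧ (M.slots s).1 = y) :
    (M.replaceInTree y x a).treeNodes = M.treeNodes.map (fun z => if z = y then x else z) := by
  unfold Model.replaceInTree
  split
  · rename_i s h
    have h1 := (hs s).mp h
    simp only [Model.treeNodes, List.map_map]
    refine List.map_congr_left fun s' hs' => ?_
    simp only [Function.comp, Function.update_apply]
    by_cases e : s' = s
    · subst e; simp [h1.2]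
    · have : (M.slots s').1 ≠ y := by
        intro h2
        have h3 := (hs s').mpr ⟨hs', h2⟩
        rw [h, Option.some_inj] at h3
        exact e h3.symm
      simp [e, this]
  · rename_i h
    simp only [Model.treeNodes, List.map_map]
    refine List.map_congr_left fun s' hs' => ?_
    have : (M.slots s').1 ≠ y := by
      intro h2
      have h3 := (hs s').mpr ⟨hs', h2⟩
      rw [h] at h3
      exact absurd h3 (by simp)
    simp [this]

/-- Overwriting an element of the B-tree keeps the invariant if it keeps the order. -/
theorem TreeInv.replace {m : ℕ} {M : Model} {y x a : ℕ} (hv : M.tree.IsBTree m)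
    (hn : M.tree.inorder.Nodup)
    (hs : ∀ z, z ∈ M.us ∨ z = y → ∀ s, M.slot z = some s ↔ s ∈ M.tree.inorder ∧ (M.slots s).1 = z)
    (_hx : x ∈ M.us) (_hxy : x ≠ y) (hxn : x ∉ M.treeNodes ∨ y ∉ M.treeNodes)
    (hk : ∀ s ∈ M.tree.inorder, (M.slots s).1 ≠ y → (M.slots s).2 = M.chr (M.slots s).1)
    (ha : a = M.chr x)
    (hsub : (M.treeNodes.map (fun z => if z = y then x else z)).Sublist M.vs) :
    TreeInv m (M.replaceInTree y x a) := by
  have htn := Model.replaceInTree_treeNodes (x := x) (a := a) (hs y (Or.inr rfl))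
  have hsy := hs y (Or.inr rfl)
  have hvs : (M.replaceInTree y x a).vs = M.vs := by unfold Model.replaceInTree; split <;> rfl
  have hsub' : (M.replaceInTree y x a).treeNodes.Sublist (M.replaceInTree y x a).vs := by
    rw [htn, hvs]; exact hsub
  unfold Model.replaceInTree at hsub' ⊢
  split
  · rename_i s h
    rw [h] at hsub'
    have h1 := (hsy s).mp h
    have hyn : y ∈ M.treeNodes := List.mem_map.mpr ⟨s, h1.1, h1.2⟩
    have hxn' : x ∉ M.treeNodes := hxn.resolve_right (not_not.mpr hyn)
    constructor <;> dsimp only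
    case valid => exact hv
    case nodup => exact hn
    case slot =>
      intro z hz s'
      have hz' := hs z (Or.inl hz) s'
      have hzs := hs z (Or.inl hz) s
      have hys := hsy s'
      have hx' : s' ∈ M.tree.inorder → (M.slots s').1 ≠ x := by
        intro h2 h3
        exact hxn' (List.mem_map.mpr ⟨s', h2, h3⟩)
      simp only [Function.update_apply]
      grind
    case key =>
      intro s' hs'
      rw [Function.update_apply]
      split_ifs with h2
      · exact ha
      · refine hk s' hs' fun h3 => ?_
        have h4 := (hsy s').mpr ⟨hs', h3⟩
        rw [h, Option.some_inj] at h4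
        exact h2 h4.symm
    case sub => exact hsub'
  · rename_i h
    rw [h] at hsub'
    constructor
    case valid => exact hv
    case nodup => exact hn
    case slot => exact fun z hz => hs z (Or.inl hz)
    case key =>
      intro s hs'
      refine hk s hs' fun h3 => ?_
      have h4 := (hsy s).mpr ⟨hs', h3⟩
      rw [h] at h4
      exact absurd h4 (by simp)
    case sub => exact hsub'

theorem map_replace_of_notMem {l : List ℕ} {y x : ℕ} (h : y ∉ l) :
    l.map (fun z => if z = y then x else z) = l := by
  conv_rhs => rw [← List.map_id l]
  refine List.map_congr_left fun z hz => ?_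
  rw [if_neg (by rintro rfl; exact h hz)]; rfl

theorem mem_map_replace {l : List ℕ} {y x z : ℕ} :
    z ∈ l.map (fun z => if z = y then x else z) ↔ (z = x ∧ y ∈ l) ∨ (z ≠ y ∧ z ∈ l) := by
  rw [List.mem_map]
  constructor
  · rintro ⟨w, hw, rfl⟩
    split_ifs with h
    · exact Or.inl ⟨rfl, h ▸ hw⟩
    · exact Or.inr ⟨h, hw⟩
  · rintro (⟨rfl, h⟩ | ⟨h1, h2⟩)
    · exact ⟨y, h, by simp⟩
    · exact ⟨z, h2, by simp [h1]⟩

/-- Replacement of a member of a sublist by another one that is put at the same place. -/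
theorem sublist_replace {A B l : List ℕ} {y x : ℕ} (hl : l.Sublist (A ++ y :: B))
    (hn : (A ++ y :: B).Nodup) :
    (l.map (fun z => if z = y then x else z)).Sublist (A ++ x :: B) := by
  have := hl.map (fun z => if z = y then x else z)
  rw [List.map_append, List.map_cons, map_replace_of_notMem (notMem_left_of_nodup hn),
    map_replace_of_notMem (notMem_right_of_nodup hn), if_pos rfl] at this
  exact this

theorem sublist_of_notMem {A B l : List ℕ} {x : ℕ} (hl : l.Sublist (A ++ x :: B)) (hx : x ∉ l) :
    l.Sublist (A ++ B) := by
  obtain ⟨l₁, l₂, rfl, h1, h2⟩ := List.sublist_append_iff.mp hl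
  refine h1.append ?_
  cases h2 with
  | cons _ h => exact h
  | cons_cons _ h => simp at hx

theorem TreeInv.treeNodes_mem {m : ℕ} {M : Model} (hT : TreeInv m M) (hg : Graph M) {x : ℕ}
    (hx : x ∈ M.treeNodes) : x ∈ M.us := (hg.mem_iff _).mpr (hT.sub.mem hx)

/-- The new node stands right behind `j` in `V` and takes over its slot, so the order of the
elements is kept. -/
theorem TreeInv.split {m : ℕ} {M : Model} (hT : TreeInv m M) (hg : Graph M) {j d z h off : ℕ}
    (hj : j ∈ M.us) :
    TreeInv m ((M.split j d z h off).replaceInTree j M.fresh (M.chr j)) ∧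
    ((M.split j d z h off).replaceInTree j M.fresh (M.chr j)).treeNodes =
      M.treeNodes.map (fun z => if z = j then M.fresh else z) := by
  have hfu := hg.fresh_notMem
  have hft : M.fresh ∉ M.treeNodes := fun h => hfu (hT.treeNodes_mem hg h)
  have hjf : M.fresh ≠ j := by rintro rfl; exact hfu hj
  obtain ⟨A, B, e⟩ := List.append_of_mem ((hg.mem_iff _).mp hj)
  obtain ⟨A', B', e'⟩ := List.append_of_mem hj
  have hnV := hg.nodupV
  have hnU := hg.nodupU
  have i2 : insertAfter j M.fresh M.vs = A ++ j :: M.fresh :: B := by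
    rw [e] at hnV ⊢; exact insertAfter_append (notMem_left_of_nodup hnV)
  have i1 : insertAfter j M.fresh M.us = A' ++ j :: M.fresh :: B' := by
    rw [e'] at hnU ⊢; exact insertAfter_append (notMem_left_of_nodup hnU)
  have hmemU : ∀ w, w ∈ (M.split j d z h off).us ↔ w = M.fresh ∨ w ∈ M.us := by
    intro w
    simp only [Model.split, i1]
    rw [e']
    simp only [List.mem_append, List.mem_cons]
    tauto
  have hslot : ∀ w, w ∈ (M.split j d z h off).us ∨ w = j → ∀ s,
      (M.split j d z h off).slot w = some s ↔ s ∈ M.tree.inorder ∧ (M.slots s).1 = w := by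
    intro w hw s
    by_cases hwf : w = M.fresh
    · subst hwf
      simp only [Model.split, Function.update_self]
      constructor
      · intro h; exact absurd h (by simp)
      · rintro ⟨h1, h2⟩
        exact absurd (List.mem_map.mpr ⟨s, h1, h2⟩) hft
    · have hwu : w ∈ M.us := by
        rw [hmemU] at hw
        rcases hw with (h | h) | h
        · exact absurd h hwf
        · exact h
        · rw [h]; exact hj
      simp only [Model.split, Function.update_of_ne hwf]
      exact hT.slot w hwu s
  have htn := Model.replaceInTree_treeNodes (M := M.split j d z h off) (x := M.fresh)
    (a := M.chr j) (hslot j (Or.inr rfl))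
  refine ⟨TreeInv.replace hT.valid hT.nodup hslot ((hmemU _).mpr (Or.inl rfl)) hjf (Or.inl hft) ?_
    ?_ ?_, htn⟩
  · intro s hs _
    have : (M.slots s).1 ≠ M.fresh := fun h => hft (List.mem_map.mpr ⟨s, hs, h⟩)
    simp only [Model.split, Function.update_of_ne this]
    exact hT.key s hs
  · simp only [Model.split, Function.update_self]
  · simp only [Model.split, i2]
    have h1 := hT.sub
    rw [e] at h1 hnV
    exact (sublist_replace (x := M.fresh) h1 hnV).trans
      (List.Sublist.append_left (List.sublist_cons_self _ _) _)

/-- Merging the nodes `p` and `q`. -/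
def Model.absorb (M : Model) (p q : ℕ) : Model := (M.merge p q).replaceInTree q p (M.chr p)

/-- If both nodes had elements, `p` would occur twice afterwards; `hpq` excludes this. It holds
either because `p` violates the tree condition or because `q` is the old `dollar` node, which has
lost its element. -/
theorem TreeInv.absorb {m : ℕ} {M : Model} (hT : TreeInv m M) (hg : Graph M) {p q : ℕ}
    {A B : List ℕ} (e : M.vs = A ++ p :: q :: B)
    (hpq : p ∉ M.treeNodes ∨ q ∉ M.treeNodes) :
    TreeInv m (M.absorb p q) ∧
    (M.absorb p q).treeNodes = M.treeNodes.map (fun z => if z = q then p else z) := by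
  have hnV := hg.nodupV
  have hne : p ≠ q := by
    rintro rfl
    rw [e] at hnV
    exact notMem_right_of_nodup hnV (by simp)
  have hp : p ∈ M.us := (hg.mem_iff _).mpr (by simp [e])
  have hq : q ∈ M.us := (hg.mem_iff _).mpr (by simp [e])
  have i2 : M.vs.erase q = A ++ p :: B := by
    have := erase_append_cons (A := A ++ [p]) (B := B) (x := q) (by simpa [e] using hnV)
    simpa [e] using this
  have hslot : ∀ w, w ∈ (M.merge p q).us ∨ w = q → ∀ s,
      (M.merge p q).slot w = some s ↔ s ∈ M.tree.inorder ∧ (M.slots s).1 = w := by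
    intro w hw s
    refine hT.slot w ?_ s
    rcases hw with h | rfl
    · exact List.mem_of_mem_erase h
    · exact hq
  have htn := Model.replaceInTree_treeNodes (M := M.merge p q) (x := p)
    (a := M.chr p) (hslot q (Or.inr rfl))
  refine ⟨TreeInv.replace hT.valid hT.nodup hslot
    ((hg.nodupU.mem_erase_iff).mpr ⟨hne, hp⟩) hne hpq (fun s hs _ => hT.key s hs) rfl ?_, htn⟩
  have h1 := hT.sub
  simp only [Model.merge, i2]
  change (M.treeNodes.map _).Sublist _
  rw [e] at h1 hnV
  have hn1 : ((A ++ [p]) ++ q :: B).Nodup := by simpa using hnV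
  by_cases hqt : q ∈ M.treeNodes
  · have h2 := sublist_of_notMem h1 (hpq.resolve_right (not_not.mpr hqt))
    exact sublist_replace h2 (hnV.sublist (List.Sublist.append_left (List.sublist_cons_self _ _) _))
  · rw [map_replace_of_notMem hqt]
    have := sublist_of_notMem (A := A ++ [p]) (B := B) (x := q) (l := M.treeNodes)
      (by simpa using h1) hqt
    simpa using this

/-- Insertion of the new dollar node, including the B-tree. -/
def Model.newDollar (M : Model) (c : ℕ) (us vs : List ℕ) : Model :=
  (M.insertDollar c us vs).replaceInTree M.dol M.fresh dollar

/-- The new node takes both the slot of the old one and its place at the front of `V`; the old node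
moves elsewhere without an element. -/
theorem TreeInv.newDollar {m : ℕ} {M : Model} (hT : TreeInv m M) (hg : Graph M) {c : ℕ}
    {U1 U2 V1 V2 : List ℕ} (eU : M.us = U1 ++ U2)
    (eV : M.vs = M.dol :: (V1 ++ V2)) :
    TreeInv m (M.newDollar c (U1 ++ M.fresh :: U2) (M.fresh :: (V1 ++ M.dol :: V2))) ∧
    (M.newDollar c (U1 ++ M.fresh :: U2) (M.fresh :: (V1 ++ M.dol :: V2))).treeNodes =
      M.treeNodes.map (fun z => if z = M.dol then M.fresh else z) := by
  have hfu := hg.fresh_notMem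
  have hft : M.fresh ∉ M.treeNodes := fun h => hfu (hT.treeNodes_mem hg h)
  have hdf : M.fresh ≠ M.dol := by intro h; exact hfu (h ▸ hg.dol_mem)
  set us' := U1 ++ M.fresh :: U2 with hus
  set vs' := M.fresh :: (V1 ++ M.dol :: V2) with hvs
  have hmemU : ∀ w, w ∈ us' ↔ w = M.fresh ∨ w ∈ M.us := by
    intro w
    rw [hus, eU]
    simp only [List.mem_append, List.mem_cons]
    tauto
  have hslot : ∀ w, w ∈ (M.insertDollar c us' vs').us ∨ w = M.dol → ∀ s,
      (M.insertDollar c us' vs').slot w = some s ↔ s ∈ M.tree.inorder ∧ (M.slots s).1 = w := by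
    intro w hw s
    by_cases hwf : w = M.fresh
    · subst hwf
      simp only [Model.insertDollar, Function.update_self]
      constructor
      · intro h; exact absurd h (by simp)
      · rintro ⟨h1, h2⟩
        exact absurd (List.mem_map.mpr ⟨s, h1, h2⟩) hft
    · have hwu : w ∈ M.us := by
        rcases hw with h | h
        · exact ((hmemU w).mp h).resolve_left hwf
        · rw [h]; exact hg.dol_mem
      simp only [Model.insertDollar, Function.update_of_ne hwf]
      exact hT.slot w hwu s
  have htn := Model.replaceInTree_treeNodes (M := M.insertDollar c us' vs') (x := M.fresh)
    (a := dollar) (hslot M.dol (Or.inr rfl))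
  refine ⟨TreeInv.replace hT.valid hT.nodup hslot ((hmemU _).mpr (Or.inl rfl)) hdf (Or.inl hft) ?_
    ?_ ?_, htn⟩
  · intro s hs hsd
    have : (M.slots s).1 ≠ M.fresh := fun h => hft (List.mem_map.mpr ⟨s, hs, h⟩)
    change (M.slots s).1 ≠ M.dol at hsd
    simp only [Model.insertDollar, Function.update_of_ne this, Function.update_of_ne hsd]
    exact hT.key s hs
  · simp only [Model.insertDollar, Function.update_of_ne hdf, Function.update_self]
  · change (M.treeNodes.map _).Sublist vs'
    have h1 := hT.sub
    have hnV := hg.nodupV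
    rw [eV] at h1 hnV
    have := sublist_replace (A := []) (x := M.fresh) h1 hnV
    refine this.trans ?_
    rw [List.nil_append, hvs]
    exact List.Sublist.cons_cons _ (List.Sublist.append_left (List.sublist_cons_self _ _) _)

/-! ## Nodes that belong into the B-tree -/

section
variable (M : Model) (y x a : ℕ)

@[simp] theorem Model.replaceInTree_us : (M.replaceInTree y x a).us = M.us := by
  unfold Model.replaceInTree; split <;> rfl

@[simp] theorem Model.replaceInTree_vs : (M.replaceInTree y x a).vs = M.vs := by
  unfold Model.replaceInTree; split <;> rfl

@[simp] theorem Model.replaceInTree_chr : (M.replaceInTree y x a).chr = M.chr := by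
  unfold Model.replaceInTree; split <;> rfl

@[simp] theorem Model.replaceInTree_len : (M.replaceInTree y x a).len = M.len := by
  unfold Model.replaceInTree; split <;> rfl

@[simp] theorem Model.replaceInTree_tgtL : (M.replaceInTree y x a).tgtL = M.tgtL := by
  unfold Model.replaceInTree; split <;> rfl

@[simp] theorem Model.replaceInTree_tgtF : (M.replaceInTree y x a).tgtF = M.tgtF := by
  unfold Model.replaceInTree; split <;> rfl

@[simp] theorem Model.replaceInTree_dol : (M.replaceInTree y x a).dol = M.dol := by
  unfold Model.replaceInTree; split <;> rfl

@[simp] theorem Model.replaceInTree_heavyU : (M.replaceInTree y x a).heavyU = M.heavyU := by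
  unfold Model.replaceInTree; split <;> rfl

@[simp] theorem Model.replaceInTree_heavyV : (M.replaceInTree y x a).heavyV = M.heavyV := by
  unfold Model.replaceInTree; split <;> rfl

end

/-- The element that follows `z` in the list. -/
def nxt : List ℕ → ℕ → Option ℕ
  | [], _ => none
  | a :: l, z => if z = a then l.head? else nxt l z

theorem nxt_append {A B : List ℕ} {z : ℕ} (h : z ∉ A) : nxt (A ++ z :: B) z = B.head? := by
  induction A with
  | nil => simp [nxt]
  | cons a A ih =>
    simp only [List.mem_cons, not_or] at h
    simp [nxt, h.1, ih h.2]

theorem nxt_of_notMem {l : List ℕ} {z : ℕ} (h : z ∉ l) : nxt l z = none := by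
  induction l with
  | nil => rfl
  | cons a l ih =>
    simp only [List.mem_cons, not_or] at h
    simp [nxt, h.1, ih h.2]

theorem mem_of_nxt {l : List ℕ} {z a : ℕ} (h : nxt l z = some a) : a ∈ l := by
  induction l with
  | nil => simp [nxt] at h
  | cons b l ih =>
    rw [nxt] at h
    split_ifs at h
    · exact List.mem_cons_of_mem _ (List.mem_of_mem_head? h)
    · exact List.mem_cons_of_mem _ (ih h)

theorem nxt_insert {A B : List ℕ} {p q w : ℕ} (h1 : w ≠ p) (h2 : w ≠ q) :
    nxt (A ++ p :: q :: B) w = nxt (A ++ p :: B) w := by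
  induction A with
  | nil => simp [nxt, h1, h2]
  | cons a A ih =>
    simp only [List.cons_append, nxt, ih]
    cases A <;> rfl

/-- Seen through `f`, an element with the same value as its successor is invisible to the elements
before it. -/
theorem nxt_map_insert {A B : List ℕ} {p q w : ℕ} {f : ℕ → ℕ} (h : w ≠ p) (hf : f p = f q) :
    (nxt (A ++ p :: q :: B) w).map f = (nxt (A ++ q :: B) w).map f := by
  induction A with
  | nil => simp [nxt, h]
  | cons a A ih =>
    simp only [List.cons_append, nxt]
    split_ifs
    · cases A <;> simp [hf]
    · exact ih

/-- The element that follows `z` exists and carries another character. -/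
def DiffNext (l : List ℕ) (chr : ℕ → ℕ) (z : ℕ) : Prop :=
  ∃ a, (nxt l z).map chr = some a ∧ chr z ≠ a

theorem DiffNext.mem {l : List ℕ} {chr : ℕ → ℕ} {z : ℕ} (h : DiffNext l chr z) : z ∈ l := by
  by_contra hz
  obtain ⟨a, h1, -⟩ := h
  rw [nxt_of_notMem hz] at h1
  simp at h1

theorem diffNext_append {A B : List ℕ} {chr : ℕ → ℕ} {z : ℕ} (h : z ∉ A) :
    DiffNext (A ++ z :: B) chr z ↔ ∃ w, B.head? = some w ∧ chr z ≠ chr w := by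
  rw [DiffNext, nxt_append h]
  cases B <;> simp

theorem diffNext_congr {l : List ℕ} {chr chr' : ℕ → ℕ} (h : ∀ y ∈ l, chr y = chr' y) (z : ℕ) :
    DiffNext l chr z ↔ DiffNext l chr' z := by
  by_cases hz : z ∈ l
  · rw [DiffNext, DiffNext, h z hz]
    have : (nxt l z).map chr = (nxt l z).map chr' := by
      cases e : nxt l z with
      | none => rfl
      | some a => simp [h a (mem_of_nxt e)]
    rw [this]
  · exact ⟨fun h => absurd h.mem hz, fun h => absurd h.mem hz⟩

/-- Of two neighbours with equal characters only the second can differ from its successor. The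
merged element has this successor and so plays the role of `q`. -/
theorem diffNext_merge {A B : List ℕ} {chr : ℕ → ℕ} {p q : ℕ} (hn : (A ++ p :: q :: B).Nodup)
    (hc : chr p = chr q) (z : ℕ) :
    DiffNext (A ++ p :: B) chr z ↔ (z = p ∧ DiffNext (A ++ p :: q :: B) chr q) ∨
      (z ≠ q ∧ DiffNext (A ++ p :: q :: B) chr z) := by
  have hpA := notMem_left_of_nodup hn
  have e : A ++ p :: q :: B = (A ++ [p]) ++ q :: B := by simp
  have hqA : q ∉ A ++ [p] := by rw [e] at hn; exact notMem_left_of_nodup hn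
  have hqB : q ∉ B := by rw [e] at hn; exact notMem_right_of_nodup hn
  have h2 : ¬ DiffNext (A ++ p :: q :: B) chr p := by
    rw [diffNext_append hpA]; simp [hc]
  by_cases h1 : z = p
  · subst h1
    rw [diffNext_append hpA, e, diffNext_append hqA, hc, ← e]
    simp [h2]
  · by_cases h3 : z = q
    · subst h3
      have : ¬ DiffNext (A ++ p :: B) chr z := fun h => by
        have := h.mem
        simp only [List.mem_append, List.mem_cons, List.not_mem_nil] at this hqA
        tauto
      simp [this, h1]
    · simp only [h1, false_and, false_or, ne_eq, h3, not_false_eq_true, true_and]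
      rw [DiffNext, DiffNext, nxt_insert h1 h3]

/-- The comparison of `diffNext_merge` read backwards: the second part takes the role of the divided
element. -/
theorem diffNext_split {A B : List ℕ} {chr : ℕ → ℕ} {p q : ℕ} (hn : (A ++ p :: q :: B).Nodup)
    (hc : chr p = chr q) (z : ℕ) :
    DiffNext (A ++ p :: q :: B) chr z ↔ (z = q ∧ DiffNext (A ++ p :: B) chr p) ∨
      (z ≠ p ∧ DiffNext (A ++ p :: B) chr z) := by
  have h0 := diffNext_merge hn hc
  have hpA := notMem_left_of_nodup hn
  have h2 : ¬ DiffNext (A ++ p :: q :: B) chr p := by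
    rw [diffNext_append hpA]; simp [hc]
  have hpq : p ≠ q := by rintro rfl; exact notMem_right_of_nodup hn (by simp)
  rw [h0 p, h0 z]
  by_cases h1 : z = p
  · subst h1; simp [hpq, h2]
  · by_cases h3 : z = q
    · subst h3; simp [h2]
    · simp [h1, h3]

/-- The inserted element agrees with its successor, so it fails the condition itself and shows the
same character to its predecessor as `b` did. -/
theorem diffNext_insert {A B : List ℕ} {chr : ℕ → ℕ} {i b : ℕ} (hn : (A ++ i :: b :: B).Nodup)
    (hc : chr i = chr b) (z : ℕ) :
    DiffNext (A ++ i :: b :: B) chr z ↔ DiffNext (A ++ b :: B) chr z := by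
  have hiA := notMem_left_of_nodup hn
  by_cases h : z = i
  · subst h
    have h1 : ¬ DiffNext (A ++ b :: B) chr z := fun h => by
      have := h.mem
      have := notMem_right_of_nodup hn
      simp_all
    rw [diffNext_append hiA]
    simp [h1, hc]
  · rw [DiffNext, DiffNext, nxt_map_insert h hc]

/-- The condition that decides whether `v_z` belongs into the B-tree. -/
def NodeCond (M : Model) (z : ℕ) : Prop :=
  z = M.dol ∨ DiffNext (M.us.filter (· ≠ M.dol)) M.chr z

theorem Graph.mem_of_nodeCond {M : Model} (hg : Graph M) {z : ℕ} (hz : NodeCond M z) :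
    z ∈ M.us := by
  rcases hz with rfl | h
  · exact hg.dol_mem
  · exact (List.mem_filter.mp h.mem).1

/-- Condition (ii) looks past the `dollar` node. With this node deleted from the list, (i) and (ii)
are the same condition; since `dollar` occurs once, at most one node has to be skipped. -/
theorem Graph.treeCond_iff {M : Model} (hg : Graph M) {i : ℕ} (h : i < M.labels.length)
    (hi : i < M.us.length) : TreeCond M.labels ⟨i, h⟩ ↔ NodeCond M M.us[i] := by
  have hl : ∀ k : ℕ, M.labels[k]? = M.us[k]?.map (fun x => (M.chr x, M.len x)) := by
    intro k; simp [Model.labels, labels]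
  have e : M.us = M.us.take i ++ M.us[i] :: M.us.drop (i + 1) := by
    rw [← List.drop_eq_getElem_cons, List.take_append_drop]
  have hgi : M.labels[i].1 = M.chr M.us[i] := by rw [labels_getElem hi]
  have h1 : M.us[i + 1]? = (M.us.drop (i + 1)).head? := by simp
  have h2 : M.us[i + 2]? = (M.us.drop (i + 1))[1]? := by
    rw [List.getElem?_drop]
  simp only [TreeCond, Fin.getElem_fin, hgi, hl, h1, h2]
  set z := M.us[i] with hz
  have hzu : z ∈ M.us := List.getElem_mem _
  generalize M.us.take i = A at e
  generalize M.us.drop (i + 1) = R at e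
  have hn := hg.nodupU
  have hmem := hg.dol_mem
  have hlt := hg.dol_lt
  have hdc := hg.dol_chr
  rw [NodeCond]
  by_cases hzd : z = M.dol
  · simp [hzd, hdc]
  have hzc := hlt z hzu hzd
  have hzA : z ∉ A.filter (· ≠ M.dol) := by
    rw [e] at hn
    exact fun hh => notMem_left_of_nodup hn (List.mem_filter.mp hh).1
  have eW : M.us.filter (· ≠ M.dol) = A.filter (· ≠ M.dol) ++ z :: R.filter (· ≠ M.dol) := by
    rw [e, List.filter_append, List.filter_cons_of_pos (by simpa using hzd)]
  rw [eW, diffNext_append hzA]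
  have hR : ∀ y ∈ R, y ∈ M.us := fun y hy => by rw [e]; simp [hy]
  simp only [hzd, false_or, hzc.ne', or_false]
  cases R with
  | nil => simp
  | cons r R =>
    have hr := hR r (by simp)
    by_cases hrd : r = M.dol
    · have hdR : M.dol ∉ R := by
        rw [e] at hn
        rw [← hrd]
        have : ((A ++ [z]) ++ r :: R).Nodup := by simpa using hn
        exact notMem_right_of_nodup this
      have : R.filter (· ≠ M.dol) = R := by
        rw [List.filter_eq_self]
        intro y hy
        simp only [ne_eq, decide_eq_true_eq]
        rintro rfl; exact hdR hy
      rw [List.filter_cons_of_neg (by simpa using hrd), this]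
      cases R with
      | nil => simp [hrd, hdc]
      | cons r' R => simp [hrd, hdc, eq_comm]
    · rw [List.filter_cons_of_pos (by simpa using hrd)]
      have := hlt r hr hrd
      simp [this.ne, eq_comm]

/-- The B-tree contains only nodes that satisfy the condition and, if `b` holds, all of them. -/
def Exact (b : Prop) (M : Model) : Prop :=
  ∀ z, (z ∈ M.treeNodes → NodeCond M z) ∧ (b → NodeCond M z → z ∈ M.treeNodes)

/-- If `x` takes the place of `y` both in the B-tree and in the condition, then the B-tree
remains exact. -/
theorem Exact.replace {b : Prop} {M M' : Model} {y x : ℕ} (h : Exact b M)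
    (ht : M'.treeNodes = M.treeNodes.map (fun z => if z = y then x else z))
    (hc : ∀ z, NodeCond M' z ↔ (z = x ∧ NodeCond M y) ∨ (z ≠ y ∧ NodeCond M z)) :
    Exact b M' := by
  intro z
  have h1 := h y
  have h2 := h z
  rw [ht, mem_map_replace, hc]
  tauto

/-- The second part inherits both the successor of `j` and its slot, whereas the first part is
followed by its own character. -/
theorem Exact.split {b : Prop} {M : Model} (hE : Exact b M) (hg : Graph M) {m j d z h off : ℕ}
    (hT : TreeInv m M) (hj : j ∈ M.us) (hjd : j ≠ M.dol) :
    Exact b ((M.split j d z h off).replaceInTree j M.fresh (M.chr j)) := by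
  refine hE.replace (hT.split hg hj).2 fun w => ?_
  obtain ⟨A, B, e⟩ := List.append_of_mem hj
  have hnU := hg.nodupU
  have hfu := hg.fresh_notMem
  have hfd : M.fresh ≠ M.dol := fun h => hfu (h ▸ hg.dol_mem)
  have i1 : insertAfter j M.fresh M.us = A ++ j :: M.fresh :: B := by
    rw [e] at hnU ⊢; exact insertAfter_append (notMem_left_of_nodup hnU)
  have hn' : (A ++ j :: M.fresh :: B).Nodup := by
    have : ((A ++ [j]) ++ M.fresh :: B).Nodup := by
      rw [List.nodup_middle, List.nodup_cons]
      rw [e] at hfu hnU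
      simpa using ⟨by simpa using hfu, by simpa using hnU⟩
    simpa using this
  have eW : M.us.filter (· ≠ M.dol) = A.filter (· ≠ M.dol) ++ j :: B.filter (· ≠ M.dol) := by
    rw [e, List.filter_append, List.filter_cons_of_pos (by simpa using hjd)]
  have eW' : (A ++ j :: M.fresh :: B).filter (· ≠ M.dol) =
      A.filter (· ≠ M.dol) ++ j :: M.fresh :: B.filter (· ≠ M.dol) := by
    rw [List.filter_append, List.filter_cons_of_pos (by simpa using hjd),
      List.filter_cons_of_pos (by simpa using hfd)]
  have hjf : j ≠ M.fresh := fun h => hfu (h ▸ hj)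
  have hcong : ∀ w, DiffNext (M.us.filter (· ≠ M.dol))
      (Function.update M.chr M.fresh (M.chr j)) w ↔ DiffNext (M.us.filter (· ≠ M.dol)) M.chr w := by
    refine diffNext_congr fun y hy => ?_
    rw [Function.update_of_ne]
    rintro rfl
    exact hfu (List.mem_filter.mp hy).1
  have key := diffNext_split (chr := Function.update M.chr M.fresh (M.chr j)) (p := j)
    (q := M.fresh) (by rw [← eW']; exact hn'.filter _)
    (by rw [Function.update_self, Function.update_of_ne hjf]) w
  rw [← eW', ← eW, hcong, hcong] at key
  simp only [NodeCond, Model.replaceInTree_us, Model.replaceInTree_dol, Model.replaceInTree_chr,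
    Model.split, i1]
  rw [key]
  by_cases hw : w = M.dol
  · subst hw; simp [hjd.symm]
  · simp [hw, hjd]

/-- The merged node inherits the successor of `q`, and `ht` says that it replaces `q` in the tree as
well. -/
theorem Exact.absorb {b : Prop} {M : Model} (hE : Exact b M) (hg : Graph M) {p q : ℕ}
    {A B : List ℕ} (e : M.us = A ++ p :: q :: B) (hc : M.chr p = M.chr q)
    (hp : p ≠ M.dol) (hq : q ≠ M.dol)
    (ht : (M.absorb p q).treeNodes = M.treeNodes.map (fun z => if z = q then p else z)) :
    Exact b (M.absorb p q) := by
  refine hE.replace ht fun w => ?_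
  have hnU := hg.nodupU
  rw [e] at hnU
  have i1 : M.us.erase q = A ++ p :: B := by
    have := erase_append_cons (A := A ++ [p]) (B := B) (x := q) (by simpa using hnU)
    simpa [e] using this
  have eW : M.us.filter (· ≠ M.dol) =
      A.filter (· ≠ M.dol) ++ p :: q :: B.filter (· ≠ M.dol) := by
    rw [e, List.filter_append, List.filter_cons_of_pos (by simpa using hp),
      List.filter_cons_of_pos (by simpa using hq)]
  have eW' : (A ++ p :: B).filter (· ≠ M.dol) =
      A.filter (· ≠ M.dol) ++ p :: B.filter (· ≠ M.dol) := by
    rw [List.filter_append, List.filter_cons_of_pos (by simpa using hp)]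
  have key := diffNext_merge (chr := M.chr) (p := p) (q := q)
    (by rw [← eW]; exact hg.nodupU.filter _) hc w
  rw [← eW', ← eW] at key
  simp only [NodeCond, Model.absorb, Model.replaceInTree_us, Model.replaceInTree_dol,
    Model.replaceInTree_chr, Model.merge, i1]
  rw [key]
  by_cases hw : w = M.dol
  · subst hw; simp [hq.symm]
  · simp [hw, hq]

/-! ## Merging with the neighbours -/

/-- Neighbours in `U` with the same character are neighbours in `V`. -/
theorem Graph.adjacent {M : Model} (hg : Graph M) {p q : ℕ} {A B : List ℕ}
    (e : M.us = A ++ p :: q :: B) (hc : M.chr p = M.chr q) :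
    ∃ A' B', M.vs = A' ++ p :: q :: B' := by
  have hn := hg.nodupV.filter (fun x => M.chr x = M.chr p)
  have hst := hg.stable (M.chr p)
  have hs := hg.sorted
  obtain ⟨A', R, e'⟩ := List.append_of_mem ((hg.mem_iff p).mp (by simp [e]))
  rw [e', e, List.filter_append, List.filter_append, List.filter_cons_of_pos (by simp),
    List.filter_cons_of_pos (by simp), List.filter_cons_of_pos (by simp [hc])] at hst
  rw [e', List.filter_append, List.filter_cons_of_pos (by simp)] at hn
  have h2 := (append_cons_inj hst hn).2
  have hqR : q ∈ R := (List.mem_filter.mp (h2 ▸ List.mem_cons_self)).1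
  obtain ⟨C, B', rfl⟩ := List.append_of_mem hqR
  have hnR := (List.nodup_cons.mp (List.nodup_append.mp hn).2.1).2
  rw [List.filter_append, List.filter_cons_of_pos (by simp [hc])] at h2 hnR
  have h3 := (append_cons_inj (A' := []) h2 hnR).1
  -- A node between `p` and `q` in `V` would carry their character by the sorting, but in this class
  -- `q` follows `p` directly.
  have hC : C = [] := by
    rw [List.eq_nil_iff_forall_not_mem]
    intro z hz
    rw [e', List.pairwise_append, List.pairwise_cons, List.pairwise_append] at hs
    have h4 := hs.2.1.1 z (by simp [hz])
    have h5 := hs.2.1.2.2.2 z hz q (by simp)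
    have h6 := List.filter_eq_nil_iff.mp h3 z hz
    simp only [decide_eq_true_eq] at h6
    omega
  subst hC
  exact ⟨A', B', e'⟩

section
variable (M : Model) (p q : ℕ)

@[simp] theorem Model.absorb_chr : (M.absorb p q).chr = M.chr := by simp [Model.absorb, Model.merge]
@[simp] theorem Model.absorb_dol : (M.absorb p q).dol = M.dol := by simp [Model.absorb, Model.merge]
@[simp] theorem Model.absorb_heavyU : (M.absorb p q).heavyU = M.heavyU := by
  simp [Model.absorb, Model.merge]
@[simp] theorem Model.absorb_heavyV : (M.absorb p q).heavyV = M.heavyV := by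
  simp [Model.absorb, Model.merge]

end

theorem Graph.absorb_us {M : Model} (hg : Graph M) {p q : ℕ} {A B : List ℕ}
    (e : M.us = A ++ p :: q :: B) : (M.absorb p q).us = A ++ p :: B := by
  have hnU := hg.nodupU
  have := erase_append_cons (A := A ++ [p]) (B := B) (x := q) (by simpa [e] using hnU)
  simpa [Model.absorb, Model.merge, e] using this

theorem Graph.absorb {M : Model} (hg : Graph M) {p q : ℕ} {A B : List ℕ}
    (e : M.us = A ++ p :: q :: B) (hc : M.chr p = M.chr q) (hp : p ≠ M.dol) (hq : q ≠ M.dol) :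
    Graph (M.absorb p q) := by
  obtain ⟨A', B', e'⟩ := hg.adjacent e hc
  exact (hg.merge e e' hp hq).replaceInTree _ _ _

theorem Graph.flat_absorb {M : Model} (hg : Graph M) {p q : ℕ} {A B : List ℕ}
    (e : M.us = A ++ p :: q :: B) (hc : M.chr p = M.chr q) :
    flat (M.absorb p q).chr (M.absorb p q).len (M.absorb p q).us = flat M.chr M.len M.us := by
  have hn := hg.nodupU
  rw [hg.absorb_us e, e]
  rw [e] at hn
  have hA := notMem_left_of_nodup hn
  have hB : p ∉ B := fun h => notMem_right_of_nodup hn (by simp [h])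
  have key : ∀ l : List ℕ, p ∉ l → flat (M.absorb p q).chr (M.absorb p q).len l =
      flat M.chr M.len l := by
    intro l hl
    refine flat_congr fun y hy => ⟨by simp, ?_⟩
    have : y ≠ p := by rintro rfl; exact hl hy
    simp [Model.absorb, Model.merge, this]
  rw [flat_append, flat_append, flat_cons, flat_cons, flat_cons, key A hA, key B hB]
  have hl : (M.absorb p q).len p = M.len p + M.len q := by simp [Model.absorb, Model.merge]
  rw [hl, Model.absorb_chr, hc, List.replicate_add, List.append_assoc]

-- In-degrees after merging

theorem countP_or_le (l : List ℕ) (f g : ℕ → Bool) :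
    l.countP (fun y => f y || g y) ≤ l.countP f + l.countP g := by
  induction l with
  | nil => simp
  | cons a l ih =>
    simp only [List.countP_cons]
    cases f a <;> cases g a <;> simp <;> omega

/-- Edges into `q` are redirected to `p` and the edge that starts at `q` vanishes. So only the
in-degree of `p` can grow, at most to the sum. -/
theorem indeg_erase_le {l : List ℕ} {tgt tgt' : ℕ → ℕ} {p q : ℕ}
    (h : ∀ y ∈ l, tgt' y = if tgt y = q then p else tgt y) (v : ℕ) :
    indeg (l.erase q) tgt' v ≤ if v = p then indeg l tgt p + indeg l tgt q else indeg l tgt v := by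
  refine (List.erase_sublist.countP_le).trans ?_
  split_ifs with hv
  · refine le_trans (List.countP_mono_left (q := fun y => decide (tgt y = p) || decide (tgt y = q))
      ?_) (countP_or_le _ _ _)
    intro y hy h1
    simp only [h y hy, decide_eq_true_eq, hv] at h1
    simp only [Bool.or_eq_true, decide_eq_true_eq]
    by_cases h2 : tgt y = q
    · exact Or.inr h2
    · rw [if_neg h2] at h1; exact Or.inl h1
  · refine List.countP_mono_left ?_
    intro y hy h1
    simp only [h y hy, decide_eq_true_eq] at h1 ⊢
    split_ifs at h1 with h2
    · exact absurd h1.symm hv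
    · exact h1

/-- The number of edges in `E_F` that point to `u_v`. -/
def Model.degF (M : Model) (v : ℕ) : ℕ := indeg M.vs M.tgtF v

/-- The number of edges in `E_L` that point to `v_v`. -/
def Model.degL (M : Model) (v : ℕ) : ℕ := indeg M.us M.tgtL v

theorem Model.degF_absorb_le (M : Model) (p q v : ℕ) :
    (M.absorb p q).degF v ≤ if v = p then M.degF p + M.degF q else M.degF v := by
  simp only [Model.degF, Model.absorb, Model.replaceInTree_vs, Model.replaceInTree_tgtF]
  refine indeg_erase_le ?_ v
  intro y hy
  simp [Model.merge, hy]

theorem Model.degL_absorb_le (M : Model) (p q v : ℕ) :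
    (M.absorb p q).degL v ≤ if v = p then M.degL p + M.degL q else M.degL v := by
  simp only [Model.degL, Model.absorb, Model.replaceInTree_us, Model.replaceInTree_tgtL]
  refine indeg_erase_le ?_ v
  intro y hy
  simp [Model.merge, hy]

theorem Model.tgtF_absorb (M : Model) (p q u : ℕ) (h : M.tgtF u ≠ q) :
    (M.absorb p q).tgtF u = M.tgtF u := by
  simp [Model.absorb, Model.merge, h]

theorem Model.tgtL_absorb (M : Model) (p q u : ℕ) (h : M.tgtL u ≠ q) :
    (M.absorb p q).tgtL u = M.tgtL u := by
  simp [Model.absorb, Model.merge, h]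

/-- The graph `M'` is obtained from `M` by merging nodes into the node `y`; at most `kF` and `kL`
edges point to this node. -/
structure Merged (M M' : Model) (y kF kL : ℕ) : Prop where
  sub : ∀ z ∈ M'.us, z ∈ M.us
  mem : y ∈ M'.us
  degF : ∀ v, v ≠ y → M'.degF v ≤ M.degF v
  degL : ∀ v, v ≠ y → M'.degL v ≤ M.degL v
  degF_self : M'.degF y ≤ kF
  degL_self : M'.degL y ≤ kL
  tgtF : ∀ u, M.tgtF u ∈ M'.us → M'.tgtF u = M.tgtF u
  tgtL : ∀ u, M.tgtL u ∈ M'.us → M'.tgtL u = M.tgtL u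
  chr : M'.chr = M.chr
  dol : M'.dol = M.dol
  heavyU : M'.heavyU = M.heavyU
  heavyV : M'.heavyV = M.heavyV
  flat : RComp.flat M'.chr M'.len M'.us = RComp.flat M.chr M.len M.us
  graph : Graph M'

theorem Merged.refl {M : Model} (hg : Graph M) {y : ℕ} (hy : y ∈ M.us) :
    Merged M M y (M.degF y) (M.degL y) where
  sub _ h := h
  mem := hy
  degF _ _ := le_rfl
  degL _ _ := le_rfl
  degF_self := le_rfl
  degL_self := le_rfl
  tgtF _ _ := rfl
  tgtL _ _ := rfl
  chr := rfl
  dol := rfl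
  heavyU := rfl
  heavyV := rfl
  flat := rfl
  graph := hg

/-- A further merge is compared with the original graph: the absorbed node differs from `y`, so its
in-degrees have not grown, and the bounds for `y` add up. -/
theorem Merged.absorb {M M' : Model} {y q kF kL : ℕ} (h : Merged M M' y kF kL) {A B : List ℕ}
    (e : M'.us = A ++ y :: q :: B) (hc : M.chr y = M.chr q) (hy : y ≠ M.dol) (hq : q ≠ M.dol) :
    Merged M (M'.absorb y q) y (kF + M.degF q) (kL + M.degL q) := by
  have hn := h.graph.nodupU
  have eu := h.graph.absorb_us e
  rw [e] at hn
  have hyq : q ≠ y := by rintro rfl; exact notMem_right_of_nodup hn (by simp)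
  have hqn : q ∉ (M'.absorb y q).us := by
    have h1 : ((A ++ [y]) ++ q :: B).Nodup := by simpa using hn
    have h2 := notMem_left_of_nodup h1
    have h3 := notMem_right_of_nodup h1
    rw [eu]
    simp only [List.mem_append, List.mem_cons, List.not_mem_nil] at h2 ⊢
    tauto
  have hsub : ∀ z ∈ (M'.absorb y q).us, z ∈ M'.us := by
    intro z hz
    rw [eu] at hz
    rw [e]
    simp only [List.mem_append, List.mem_cons] at hz ⊢
    tauto
  have hc' : M'.chr y = M'.chr q := by rw [h.chr]; exact hc
  constructor
  case sub => exact fun z hz => h.sub z (hsub z hz)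
  case mem => rw [eu]; simp
  case degF =>
    intro v hv
    have := M'.degF_absorb_le y q v
    rw [if_neg hv] at this
    exact this.trans (h.degF v hv)
  case degL =>
    intro v hv
    have := M'.degL_absorb_le y q v
    rw [if_neg hv] at this
    exact this.trans (h.degL v hv)
  case degF_self =>
    have := M'.degF_absorb_le y q y
    rw [if_pos rfl] at this
    exact this.trans (Nat.add_le_add h.degF_self (h.degF q hyq))
  case degL_self =>
    have := M'.degL_absorb_le y q y
    rw [if_pos rfl] at this
    exact this.trans (Nat.add_le_add h.degL_self (h.degL q hyq))
  case tgtF =>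
    intro u hu
    have h1 := h.tgtF u (hsub _ hu)
    rw [M'.tgtF_absorb, h1]
    rw [h1]; exact fun h2 => hqn (h2 ▸ hu)
  case tgtL =>
    intro u hu
    have h1 := h.tgtL u (hsub _ hu)
    rw [M'.tgtL_absorb, h1]
    rw [h1]; exact fun h2 => hqn (h2 ▸ hu)
  case chr => simp [h.chr]
  case dol => simp [h.dol]
  case heavyU => simp [h.heavyU]
  case heavyV => simp [h.heavyV]
  case flat => rw [h.graph.flat_absorb e hc', h.flat]
  case graph =>
    exact h.graph.absorb e hc' (h.dol ▸ hy) (h.dol ▸ hq)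

/-- `M'` results from `M` by merging the node `i` with its predecessor, if that carries `c`. -/
def MergePrev (M : Model) (c i : ℕ) (M' : Model) (y : ℕ) : Prop :=
  (∃ A p B, M.us = A ++ p :: i :: B ∧ M.chr p = c ∧ M' = M.absorb p i ∧ y = p) ∨
  (M' = M ∧ y = i ∧ ∀ A p B, M.us = A ++ p :: i :: B → M.chr p ≠ c)

/-- `M''` results from `M'` by merging the node `y` with the node that follows `i` in `M`, if that
carries `c`. -/
def MergeNext (M : Model) (c i : ℕ) (M' : Model) (y : ℕ) (M'' : Model) : Prop :=
  (∃ A q B, M.us = A ++ i :: q :: B ∧ M.chr q = c ∧ M'' = M'.absorb y q) ∨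
  (M'' = M' ∧ ∀ A q B, M.us = A ++ i :: q :: B → M.chr q ≠ c)

/-- Decomposition of the list of `U` before the second merge. -/
theorem MergePrev.us_eq {M M' : Model} {c i y : ℕ} (h : MergePrev M c i M' y) (hg : Graph M)
    {A B : List ℕ} (e : M.us = A ++ i :: B) : ∃ A', M'.us = A' ++ y :: B := by
  rcases h with ⟨A1, p, B1, e1, -, rfl, rfl⟩ | ⟨rfl, rfl, -⟩
  · refine ⟨A1, ?_⟩
    rw [hg.absorb_us e1]
    have h1 : (A1 ++ [y]) ++ i :: B1 = A ++ i :: B := by rw [← e, e1]; simp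
    rw [(append_cons_inj h1 (by rw [h1, ← e]; exact hg.nodupU)).2]
  · exact ⟨A, e⟩

/-- A merge is paid for by the absorbed node. In the second merge this is the successor, whose
in-degrees did not grow in the first one, so `K` bounds both. -/
theorem spec_mergeStep {M : Model} {S : State} (h : Models M S) (hg : Graph M) {c i K : ℕ}
    (hi : i ∈ M.us) (hci : M.chr i = c) (hc : dollar < c)
    (hF : ∀ v ∈ M.us, M.degF v ≤ K) (hL : ∀ v ∈ M.us, M.degL v ≤ K) :
    Spec (mergeStep c i) S (12 * K + 60) 2 (fun y S' => ∃ M' M'', MergePrev M c i M' y ∧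
      MergeNext M c i M' y M'' ∧ Models M'' S') := by
  obtain ⟨A, B, e⟩ := List.append_of_mem hi
  have hcd : ∀ z, M.chr z = c → z ≠ M.dol := by
    rintro z hz rfl
    rw [hg.dol_chr] at hz
    omega
  have hlk := h.listU.link A i B e
  have hA : ∀ A1 p B1, M.us = A1 ++ p :: i :: B1 → A = A1 ++ [p] := by
    intro A1 p B1 e1
    have h1 : (A1 ++ [p]) ++ i :: B1 = A ++ i :: B := by rw [← e, e1]; simp
    exact (append_cons_inj h1 (by rw [h1, ← e]; exact hg.nodupU)).1.symm
  have hB : ∀ A1 q B1, M.us = A1 ++ i :: q :: B1 → B = q :: B1 := by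
    intro A1 q B1 e1
    have h1 : A1 ++ i :: q :: B1 = A ++ i :: B := by rw [← e, e1]
    exact (append_cons_inj h1 (by rw [h1, ← e]; exact hg.nodupU)).2.symm
  unfold mergeStep
  refine Spec.mono (k := 1 + ((6 * K + 27) + ((6 * K + 27) + 0))) (c := 0 + (1 + (1 + 0)))
    (Q := fun y S' => ∃ M' M'', MergePrev M c i M' y ∧
      MergeNext M c i M' y M'' ∧ Models M'' S')
    (Spec.bind spec_read ?_) (by omega) (by omega) (fun _ _ h => h)
  rintro _ _ ⟨rfl, rfl⟩
  rw [hlk.1, hlk.2]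
  refine Spec.bind (Q := fun y S' => ∃ M', MergePrev M c i M' y ∧ Models M' S') ?_ ?_
  · rcases List.eq_nil_or_concat A with rfl | ⟨A1, p, rfl⟩
    · refine (Spec.pure ⟨M, Or.inr ⟨rfl, rfl, ?_⟩, h⟩).mono (by omega) (by omega) (fun _ _ h => h)
      intro A1 p B1 e1
      exact absurd (hA A1 p B1 e1) (by simp)
    · rw [List.concat_eq_append] at e hA
      simp only [List.concat_eq_append, List.getLast?_append, List.getLast?_singleton,
        Option.some_or]
      refine (Spec.bind (k := 1) (k' := 6 * K + 26) (c := 0) (c' := 1) spec_read ?_).mono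
        (by omega) (by omega) (fun _ _ h => h)
      rintro _ _ ⟨rfl, rfl⟩
      rw [h.chr]
      split_ifs with hpc
      · refine (Spec.bind (spec_mergeNodes h hg hi (hF i hi) (hL i hi)) ?_).mono
          (k := 6 * K + 26 + 0) (c := 1 + 0) (by omega) (by omega) (fun _ _ h => h)
        rintro _ S1 h1
        exact Spec.pure ⟨_, Or.inl ⟨A1, p, B, by simpa using e, hpc, rfl, rfl⟩, h1⟩
      · refine (Spec.pure ⟨M, Or.inr ⟨rfl, rfl, ?_⟩, h⟩).mono (by omega) (by omega)
          (fun _ _ h => h)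
        intro A2 p2 B2 e2
        have := hA A2 p2 B2 e2
        have := (List.append_inj' this (by simp)).2
        simp only [List.cons.injEq, and_true] at this
        rwa [← this]
  · rintro y S1 ⟨M', hp, h1⟩
    have hmg : ∃ kF kL, Merged M M' y kF kL := by
      rcases hp with ⟨A1, p, B1, e1, hpc, rfl, rfl⟩ | ⟨rfl, rfl, -⟩
      · exact ⟨_, _, (Merged.refl hg (by simp [e1])).absorb e1 (by rw [hpc, hci]) (hcd y hpc)
          (hcd i hci)⟩
      · exact ⟨_, _, Merged.refl hg hi⟩
    obtain ⟨kF, kL, hmg⟩ := hmg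
    obtain ⟨A', eu⟩ := hp.us_eq hg e
    cases B with
    | nil =>
      refine (Spec.pure ⟨M', M', hp, Or.inr ⟨rfl, ?_⟩, h1⟩).mono (by omega) (by omega)
        (fun _ _ h => h)
      intro A1 q B1 e1
      exact absurd (hB A1 q B1 e1) (by simp)
    | cons q B =>
      simp only [List.head?_cons]
      refine (Spec.bind (k := 1) (k' := 6 * K + 26) (c := 0) (c' := 1) spec_read ?_).mono
        (by omega) (by omega) (fun _ _ h => h)
      rintro _ _ ⟨rfl, rfl⟩
      rw [h1.chr, hmg.chr]
      have hq' : q ∈ M'.us := by simp [eu]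
      have hn := hmg.graph.nodupU
      rw [eu] at hn
      have hqy : q ≠ y := by rintro rfl; exact notMem_right_of_nodup hn (by simp)
      split_ifs with hqc
      · refine (Spec.bind (spec_mergeNodes h1 hmg.graph hq'
          ((hmg.degF q hqy).trans (hF q (hmg.sub q hq')))
          ((hmg.degL q hqy).trans (hL q (hmg.sub q hq')))) ?_).mono
          (k := 6 * K + 26 + 0) (c := 1 + 0) (by omega) (by omega) (fun _ _ h => h)
        rintro _ S2 h2
        exact Spec.pure ⟨_, _, hp, Or.inl ⟨A, q, B, e, hqc, rfl⟩, h2⟩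
      · refine (Spec.pure ⟨M', M', hp, Or.inr ⟨rfl, ?_⟩, h1⟩).mono (by omega) (by omega)
          (fun _ _ h => h)
        intro A2 q2 B2 e2
        have := hB A2 q2 B2 e2
        simp only [List.cons.injEq] at this
        rwa [← this.1]

/-! ## Insertion of the new dollar node -/

/-- `p` is followed by its own character. So when the tree is exact, `p` has no element that the
element of `q` could collide with in a merge. -/
theorem Graph.not_nodeCond_of_adjacent {M : Model} (hg : Graph M) {p q : ℕ} {A B : List ℕ}
    (e : M.us = A ++ p :: q :: B) (hc : M.chr p = M.chr q) (hp : p ≠ M.dol) (hq : q ≠ M.dol) :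
    ¬ NodeCond M p := by
  have hn := hg.nodupU
  rw [e] at hn
  have hpA := notMem_left_of_nodup hn
  rw [NodeCond, e, List.filter_append, List.filter_cons_of_pos (by simpa using hp),
    List.filter_cons_of_pos (by simpa using hq),
    diffNext_append (fun h => hpA (List.mem_filter.mp h).1)]
  simp [hp, hc]

theorem Exact.absorb_of_adjacent {b : Prop} {m : ℕ} {M : Model} (hE : Exact b M) (hg : Graph M)
    (hT : TreeInv m M) {p q : ℕ} {A B : List ℕ} (e : M.us = A ++ p :: q :: B)
    (hc : M.chr p = M.chr q) (hp : p ≠ M.dol) (hq : q ≠ M.dol) :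
    TreeInv m (M.absorb p q) ∧ Exact b (M.absorb p q) := by
  obtain ⟨A', B', e'⟩ := hg.adjacent e hc
  have h1 := hT.absorb hg e' (Or.inl fun h =>
    hg.not_nodeCond_of_adjacent e hc hp hq ((hE p).1 h))
  exact ⟨h1.1, hE.absorb hg e hc hp hq h1.2⟩

/-- The list of `V` is `dol :: (V₁ ++ V₂)`, and the node labelled `(c, 1)` that replaces the node
`dol` between `A` and `B` in `U` belongs between `V₁` and `V₂`. -/
structure Placement (M : Model) (c : ℕ) (A B V₁ V₂ : List ℕ) : Prop where
  us_eq : M.us = A ++ M.dol :: B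
  vs_eq : M.vs = M.dol :: (V₁ ++ V₂)
  le_left : ∀ y ∈ V₁, M.chr y ≤ c
  le_right : ∀ y ∈ V₂, c ≤ M.chr y
  left : V₁.filter (fun x => M.chr x = c) = A.filter (fun x => M.chr x = c)
  right : V₂.filter (fun x => M.chr x = c) = B.filter (fun x => M.chr x = c)
  cases : (∃ b B', B = b :: B' ∧ M.chr b = c) ∨
    (∃ A₀ a V₀, A = A₀ ++ [a] ∧ V₁ = V₀ ++ [a] ∧ M.chr a = c ∧ ∀ b ∈ B.head?, M.chr b ≠ c)

/-- Up to the `1` for the `dollar` at the front, this is the rank in `IsText.bwt_cons`: the new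
`dollar` belongs in `U` exactly where `c` belongs in `V`. -/
theorem Placement.total_eq {M : Model} {c : ℕ} {A B V₁ V₂ : List ℕ} (h : Placement M c A B V₁ V₂)
    (hg : Graph M) : total M.len V₁ = total M.len (A.filter (fun y => M.chr y ≤ c)) +
      total M.len (B.filter (fun y => M.chr y < c)) := by
  have hu := hg.nodupU
  have hv := hg.nodupV
  rw [h.us_eq] at hu
  rw [h.vs_eq, List.nodup_cons] at hv
  have hAB : (A ++ B).Nodup :=
    hu.sublist (List.Sublist.append_left (List.sublist_cons_self _ _) _)
  rw [← total_append]
  refine total_perm ((List.perm_ext_iff_of_nodup (List.nodup_append.mp hv.2).1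
    (hAB.sublist (List.Sublist.append List.filter_sublist List.filter_sublist))).mpr ?_)
  intro y
  have hmem := hg.mem_iff y
  rw [h.us_eq, h.vs_eq] at hmem
  have hdA := notMem_left_of_nodup hu
  have hdB := notMem_right_of_nodup hu
  have hdV := hv.1
  have h1 := h.le_left y
  have h2 := h.le_right y
  have h3 : y ∈ V₁ ∧ M.chr y = c ↔ y ∈ A ∧ M.chr y = c := by
    have : y ∈ V₁.filter (fun x => M.chr x = c) ↔ y ∈ A.filter (fun x => M.chr x = c) := by
      rw [h.left]
    simpa [List.mem_filter] using this
  simp only [List.mem_append, List.mem_cons, List.mem_filter, decide_eq_true_eq] at hmem hdV ⊢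
  by_cases hyd : y = M.dol
  · subst hyd; tauto
  · simp only [hyd, false_or] at hmem
    constructor
    · intro h4
      rcases (h1 h4).lt_or_eq with h5 | h5
      · rcases hmem.mpr (Or.inl h4) with h6 | h6
        · exact Or.inl ⟨h6, h5.le⟩
        · exact Or.inr ⟨h6, h5⟩
      · exact Or.inl ⟨(h3.mp ⟨h4, h5⟩).1, h5.le⟩
    · rintro (⟨h4, h5⟩ | ⟨h4, h5⟩)
      · rcases h5.lt_or_eq with h6 | h6
        · refine (hmem.mp (Or.inl h4)).resolve_right fun h7 => ?_
          have := h2 h7; omega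
        · exact (h3.mpr ⟨h4, h6⟩).1
      · refine (hmem.mp (Or.inr h4)).resolve_right fun h7 => ?_
        have := h2 h7; omega

/-- A represented graph of the text `t`, with its B-tree. -/
structure Good (b : Prop) (m : ℕ) (t : List ℕ) (M : Model) : Prop where
  graph : Graph M
  tree : TreeInv m M
  flat : flat M.chr M.len M.us = bwt t
  exact : Exact b M

-- Effect of the insertion on graph, string, in-degrees and B-tree

section
variable {b : Prop} {m c : ℕ} {t : List ℕ} {M : Model} {A B V₁ V₂ U₁ U₂ : List ℕ}

/-- The graph after the insertion of the new dollar node. -/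
def Model.inserted (M : Model) (c : ℕ) (U₁ U₂ V₁ V₂ : List ℕ) : Model :=
  M.newDollar c (U₁ ++ M.fresh :: U₂) (M.fresh :: (V₁ ++ M.dol :: V₂))

@[simp] theorem Model.inserted_us : (M.inserted c U₁ U₂ V₁ V₂).us = U₁ ++ M.fresh :: U₂ := by
  simp [Model.inserted, Model.newDollar, Model.insertDollar]

@[simp] theorem Model.inserted_vs :
    (M.inserted c U₁ U₂ V₁ V₂).vs = M.fresh :: (V₁ ++ M.dol :: V₂) := by
  simp [Model.inserted, Model.newDollar, Model.insertDollar]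

@[simp] theorem Model.inserted_dol : (M.inserted c U₁ U₂ V₁ V₂).dol = M.fresh := by
  simp [Model.inserted, Model.newDollar, Model.insertDollar]

theorem Placement.graph (h : Placement M c A B V₁ V₂) (hg : Graph M) (hc : dollar < c)
    (eU : M.us = U₁ ++ U₂) (hP : total M.len U₁ = total M.len V₁ + 1) :
    Graph (M.inserted c U₁ U₂ V₁ V₂) :=
  (hg.insertDollar hc eU h.us_eq h.vs_eq hP h.le_left h.le_right h.left h.right).replaceInTree
    _ _ _

theorem Model.inserted_chr_dol : (M.inserted c U₁ U₂ V₁ V₂).chr M.dol = c := by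
  simp [Model.inserted, Model.newDollar, Model.insertDollar]

theorem Model.inserted_chr {y : ℕ} (h1 : y ≠ M.fresh) (h2 : y ≠ M.dol) :
    (M.inserted c U₁ U₂ V₁ V₂).chr y = M.chr y := by
  simp [Model.inserted, Model.newDollar, Model.insertDollar, h1, h2]

theorem Model.inserted_len {y : ℕ} (h1 : y ≠ M.fresh) :
    (M.inserted c U₁ U₂ V₁ V₂).len y = M.len y := by
  simp [Model.inserted, Model.newDollar, Model.insertDollar, h1]

/-- After replacing `dollar` by `c`, the string is cut at length `total M.len U₁`, the rank of the
new suffix. Equal lengths then identify both halves with those of `IsText.bwt_cons`. -/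
theorem Placement.flat_inserted (h : Placement M c A B V₁ V₂) (hg : Graph M) (hc : dollar < c)
    (ht : IsText t) (hf : flat M.chr M.len M.us = bwt t)
    (eU : M.us = U₁ ++ U₂) (hP : total M.len U₁ = total M.len V₁ + 1) :
    flat (M.inserted c U₁ U₂ V₁ V₂).chr (M.inserted c U₁ U₂ V₁ V₂).len
      (M.inserted c U₁ U₂ V₁ V₂).us = bwt (c :: t) := by
  have hfu := hg.fresh_notMem
  have hn := hg.nodupU
  have hdf : M.dol ≠ M.fresh := fun e => hfu (e ▸ hg.dol_mem)
  rw [h.us_eq] at hn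
  set M' := M.inserted c U₁ U₂ V₁ V₂ with hM'
  have hl : ∀ l : List ℕ, (∀ y ∈ l, y ∈ M.us) → M.dol ∉ l →
      flat M'.chr M'.len l = flat M.chr M.len l := by
    intro l hl hd
    refine flat_congr fun y hy => ⟨?_, ?_⟩
    · refine Model.inserted_chr ?_ ?_
      · rintro rfl; exact hfu (hl _ hy)
      · rintro rfl; exact hd hy
    · refine Model.inserted_len ?_
      rintro rfl; exact hfu (hl _ hy)
  have hA := hl A (fun y hy => by rw [h.us_eq]; simp [hy]) (notMem_left_of_nodup hn)
  have hB := hl B (fun y hy => by rw [h.us_eq]; simp [hy]) (notMem_right_of_nodup hn)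
  have hb : bwt t = flat M.chr M.len A ++ dollar :: flat M.chr M.len B := by
    rw [← hf, h.us_eq, flat_append, flat_cons, hg.dol_chr, hg.dol_len]; rfl
  have hb' : flat M'.chr M'.len U₁ ++ flat M'.chr M'.len U₂ =
      flat M.chr M.len A ++ c :: flat M.chr M.len B := by
    rw [← flat_append, ← eU, h.us_eq, flat_append, flat_cons, hA, hB, Model.inserted_chr_dol,
      Model.inserted_len hdf, hg.dol_len]
    rfl
  obtain ⟨X, Y, h1, h2, h3⟩ := ht.bwt_cons hc hb
  rw [countP_flat, countP_flat] at h3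
  have hU : (flat M'.chr M'.len U₁).length = X.length := by
    rw [h3, length_flat, ← h.total_eq hg, ← hP]
    refine total_congr fun y hy => Model.inserted_len ?_
    rintro rfl; exact hfu (by rw [eU]; simp [hy])
  rw [h1] at hb'
  obtain ⟨e1, e2⟩ := List.append_inj hb' hU
  rw [Model.inserted_us, flat_append, flat_cons, e1, e2, h2]
  simp [hM', Model.inserted, Model.newDollar, Model.insertDollar, hdf.symm]

theorem Placement.tree (h : Placement M c A B V₁ V₂) (hg : Graph M) (hT : TreeInv m M)
    (eU : M.us = U₁ ++ U₂) :
    TreeInv m (M.inserted c U₁ U₂ V₁ V₂) ∧ (M.inserted c U₁ U₂ V₁ V₂).treeNodes =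
      M.treeNodes.map (fun z => if z = M.dol then M.fresh else z) :=
  hT.newDollar hg eU h.vs_eq

/-- `M.fresh` takes over the edge of `M.dol` in `E_F`, and `M.dol` now points to `M.fresh`; no other
node gains an edge. -/
theorem Placement.degF_le (h : Placement M c A B V₁ V₂) (hg : Graph M) {v : ℕ} (hv : v ≠ M.fresh) :
    (M.inserted c U₁ U₂ V₁ V₂).degF v ≤ M.degF v := by
  have hfv := hg.fresh_notMemV
  have hn := hg.nodupV
  rw [h.vs_eq] at hfv hn
  have hl : ∀ l : List ℕ, (∀ y ∈ l, y ∈ V₁ ∨ y ∈ V₂) →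
      l.countP (fun y => (M.inserted c U₁ U₂ V₁ V₂).tgtF y = v) =
        l.countP (fun y => M.tgtF y = v) := by
    intro l hl
    refine List.countP_congr fun y hy => ?_
    have h1 : y ≠ M.dol := by
      rintro rfl
      have := hl _ hy
      simp only [List.nodup_cons, List.mem_append] at hn
      tauto
    have h2 : y ≠ M.fresh := by
      rintro rfl
      have := hl _ hy
      simp only [List.mem_cons, List.mem_append] at hfv
      tauto
    simp [Model.inserted, Model.newDollar, Model.insertDollar, h1, h2]
  simp only [Model.degF, indeg]
  rw [Model.inserted_vs, h.vs_eq, List.countP_cons, List.countP_append, List.countP_cons,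
    List.countP_cons, List.countP_append, hl V₁ (fun _ h => Or.inl h), hl V₂ (fun _ h => Or.inr h)]
  have hdf : M.fresh ≠ M.dol := by
    intro e; simp [e] at hfv
  simp [Model.inserted, Model.newDollar, Model.insertDollar, hdf, hv.symm]

/-- The new `u`-node points to `M.dol`, and the one redirected edge points to `M.fresh`; all other
nodes can only lose edges. -/
theorem Placement.degL_le (hg : Graph M) (eU : M.us = U₁ ++ U₂) {v : ℕ}
    (hv : v ≠ M.fresh) (hd : v ≠ M.dol) :
    (M.inserted c U₁ U₂ V₁ V₂).degL v ≤ M.degL v := by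
  have hfu := hg.fresh_notMem
  rw [eU] at hfu
  have hl : ∀ l : List ℕ, M.fresh ∉ l →
      l.countP (fun y => (M.inserted c U₁ U₂ V₁ V₂).tgtL y = v) ≤
        l.countP (fun y => M.tgtL y = v) := by
    intro l hl
    refine List.countP_mono_left fun y hy h1 => ?_
    have h2 : y ≠ M.fresh := by rintro rfl; exact hl hy
    simp only [decide_eq_true_eq] at h1 ⊢
    simp only [Model.inserted, Model.newDollar, Model.insertDollar, Model.replaceInTree_tgtL,
      Function.update_apply, h2, if_false] at h1
    split_ifs at h1
    · exact absurd h1.symm hv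
    · exact h1
  simp only [List.mem_append, not_or] at hfu
  simp only [Model.degL, indeg]
  rw [Model.inserted_us, eU, List.countP_append, List.countP_append, List.countP_cons]
  have h1 := hl U₁ hfu.1
  have h2 := hl U₂ hfu.2
  have h3 : ¬ (M.inserted c U₁ U₂ V₁ V₂).tgtL M.fresh = v := by
    simp only [Model.inserted, Model.newDollar, Model.insertDollar, Model.replaceInTree_tgtL,
      Function.update_apply]
    split_ifs
    · exact hv.symm
    · exact hd.symm
  simp only [h3, decide_false, Bool.false_eq_true, if_false]
  omega

theorem Graph.degF_le_len (hg : Graph M) (v : ℕ) : M.degF v ≤ M.len v :=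
  indeg_le_len hg.edgesF hg.nodupV (fun x hx => hg.len_pos x ((hg.mem_iff x).mpr hx))

theorem Graph.degL_le_len (hg : Graph M) (v : ℕ) : M.degL v ≤ M.len v :=
  indeg_le_len hg.edgesL hg.nodupU hg.len_pos

theorem Graph.len_inserted (hg : Graph M) : (M.inserted c U₁ U₂ V₁ V₂).len M.fresh = 1 ∧
    (M.inserted c U₁ U₂ V₁ V₂).len M.dol = 1 := by
  have hdf : M.dol ≠ M.fresh := fun e => hg.fresh_notMem (e ▸ hg.dol_mem)
  simp [Model.inserted, Model.newDollar, Model.insertDollar, hdf, hg.dol_len]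

/-- Without the new `dollar` node, `U` is the old list, so the place of the insertion does not
matter for the tree condition. -/
theorem filter_fresh (hg : Graph M) (eU : M.us = U₁ ++ U₂) :
    (U₁ ++ M.fresh :: U₂).filter (· ≠ M.fresh) = M.us := by
  have hfu := hg.fresh_notMem
  have h1 : M.us.filter (· ≠ M.fresh) = M.us := by
    rw [List.filter_eq_self]
    intro y hy
    simp only [ne_eq, decide_eq_true_eq]
    rintro rfl; exact hfu hy
  rw [List.filter_append, List.filter_cons_of_neg (by simp), ← List.filter_append, ← eU, h1]

theorem Graph.filter_dol (hg : Graph M) (e : M.us = A ++ M.dol :: B) :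
    M.us.filter (· ≠ M.dol) = A ++ B := by
  have hn := hg.nodupU
  rw [e] at hn
  rw [e, List.filter_append, List.filter_cons_of_neg (by simp), ← List.filter_append,
    List.filter_eq_self]
  intro y hy
  simp only [ne_eq, decide_eq_true_eq]
  rintro rfl
  rcases List.mem_append.mp hy with h | h
  · exact notMem_left_of_nodup hn h
  · exact notMem_right_of_nodup hn h

theorem Graph.diffNext_inserted (hg : Graph M) (e : M.us = A ++ M.dol :: B) (z : ℕ) :
    DiffNext (A ++ B) (M.inserted c U₁ U₂ V₁ V₂).chr z ↔ DiffNext (A ++ B) M.chr z := by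
  have hn := hg.nodupU
  rw [e] at hn
  refine diffNext_congr (fun y hy => Model.inserted_chr ?_ ?_) z
  · rintro rfl
    refine hg.fresh_notMem ?_
    rw [e]
    simp only [List.mem_append, List.mem_cons] at hy ⊢
    tauto
  · rintro rfl
    rcases List.mem_append.mp hy with h | h
    · exact notMem_left_of_nodup hn h
    · exact notMem_right_of_nodup hn h

theorem Graph.not_diffNext_dol (hg : Graph M) (e : M.us = A ++ M.dol :: B) (chr : ℕ → ℕ) :
    ¬ DiffNext (A ++ B) chr M.dol := by
  have hn := hg.nodupU
  rw [e] at hn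
  intro hd
  rcases List.mem_append.mp hd.mem with h | h
  · exact notMem_left_of_nodup hn h
  · exact notMem_right_of_nodup hn h

/-- If the successor of the old dollar node carries `c`, the B-tree remains exact. -/
theorem Placement.exact_of_next (h : Placement M c A B V₁ V₂) (hg : Graph M) (hT : TreeInv m M)
    (hE : Exact b M) (eU : M.us = U₁ ++ U₂) {q : ℕ} {B' : List ℕ} (eB : B = q :: B')
    (hq : M.chr q = c) : Exact b (M.inserted c U₁ U₂ V₁ V₂) := by
  refine hE.replace (h.tree hg hT eU).2 fun z => ?_
  subst eB
  have e := h.us_eq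
  have hn := hg.nodupU
  rw [e] at hn
  have hqd : q ≠ M.dol := by rintro rfl; exact notMem_right_of_nodup hn (by simp)
  have hqf : q ≠ M.fresh := by rintro rfl; exact hg.fresh_notMem (by rw [e]; simp)
  -- The old `dollar` node now carries `c` like its successor `q`, so its reappearance in the list
  -- without `dollar` affects no condition.
  have h1 := diffNext_insert (chr := (M.inserted c U₁ U₂ V₁ V₂).chr) hn
    (by rw [Model.inserted_chr_dol, Model.inserted_chr hqf hqd, hq]) z
  rw [NodeCond, Model.inserted_us, Model.inserted_dol, filter_fresh hg eU, e, h1,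
    hg.diffNext_inserted e, NodeCond, NodeCond, hg.filter_dol e]
  have h2 := hg.not_diffNext_dol e M.chr
  by_cases hz : z = M.dol
  · subst hz; simp [h2]
  · simp [hz]

/-- If the old dollar node is merged with its predecessor only, the B-tree remains exact. -/
theorem Placement.exact_of_prev (h : Placement M c A B V₁ V₂) (hg : Graph M) (hT : TreeInv m M)
    (hE : Exact b M) (eU : M.us = U₁ ++ U₂) {p : ℕ}
    (htn : ((M.inserted c U₁ U₂ V₁ V₂).absorb p M.dol).treeNodes =
      (M.inserted c U₁ U₂ V₁ V₂).treeNodes.map (fun z => if z = M.dol then p else z)) :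
    Exact b ((M.inserted c U₁ U₂ V₁ V₂).absorb p M.dol) := by
  have e := h.us_eq
  have hfd : M.fresh ≠ M.dol := fun h => hg.fresh_notMem (h ▸ hg.dol_mem)
  have hdn : M.dol ∉ (M.inserted c U₁ U₂ V₁ V₂).treeNodes := by
    rw [(h.tree hg hT eU).2, mem_map_replace]
    simp [hfd.symm]
  -- Insertion and merge count as a single replacement: after both, the list of `U` without `dollar`
  -- is the same as before.
  refine hE.replace (y := M.dol) (x := M.fresh) ?_ fun z => ?_
  · rw [htn, map_replace_of_notMem hdn, (h.tree hg hT eU).2]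
  have hn : (U₁ ++ M.fresh :: U₂).Nodup := by
    rw [List.nodup_middle, ← eU, List.nodup_cons]
    exact ⟨hg.fresh_notMem, hg.nodupU⟩
  have e1 : ((M.inserted c U₁ U₂ V₁ V₂).absorb p M.dol).us.filter (· ≠ M.fresh) = A ++ B := by
    have : ((M.inserted c U₁ U₂ V₁ V₂).absorb p M.dol).us =
        (U₁ ++ M.fresh :: U₂).filter (· ≠ M.dol) := by
      rw [Model.absorb, Model.replaceInTree_us, Model.merge]
      rw [Model.inserted_us, List.Nodup.erase_eq_filter hn]
      refine List.filter_congr fun x _ => ?_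
      by_cases hx : x = M.dol <;> simp [hx]
    rw [this, List.filter_comm, filter_fresh hg eU, hg.filter_dol e]
  rw [NodeCond, Model.absorb_dol, Model.inserted_dol, e1, Model.absorb_chr,
    hg.diffNext_inserted e, NodeCond, NodeCond, hg.filter_dol e]
  have h2 := hg.not_diffNext_dol e M.chr
  by_cases hz : z = M.dol
  · subst hz; simp [h2]
  · simp [hz]

/-- The old dollar node keeps its predecessor, if the new one is placed after that. -/
theorem Placement.prev_adjacent (h : Placement M c A B V₁ V₂) (hg : Graph M)
    (ht : IsText t) (hf : flat M.chr M.len M.us = bwt t)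
    (eU : M.us = U₁ ++ U₂) (hP : total M.len U₁ = total M.len V₁ + 1) {A₀ V₀ : List ℕ} {a : ℕ}
    (eA : A = A₀ ++ [a]) (eV : V₁ = V₀ ++ [a]) :
    ∃ A' B', U₁ ++ M.fresh :: U₂ = A' ++ a :: M.dol :: B' := by
  have e := h.us_eq
  have ev := h.vs_eq
  subst eA eV
  have e' : M.us = A₀ ++ a :: M.dol :: B := by simpa using e
  have hnU := hg.nodupU
  have hnV := hg.nodupV
  have hau : a ∈ M.us := by rw [e']; simp
  have hla := hg.len_pos a hau
  rw [e'] at hnU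
  rw [ev] at hnV
  rw [e'] at eU
  rcases List.append_eq_append_iff.mp eU with ⟨C, h1, h2⟩ | ⟨C, h1, h2⟩
  · cases C with
    | nil =>
      simp only [List.nil_append, List.append_nil] at h1 h2
      exact ⟨A₀ ++ [M.fresh], B, by rw [h1, ← h2]; simp⟩
    | cons a' C =>
      simp only [List.cons_append, List.cons.injEq] at h2
      obtain ⟨rfl, h2⟩ := h2
      cases C with
      | nil =>
        -- The new node would fall between `a` and `M.dol`. Then `hP` gives `a` the same start in
        -- `U` and in `V`, a fixed point of LF.
        exfalso
        rw [h1] at hP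
        have p1 : pos M.len M.us a = total M.len A₀ := by
          rw [e', pos_middle (notMem_left_of_nodup hnU)]
        have p2 : pos M.len M.vs a = 1 + total M.len V₀ := by
          have e3 : M.vs = (M.dol :: V₀) ++ a :: V₂ := by rw [ev]; simp
          rw [e3, pos_middle]
          · simp [hg.dol_len]
          · have hv := hg.nodupV
            rw [e3] at hv
            exact notMem_left_of_nodup hv
        have h3 := hg.lf_pos ht hf (o := 0) hau hla
        have hlen : t.length = total M.len M.us := by
          rw [← length_bwt, ← hf, length_flat]
        rw [e', total_append, total_cons, total_cons, hg.dol_len] at hlen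
        simp only [total_append, total_cons, total_nil] at hP
        refine lf_ne_self (t := t) (i := pos M.len M.us a) (by omega) (by omega) ?_
        simp only [add_zero] at h3
        omega
      | cons d C =>
        simp only [List.cons_append, List.cons.injEq] at h2
        obtain ⟨rfl, h2⟩ := h2
        exact ⟨A₀, C ++ M.fresh :: U₂, by rw [h1]; simp⟩
  · exact ⟨U₁ ++ M.fresh :: C, B, by rw [h2]; simp⟩

end

/-! ## The position of the replaced node -/

theorem mem_insertAfter {w x y : ℕ} {l : List ℕ} :
    y ∈ insertAfter w x l ↔ y ∈ l ∨ (y = x ∧ w ∈ l) := by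
  induction l with
  | nil => simp [insertAfter]
  | cons a l ih =>
    rw [insertAfter]
    split_ifs with h
    · subst h; simp only [List.mem_cons]; tauto
    · simp only [List.mem_cons, ih, Ne.symm h, false_or]; tauto

theorem insertAfter_of_notMem {w x : ℕ} {l : List ℕ} (h : w ∉ l) : insertAfter w x l = l := by
  induction l with
  | nil => rfl
  | cons a l ih =>
    simp only [List.mem_cons, not_or] at h
    rw [insertAfter, if_neg (Ne.symm h.1), ih h.2]

theorem insertAfter_append_eq {w x : ℕ} {l l' : List ℕ} (h : (l ++ l').Nodup) :
    insertAfter w x (l ++ l') = insertAfter w x l ++ insertAfter w x l' := by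
  induction l with
  | nil => rfl
  | cons a l ih =>
    rw [List.cons_append, List.nodup_cons] at h
    rw [List.cons_append, insertAfter, insertAfter]
    split_ifs with e
    · subst e
      rw [insertAfter_of_notMem (fun h' => h.1 (by simp [h']))]
      rfl
    · rw [ih h.2]; rfl

theorem filter_insertAfter {w x : ℕ} {l : List ℕ} {p : ℕ → Bool} (h : p w = p x) :
    (insertAfter w x l).filter p =
      if p x then insertAfter w x (l.filter p) else l.filter p := by
  induction l with
  | nil => simp [insertAfter]
  | cons a l ih =>
    rw [insertAfter]
    by_cases ha : a = w
    · subst ha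
      cases hx : p x <;> simp [h, hx, insertAfter]
    · rw [if_neg ha, List.filter_cons, ih]
      cases hp : p a <;> cases hx : p x <;> simp [hp, insertAfter, ha]

theorem head?_insertAfter {w x : ℕ} (l : List ℕ) : (insertAfter w x l).head? = l.head? := by
  cases l with
  | nil => rfl
  | cons a l => rw [insertAfter]; split_ifs <;> rfl

theorem insertAfter_concat {w x a : ℕ} {l : List ℕ} (h : (l ++ [a]).Nodup) :
    insertAfter w x (l ++ [a]) = insertAfter w x l ++ (if a = w then [a, x] else [a]) := by
  rw [insertAfter_append_eq h]
  simp only [insertAfter]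

section
variable {M : Model} {c : ℕ} {A B V₁ V₂ : List ℕ}

/-- By stability, the members of the class of `c` before `a` are the same in `U` and in `V`, so the
replaced node belongs right behind `a` in `V`. -/
theorem Graph.placement_prev (hg : Graph M) (hc : dollar < c) {a : ℕ}
    (e : M.us = A ++ a :: M.dol :: B) (ha : M.chr a = c) :
    ∃ V₁ V₂, Placement M c (A ++ [a]) B V₁ V₂ ∧ ∃ V₀, V₁ = V₀ ++ [a] := by
  obtain ⟨V, hV⟩ := hg.vs_eq
  have had : a ≠ M.dol := by
    rintro rfl; rw [hg.dol_chr] at ha; omega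
  have hav : a ∈ V := by
    have := (hg.mem_iff a).mp (by rw [e]; simp)
    rw [hV] at this
    exact (List.mem_cons.mp this).resolve_left had
  obtain ⟨V₀, V₂, rfl⟩ := List.append_of_mem hav
  have hs := hg.sorted
  rw [hV, List.pairwise_cons, List.pairwise_append, List.pairwise_cons] at hs
  have hst := hg.stable c
  have hn := hg.nodupV.filter (fun x => M.chr x = c)
  have hd : ¬ (M.chr M.dol = c) := by rw [hg.dol_chr]; omega
  rw [hV, List.filter_cons_of_neg (by simpa using hd), List.filter_append,
    List.filter_cons_of_pos (by simpa using ha)] at hst hn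
  rw [e, List.filter_append, List.filter_cons_of_pos (by simpa using ha),
    List.filter_cons_of_neg (by simpa using hd)] at hst
  obtain ⟨f1, f2⟩ := append_cons_inj hst hn
  refine ⟨V₀ ++ [a], V₂, ⟨by simp [e], by simp [hV], ?_, ?_, ?_, f2, ?_⟩, V₀, rfl⟩
  · intro y hy
    rw [List.mem_append, List.mem_singleton] at hy
    rcases hy with hy | rfl
    · rw [← ha]; exact hs.2.2.2 y hy a (by simp)
    · exact ha.le
  · intro y hy
    rw [← ha]; exact hs.2.2.1.1 y hy
  · rw [List.filter_append, List.filter_append, f1]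
  -- If both neighbours carry `c`, the alternative about the successor is chosen.
  · by_cases hB : ∀ b ∈ B.head?, M.chr b ≠ c
    · exact Or.inr ⟨A, a, V₀, rfl, rfl, ha, hB⟩
    · push Not at hB
      obtain ⟨b, hb, hbc⟩ := hB
      cases B with
      | nil => simp at hb
      | cons b' B' =>
        simp only [List.head?_cons, Option.mem_def, Option.some_inj] at hb
        subst hb
        exact Or.inl ⟨b', B', rfl, hbc⟩

/-- The mirror image: the first node of the class of `c` behind the `dollar` node is `b`, so the
replaced node belongs right before `b` in `V`. -/
theorem Graph.placement_next (hg : Graph M) (hc : dollar < c) {b : ℕ}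
    (e : M.us = A ++ M.dol :: b :: B) (hb : M.chr b = c) :
    ∃ V₁ V₂, Placement M c A (b :: B) V₁ (b :: V₂) := by
  obtain ⟨V, hV⟩ := hg.vs_eq
  have hbd : b ≠ M.dol := by
    rintro rfl; rw [hg.dol_chr] at hb; omega
  have hbv : b ∈ V := by
    have := (hg.mem_iff b).mp (by rw [e]; simp)
    rw [hV] at this
    exact (List.mem_cons.mp this).resolve_left hbd
  obtain ⟨V₁, V₂, rfl⟩ := List.append_of_mem hbv
  have hs := hg.sorted
  rw [hV, List.pairwise_cons, List.pairwise_append, List.pairwise_cons] at hs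
  have hst := hg.stable c
  have hn := hg.nodupV.filter (fun x => M.chr x = c)
  have hd : ¬ (M.chr M.dol = c) := by rw [hg.dol_chr]; omega
  rw [hV, List.filter_cons_of_neg (by simpa using hd), List.filter_append,
    List.filter_cons_of_pos (by simpa using hb)] at hst hn
  rw [e, List.filter_append, List.filter_cons_of_neg (by simpa using hd),
    List.filter_cons_of_pos (by simpa using hb)] at hst
  obtain ⟨f1, f2⟩ := append_cons_inj hst hn
  refine ⟨V₁, V₂, e, hV, ?_, ?_, f1, ?_, Or.inl ⟨b, B, rfl, hb⟩⟩
  · intro y hy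
    rw [← hb]; exact hs.2.2.2 y hy b (by simp)
  · intro y hy
    rw [List.mem_cons] at hy
    rcases hy with rfl | hy
    · exact hb.ge
    · rw [← hb]; exact hs.2.2.1.1 y hy
  · rw [List.filter_cons_of_pos (by simpa using hb), List.filter_cons_of_pos (by simpa using hb), f2]

/-- Since `u_x` and `v_x` share a record, the successor of the `dollar` node in `U` is at once the
address of the node of `V` before which `c` is placed. -/
theorem spec_findPosition {S : State} (h : Models M S) (hg : Graph M) (hc : dollar < c)
    (hn : (∃ A a B, M.us = A ++ a :: M.dol :: B ∧ M.chr a = c) ∨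
      ∃ A b B, M.us = A ++ M.dol :: b :: B ∧ M.chr b = c) :
    Spec (findPosition c) S 4 0 (fun r S' => S' = S ∧
      ∃ A B V₁ V₂, Placement M c A B V₁ V₂ ∧ r = V₂.head?) := by
  unfold findPosition
  refine Spec.mono (k := 1 + (1 + 2)) (c := 0 + (0 + 0)) (Q := fun r S' => S' = S ∧
      ∃ A B V₁ V₂, Placement M c A B V₁ V₂ ∧ r = V₂.head?)
    (Spec.bind spec_readRegs ?_) (by omega) (by omega) (fun _ _ h => h)
  rintro _ _ ⟨rfl, rfl⟩
  refine Spec.bind spec_read ?_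
  rintro _ _ ⟨rfl, rfl⟩
  rw [h.dol]
  obtain ⟨A, B, e⟩ := List.append_of_mem hg.dol_mem
  have hlk := h.listU.link A M.dol B e
  rw [hlk.1, hlk.2]
  have hnext : (∀ a ∈ A.getLast?, M.chr a ≠ c) →
      ∃ A B' V₁ V₂, Placement M c A B' V₁ V₂ ∧ B.head? = V₂.head? := by
    intro hA
    rcases hn with ⟨A1, a, B1, e1, ha⟩ | ⟨A1, q, B1, e1, hq⟩
    · exfalso
      have h1 : (A1 ++ [a]) ++ M.dol :: B1 = A ++ M.dol :: B := by rw [← e, e1]; simp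
      have h2 := (append_cons_inj h1 (by rw [h1, ← e]; exact hg.nodupU)).1
      exact hA a (by simp [← h2]) ha
    · have h1 : A1 ++ M.dol :: (q :: B1) = A ++ M.dol :: B := by rw [← e, e1]
      have h2 := (append_cons_inj h1 (by rw [h1, ← e]; exact hg.nodupU)).2
      obtain ⟨V₁, V₂, hp⟩ := hg.placement_next hc e1 hq
      exact ⟨A1, q :: B1, V₁, q :: V₂, hp, by simp [← h2]⟩
  cases hA : A.getLast? with
  | none =>
    refine (Spec.pure ⟨rfl, hnext ?_⟩).mono (by omega) (by omega) (fun _ _ h => h)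
    simp [hA]
  | some a =>
    refine (Spec.bind (k := 1) (k' := 0) (c := 0) (c' := 0) spec_read ?_).mono
      (by omega) (by omega) (fun _ _ h => h)
    rintro _ _ ⟨rfl, rfl⟩
    rw [h.chr]
    split_ifs with hac
    · obtain ⟨A1, rfl⟩ : ∃ A1, A = A1 ++ [a] := by
        rcases List.eq_nil_or_concat A with rfl | ⟨A1, p, rfl⟩
        · simp at hA
        · simp at hA; exact ⟨A1, by simp [hA]⟩
      obtain ⟨V₁, V₂, hp, V₀, rfl⟩ := hg.placement_prev hc (A := A1) (B := B) (by simpa using e) hac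
      refine Spec.pure ⟨rfl, _, _, _, _, hp, ?_⟩
      exact (h.listV.link (M.dol :: V₀) a V₂ (by simpa using hp.vs_eq)).1
    · refine Spec.pure ⟨rfl, hnext ?_⟩
      intro a' ha'
      rw [hA, Option.mem_def, Option.some_inj] at ha'
      rwa [← ha']

/-! ## Splitting a node -/

/-- The graph after splitting the node `j`. -/
def Model.splitTree (M : Model) (j d z h off : ℕ) : Model :=
  (M.split j d z h off).replaceInTree j M.fresh (M.chr j)

variable {j d z h off : ℕ}

@[simp] theorem Model.splitTree_us :
    (M.splitTree j d z h off).us = insertAfter j M.fresh M.us := by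
  simp [Model.splitTree, Model.split]

@[simp] theorem Model.splitTree_vs :
    (M.splitTree j d z h off).vs = insertAfter j M.fresh M.vs := by
  simp [Model.splitTree, Model.split]

@[simp] theorem Model.splitTree_dol : (M.splitTree j d z h off).dol = M.dol := by
  simp [Model.splitTree, Model.split]

@[simp] theorem Model.splitTree_heavyU : (M.splitTree j d z h off).heavyU = M.heavyU := by
  simp [Model.splitTree, Model.split]

@[simp] theorem Model.splitTree_heavyV : (M.splitTree j d z h off).heavyV = M.heavyV := by
  simp [Model.splitTree, Model.split]

theorem Model.splitTree_chr :
    (M.splitTree j d z h off).chr = Function.update M.chr M.fresh (M.chr j) := by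
  simp [Model.splitTree, Model.split]

/-- All lists change by `insertAfter`, which commutes with concatenation and with taking a class. If
the predecessor `a` itself is split, its second part takes its role. -/
theorem Placement.split (hp : Placement M c A B V₁ V₂) (hg : Graph M) (hj : j ∈ M.us)
    (hjd : j ≠ M.dol) :
    Placement (M.splitTree j d z h off) c (insertAfter j M.fresh A) (insertAfter j M.fresh B)
      (insertAfter j M.fresh V₁) (insertAfter j M.fresh V₂) := by
  have hnU := hg.nodupU
  have hnV := hg.nodupV
  have hfu := hg.fresh_notMem
  have hfv := hg.fresh_notMemV
  have hjf : j ≠ M.fresh := by rintro rfl; exact hfu hj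
  have eU := hp.us_eq
  have eV := hp.vs_eq
  rw [eU] at hnU hfu
  rw [eV] at hnV hfv
  simp only [List.mem_append, List.mem_cons, not_or] at hfu hfv
  have hnA := (List.nodup_append.mp hnU).1
  have hn12 := (List.nodup_cons.mp hnV).2
  have hn1 := (List.nodup_append.mp hn12).1
  have hcj : Function.update M.chr M.fresh (M.chr j) j = M.chr j := Function.update_of_ne hjf _ _
  have hcf : Function.update M.chr M.fresh (M.chr j) M.fresh = M.chr j := Function.update_self ..
  have hco : ∀ l : List ℕ, M.fresh ∉ l → ∀ y ∈ l,
      Function.update M.chr M.fresh (M.chr j) y = M.chr y := by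
    intro l hl y hy
    refine Function.update_of_ne ?_ _ _
    rintro rfl; exact hl hy
  have hfil : ∀ l : List ℕ, M.fresh ∉ l →
      l.filter (fun x => Function.update M.chr M.fresh (M.chr j) x = c) =
        l.filter (fun x => M.chr x = c) := by
    intro l hl
    refine List.filter_congr fun y hy => ?_
    rw [hco l hl y hy]
  constructor
  case us_eq =>
    rw [Model.splitTree_us, Model.splitTree_dol, eU, insertAfter_append_eq hnU]
    simp [insertAfter, hjd.symm]
  case vs_eq =>
    rw [Model.splitTree_vs, Model.splitTree_dol, eV, ← insertAfter_append_eq hn12]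
    simp [insertAfter, hjd.symm]
  case le_left =>
    rw [Model.splitTree_chr]
    intro y hy
    rcases mem_insertAfter.mp hy with h1 | ⟨rfl, h1⟩
    · rw [hco V₁ hfv.2.1 y h1]; exact hp.le_left y h1
    · rw [hcf]; exact hp.le_left j h1
  case le_right =>
    rw [Model.splitTree_chr]
    intro y hy
    rcases mem_insertAfter.mp hy with h1 | ⟨rfl, h1⟩
    · rw [hco V₂ hfv.2.2 y h1]; exact hp.le_right y h1
    · rw [hcf]; exact hp.le_right j h1
  case left =>
    rw [Model.splitTree_chr, filter_insertAfter (by simp [hcj]), filter_insertAfter (by simp [hcj]),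
      hfil V₁ hfv.2.1, hfil A hfu.1, hp.left]
  case right =>
    rw [Model.splitTree_chr, filter_insertAfter (by simp [hcj]), filter_insertAfter (by simp [hcj]),
      hfil V₂ hfv.2.2, hfil B hfu.2.2, hp.right]
  case cases =>
    rw [Model.splitTree_chr]
    rcases hp.cases with ⟨q, B', rfl, hq⟩ | ⟨A₀, a, V₀, rfl, rfl, ha, hB⟩
    · left
      have hq' := hco _ hfu.2.2 q (by simp)
      rw [insertAfter]
      split_ifs
      · exact ⟨q, _, rfl, by rw [hq', hq]⟩
      · exact ⟨q, _, rfl, by rw [hq', hq]⟩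
    · right
      have ha' := hco _ hfu.1 a (by simp)
      rw [insertAfter_concat hnA, insertAfter_concat hn1, head?_insertAfter]
      have hB' : ∀ q ∈ B.head?, Function.update M.chr M.fresh (M.chr j) q ≠ c := by
        intro q hq
        rw [hco B hfu.2.2 q (List.mem_of_mem_head? hq)]
        exact hB q hq
      split_ifs with haj
      · subst haj
        exact ⟨insertAfter a M.fresh A₀ ++ [a], M.fresh, insertAfter a M.fresh V₀ ++ [a],
          by simp, by simp, by rw [hcf, ha], hB'⟩
      · exact ⟨_, a, _, rfl, rfl, by rw [ha', ha], hB'⟩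

theorem Graph.flat_splitTree (hg : Graph M) (hj : j ∈ M.us) (hd : d < M.len j) :
    flat (M.splitTree j d z h off).chr (M.splitTree j d z h off).len
      (M.splitTree j d z h off).us = flat M.chr M.len M.us := by
  have hfu := hg.fresh_notMem
  have hn := hg.nodupU
  have hjf : j ≠ M.fresh := by rintro rfl; exact hfu hj
  obtain ⟨A, B, e⟩ := List.append_of_mem hj
  rw [Model.splitTree_us, e]
  rw [e] at hn hfu
  have hjA := notMem_left_of_nodup hn
  have hjB := notMem_right_of_nodup hn
  simp only [List.mem_append, List.mem_cons, not_or] at hfu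
  have key : ∀ l : List ℕ, j ∉ l → M.fresh ∉ l →
      flat (M.splitTree j d z h off).chr (M.splitTree j d z h off).len l = flat M.chr M.len l := by
    intro l h1 h2
    refine flat_congr fun y hy => ?_
    have h3 : y ≠ j := by rintro rfl; exact h1 hy
    have h4 : y ≠ M.fresh := by rintro rfl; exact h2 hy
    simp [Model.splitTree, Model.split, h3, h4]
  have l1 : (M.splitTree j d z h off).len j = d := by simp [Model.splitTree, Model.split]
  have l2 : (M.splitTree j d z h off).len M.fresh = M.len j - d := by
    simp [Model.splitTree, Model.split, hjf.symm]
  have c1 : (M.splitTree j d z h off).chr j = M.chr j := by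
    simp [Model.splitTree, Model.split, hjf]
  have c2 : (M.splitTree j d z h off).chr M.fresh = M.chr j := by
    simp [Model.splitTree, Model.split]
  have hl : M.len j = d + (M.len j - d) := by omega
  rw [insertAfter_append hjA, flat_append, flat_cons, flat_cons, key A hjA hfu.1,
    key B hjB hfu.2.2, l1, l2, c1, c2, flat_append, flat_cons]
  conv_rhs => rw [hl, List.replicate_add, List.append_assoc]

theorem perm_insertAfter {w x : ℕ} {l : List ℕ} (h : w ∈ l) (hn : l.Nodup) :
    (insertAfter w x l).Perm (x :: l) := by
  obtain ⟨A, B, rfl⟩ := List.append_of_mem h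
  rw [insertAfter_append (notMem_left_of_nodup hn)]
  have e : A ++ w :: x :: B = (A ++ [w]) ++ x :: B := by simp
  have e' : x :: (A ++ w :: B) = x :: ((A ++ [w]) ++ B) := by simp
  rw [e, e']
  exact List.perm_middle

/-- A redirected edge led to `j` before and leads to `n` now, so neither part receives more of the
old edges than `j` did. -/
theorem indeg_split_le {l : List ℕ} {tgt tgt' : ℕ → ℕ} {v n j k : ℕ}
    (h : ∀ y ∈ l, tgt' y = tgt y ∨ (tgt y = j ∧ tgt' y = n)) (hn : ∀ y ∈ l, tgt y ≠ n)
    (hk : indeg l tgt (if v = n then j else v) ≤ k) : indeg l tgt' v ≤ k := by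
  refine le_trans (List.countP_mono_left ?_) hk
  intro y hy h1
  simp only [decide_eq_true_eq] at h1 ⊢
  have := hn y hy
  rcases h y hy with h2 | ⟨h2, h3⟩
  · rw [h2] at h1
    rw [if_neg (fun e => this (h1.trans e))]; exact h1
  · rw [if_pos (by rw [← h1, h3]), h2]

/-- Redirection makes no in-degree reach `α`; the only additional tail is the new node, and it has a
single head. -/
theorem Graph.degF_splitTree_le (hg : Graph M) (hj : j ∈ M.us) {α : ℕ}
    (hF : ∀ v ∈ M.us, M.degF v < α) {v : ℕ} (hv : v ∈ (M.splitTree j d z h off).us) :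
    (M.splitTree j d z h off).degF v < α ∨ ((M.splitTree j d z h off).degF v ≤ α ∧
      (M.splitTree j d z h off).tgtF M.fresh = v) := by
  have hfv := hg.fresh_notMemV
  have hfu := hg.fresh_notMem
  rw [Model.degF, Model.splitTree_vs,
    indeg_eq_of_perm (perm_insertAfter ((hg.mem_iff j).mp hj) hg.nodupV), indeg, List.countP_cons]
  have hv' : (if v = M.fresh then j else v) ∈ M.us := by
    rw [Model.splitTree_us, mem_insertAfter] at hv
    split_ifs with h1
    · exact hj
    · exact hv.resolve_right fun h2 => h1 h2.1
  have h1 : indeg M.vs (M.splitTree j d z h off).tgtF v ≤ α - 1 := by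
    refine indeg_split_le (tgt := M.tgtF) (n := M.fresh) (j := j) ?_ ?_ ?_
    · intro y hy
      have hyf : y ≠ M.fresh := by rintro rfl; exact hfv hy
      simp only [Model.splitTree, Model.replaceInTree_tgtF, Model.split,
        Function.update_of_ne hyf]
      split_ifs with h2
      · exact Or.inr ⟨h2.2.1, rfl⟩
      · exact Or.inl rfl
    · intro y hy e
      exact hfu (e ▸ (hg.edgesF y hy).1)
    · have := hF _ hv'
      rw [Model.degF] at this
      omega
  -- This provides `0 < α`, without which `α - 1` would not be below `α`.
  have h2 := hF j hj
  rw [indeg] at h1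
  by_cases h3 : (M.splitTree j d z h off).tgtF M.fresh = v
  · right; simp only [h3, decide_true, if_true, and_true]; omega
  · left; simp only [h3, decide_false, Bool.false_eq_true, if_false]; omega

theorem Graph.degL_splitTree_le (hg : Graph M) (hj : j ∈ M.us) {α : ℕ}
    (hL : ∀ v ∈ M.us, M.degL v < α) {v : ℕ} (hv : v ∈ (M.splitTree j d z h off).us) :
    (M.splitTree j d z h off).degL v < α ∨ ((M.splitTree j d z h off).degL v ≤ α ∧
      (M.splitTree j d z h off).tgtL M.fresh = v) := by
  have hfu := hg.fresh_notMem
  rw [Model.degL, Model.splitTree_us,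
    indeg_eq_of_perm (perm_insertAfter hj hg.nodupU), indeg, List.countP_cons]
  have hv' : (if v = M.fresh then j else v) ∈ M.us := by
    rw [Model.splitTree_us, mem_insertAfter] at hv
    split_ifs with h1
    · exact hj
    · exact hv.resolve_right fun h2 => h1 h2.1
  have h1 : indeg M.us (M.splitTree j d z h off).tgtL v ≤ α - 1 := by
    refine indeg_split_le (tgt := M.tgtL) (n := M.fresh) (j := j) ?_ ?_ ?_
    · intro y hy
      have hyf : y ≠ M.fresh := by rintro rfl; exact hfu hy
      simp only [Model.splitTree, Model.replaceInTree_tgtL, Model.split,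
        Function.update_of_ne hyf]
      split_ifs with h2
      · exact Or.inr ⟨h2.2.1, rfl⟩
      · exact Or.inl rfl
    · intro y hy e
      exact hfu (e ▸ (hg.mem_iff _).mpr (hg.edgesL y hy).1)
    · have := hL _ hv'
      rw [Model.degL] at this
      omega
  have h2 := hL j hj
  rw [indeg] at h1
  by_cases h3 : (M.splitTree j d z h off).tgtL M.fresh = v
  · right; simp only [h3, decide_true, if_true, and_true]; omega
  · left; simp only [h3, decide_false, Bool.false_eq_true, if_false]; omega

end

/-! ## The split-node step -/

/-- The node `w`, after which the new dollar node is inserted in `U`, is determined; `s` is the second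
part of a split node. At most the heads of the two edges that start at `s` are `α`-heavy. -/
structure Ready (b : Prop) (m : ℕ) (t : List ℕ) (α c : ℕ) (M : Model) (w : ℕ) (s : Option ℕ)
    (A B V₁ V₂ U₁ U₂ : List ℕ) : Prop where
  good : Good b m t M
  place : Placement M c A B V₁ V₂
  us_eq : M.us = U₁ ++ w :: U₂
  total_eq : total M.len (U₁ ++ [w]) = total M.len V₁ + 1
  degF : ∀ v ∈ M.us, M.degF v < α ∨ (M.degF v ≤ α ∧ ∃ n, s = some n ∧ M.tgtF n = v)
  degL : ∀ v ∈ M.us, M.degL v < α ∨ (M.degL v ≤ α ∧ ∃ n, s = some n ∧ M.tgtL n = v)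
  second : ∀ n, s = some n → U₂.head? = some n ∧ n ≠ M.dol

section
variable {b : Prop} {m c α : ℕ} {t : List ℕ} {M : Model} {A B V₁ V₂ : List ℕ}

/-- `v_z` starts at `total M.len V₁ + 1`, behind the `dollar` node, and `u` starts at the same
position. So `u` is not the first node of `U`. -/
theorem Placement.exists_pred (hp : Placement M c A B V₁ V₂) (hg : Graph M) {z u : ℕ}
    (hz : V₂.head? = some z) (hu : M.tgtF z = u) (hl : M.labF z = 0) :
    ∃ U₁ w U₂, M.us = U₁ ++ w :: u :: U₂ ∧ total M.len (U₁ ++ [w]) = total M.len V₁ + 1 := by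
  cases V₂ with
  | nil => simp at hz
  | cons z' V₂ =>
    simp only [List.head?_cons, Option.some_inj] at hz
    subst hz hu
    have hv := hg.nodupV
    have ev : M.vs = (M.dol :: V₁) ++ z' :: V₂ := by rw [hp.vs_eq]; simp
    obtain ⟨h1, h2, -⟩ := hg.edgesF z' (by rw [ev]; simp)
    rw [ev] at hv
    rw [hl, add_zero, ev, pos_middle (notMem_left_of_nodup hv), total_cons, hg.dol_len] at h2
    obtain ⟨P, U₂, e⟩ := List.append_of_mem h1
    have hu := hg.nodupU
    rw [e] at hu
    rw [e, pos_middle (notMem_left_of_nodup hu)] at h2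
    rcases List.eq_nil_or_concat P with rfl | ⟨U₁, w, rfl⟩
    · simp at h2
    · rw [List.concat_eq_append] at e h2
      exact ⟨U₁, w, U₂, by rw [e]; simp, by omega⟩

theorem Good.split {j d z h off : ℕ} (hG : Good b m t M) (hj : j ∈ M.us) (hd0 : 0 < d)
    (hd : d < M.len j) (hz : z ∈ M.vs) (ez : pos M.len M.us j + d = pos M.len M.vs z)
    (hh : h ∈ M.us) (eh : pos M.len M.vs j + d = pos M.len M.us h + off) (ho : off < M.len h) :
    Good b m t (M.splitTree j d z h off) where
  graph := (hG.graph.split hj hd0 hd hz ez hh eh ho).replaceInTree _ _ _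
  tree := (hG.tree.split hG.graph hj).1
  flat := (hG.graph.flat_splitTree hj hd).trans hG.flat
  exact := hG.exact.split hG.graph hG.tree hj (by
    rintro rfl
    rw [hG.graph.dol_len] at hd
    omega)

/-- Afterwards the insertion position is a boundary of `U`. A cut makes the edge of `v_z` lead to
the second part with label `0`, so `Placement.exists_pred` applies with and without a cut. -/
theorem spec_splitStep {S : State} (h : Models M S) (hG : Good b m t M)
    (hp : Placement M c A B V₁ V₂) (hF : ∀ v ∈ M.us, M.degF v < α)
    (hL : ∀ v ∈ M.us, M.degL v < α) :
    Spec (splitStep V₂.head?) S (7 * α + 40) 1 (fun r S' => ∃ M' w A' B' V₁' V₂' U₁ U₂,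
      r.1 = some w ∧ Ready b m t α c M' w r.2 A' B' V₁' V₂' U₁ U₂ ∧ V₂'.head? = V₂.head? ∧
      M'.dol = M.dol ∧ M'.heavyU = M.heavyU ∧ M'.heavyV = M.heavyV ∧ Models M' S') := by
  have hg := hG.graph
  unfold splitStep
  cases hz : V₂.head? with
  | none =>
    refine (Spec.bind (k := 1) (k' := 0) (c := 0) (c' := 0) spec_readRegs ?_).mono
      (by omega) (by omega) (fun _ _ h => h)
    rintro _ _ ⟨rfl, rfl⟩
    rw [h.listU.last]
    have hV : V₂ = [] := by simpa using hz
    subst hV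
    rcases List.eq_nil_or_concat M.us with e | ⟨U₁, w, e⟩
    · have := hg.dol_mem
      rw [e] at this
      exact absurd this (by simp)
    · rw [List.concat_eq_append] at e
      refine Spec.pure ⟨M, w, A, B, V₁, [], U₁, [], by simp [e], ?_, rfl, rfl, rfl, rfl, h⟩
      refine ⟨hG, hp, e, ?_, fun v hv => Or.inl (hF v hv), fun v hv => Or.inl (hL v hv), by simp⟩
      -- Nothing follows `c` in `V`, so the new `dollar` goes to the end of `U`, and the totals of
      -- both lists agree.
      rw [← e, hg.total_eq, hp.vs_eq]
      simp [hg.dol_len, add_comm]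
  | some z =>
    have hzv : z ∈ M.vs := by
      rw [hp.vs_eq]
      simp [List.mem_of_mem_head? hz]
    refine (Spec.bind (k := 1) (k' := 7 * α + 37) (c := 0) (c' := 1) spec_read ?_).mono
      (by omega) (by omega) (fun _ _ h => h)
    rintro _ _ ⟨rfl, rfl⟩
    rw [h.labF, h.tgtF]
    split_ifs with hl
    · refine (Spec.bind (k := 1) (k' := 0) (c := 0) (c' := 0) spec_read ?_).mono
        (by omega) (by omega) (fun _ _ h => h)
      rintro _ _ ⟨rfl, rfl⟩
      obtain ⟨U₁, w, U₂, e, ht⟩ := hp.exists_pred hg hz rfl hl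
      have hpr := (h.listU.link (U₁ ++ [w]) (M.tgtF z) U₂ (by simp [e])).2
      rw [hpr]
      refine Spec.pure ⟨M, w, A, B, V₁, V₂, U₁, M.tgtF z :: U₂, by simp, ?_, hz, rfl, rfl, rfl, h⟩
      exact ⟨hG, hp, e, ht, fun v hv => Or.inl (hF v hv), fun v hv => Or.inl (hL v hv), by simp⟩
    · obtain ⟨h1, h2, h3⟩ := hg.edgesF z hzv
      refine (Spec.bind (spec_splitNode h hg h1 h3 (hF _ h1).le (hL _ h1).le) ?_).mono
        (k := 7 * α + 37 + 0) (c := 1 + 0) (by omega) (by omega) (fun _ _ h => h)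
      rintro _ S' ⟨rfl, h', off, hh, eh, ho, hm⟩
      have hd0 : 0 < M.labF z := Nat.pos_of_ne_zero hl
      have hG' := hG.split h1 hd0 h3 hzv h2.symm hh eh ho
      have hjd : M.tgtF z ≠ M.dol := by
        intro e
        rw [e, hg.dol_len] at h3
        omega
      have hp' := hp.split (d := M.labF z) (z := z) (h := h') (off := off) hg h1 hjd
      have hzf : z ≠ M.fresh := by rintro rfl; exact hg.fresh_notMemV hzv
      have t1 : (M.splitTree (M.tgtF z) (M.labF z) z h' off).tgtF z = M.fresh := by
        simp [Model.splitTree, Model.split, hzf, hzv]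
      have t2 : (M.splitTree (M.tgtF z) (M.labF z) z h' off).labF z = 0 := by
        have : (M.splitTree (M.tgtF z) (M.labF z) z h' off).labF =
            (M.split (M.tgtF z) (M.labF z) z h' off).labF := by
          simp only [Model.splitTree, Model.replaceInTree]
          split <;> rfl
        rw [this]
        simp [Model.split, hzf, hzv]
      obtain ⟨U₁, w, U₂, e, ht⟩ := hp'.exists_pred hG'.graph (by rw [head?_insertAfter, hz]) t1 t2
      -- The predecessor of the second part is the first part, which keeps the record of the split
      -- node.
      have hw : w = M.tgtF z := by
        obtain ⟨P, Q, e1⟩ := List.append_of_mem h1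
        have hn := hG'.graph.nodupU
        have e2 := e
        have hn1 := hg.nodupU
        rw [e1] at hn1
        rw [Model.splitTree_us, e1, insertAfter_append (notMem_left_of_nodup hn1)] at e2
        have e3 : (P ++ [M.tgtF z]) ++ M.fresh :: Q = (U₁ ++ [w]) ++ M.fresh :: U₂ := by
          simpa using e2
        have e4 := (append_cons_inj e3 (by
          rw [e3]; rw [e] at hn; simpa using hn)).1
        have := (List.append_inj' e4 (by simp)).2
        simpa using this.symm
      subst hw
      refine Spec.pure ⟨M.splitTree (M.tgtF z) (M.labF z) z h' off, M.tgtF z,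
        insertAfter (M.tgtF z) M.fresh A, insertAfter (M.tgtF z) M.fresh B,
        insertAfter (M.tgtF z) M.fresh V₁, insertAfter (M.tgtF z) M.fresh V₂,
        U₁, M.fresh :: U₂, rfl, ?_, ?_,
        Model.splitTree_dol, Model.splitTree_heavyU, Model.splitTree_heavyV, hm⟩
      · refine ⟨hG', hp', e, ht, ?_, ?_, ?_⟩
        · intro v hv
          rcases hg.degF_splitTree_le h1 hF hv with h4 | ⟨h4, h5⟩
          · exact Or.inl h4
          · exact Or.inr ⟨h4, _, rfl, h5⟩
        · intro v hv
          rcases hg.degL_splitTree_le h1 hL hv with h4 | ⟨h4, h5⟩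
          · exact Or.inl h4
          · exact Or.inr ⟨h4, _, rfl, h5⟩
        · rintro n hn
          simp only [Option.some_inj] at hn
          subst hn
          refine ⟨rfl, ?_⟩
          rw [Model.splitTree_dol]
          exact fun e => hg.fresh_notMem (e ▸ hg.dol_mem)
      · rw [head?_insertAfter, hz]

end

/-! ## The resulting graph -/

section
variable {b : Prop} {m c α w : ℕ} {t : List ℕ} {M M' M'' : Model} {s : Option ℕ}
  {A B V₁ V₂ U₁ U₂ : List ℕ}

/-- At most one node attains `α`, because it must be the head of the edge from the single node in
`s`. The `+ 1` leaves room for the edge into the node of length `1` merged along. -/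
theorem add_le_of_bound {l : List ℕ} {deg tgt : ℕ → ℕ} {u v : ℕ}
    (h : ∀ v ∈ l, deg v < α ∨ (deg v ≤ α ∧ ∃ n, s = some n ∧ tgt n = v))
    (hu : u ∈ l) (hv : v ∈ l) (huv : u ≠ v) : deg u + deg v + 1 ≤ 2 * α := by
  rcases h u hu with h1 | ⟨h1, n, rfl, h2⟩
  · rcases h v hv with h3 | ⟨h3, -⟩ <;> omega
  · rcases h v hv with h3 | ⟨h3, n', h4, h5⟩
    · omega
    · exfalso
      rw [Option.some_inj] at h4
      exact huv (by rw [← h2, ← h5, h4])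

/-- Merging a light node with its neighbours. -/
theorem merged_of_merge (hg : Graph M) {i y : ℕ} (hi : i ∈ M.us) (hid : i ≠ M.dol)
    (hci : M.chr i = c) (hc : dollar < c) (hα : 2 ≤ α)
    (h1 : MergePrev M c i M' y) (h2 : MergeNext M c i M' y M'')
    (hF : ∀ v ∈ M.us, M.degF v < α ∨ (M.degF v ≤ α ∧ ∃ n, s = some n ∧ M.tgtF n = v))
    (hL : ∀ v ∈ M.us, M.degL v < α ∨ (M.degL v ≤ α ∧ ∃ n, s = some n ∧ M.tgtL n = v))
    (hiF : M.degF i ≤ 1) (hiL : M.degL i ≤ 1) :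
    Merged M M'' y (2 * α) (2 * α) ∧
      ∀ n ∈ M.us, n ≠ i → (∀ A B, M.us ≠ A ++ i :: n :: B) → n ∈ M''.us := by
  have hcd : ∀ z, M.chr z = c → z ≠ M.dol := by
    rintro z hz rfl
    rw [hg.dol_chr] at hz
    omega
  have hF' : ∀ v ∈ M.us, M.degF v ≤ α := fun v hv => by rcases hF v hv with h | h <;> omega
  have hL' : ∀ v ∈ M.us, M.degL v ≤ α := fun v hv => by rcases hL v hv with h | h <;> omega
  have mono : ∀ {N kF kL}, Merged M N y kF kL → kF ≤ 2 * α → kL ≤ 2 * α →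
      Merged M N y (2 * α) (2 * α) := fun h hk hl =>
    { h with degF_self := h.degF_self.trans hk, degL_self := h.degL_self.trans hl }
  rcases h1 with ⟨A, p, B, e, hp, rfl, rfl⟩ | ⟨rfl, rfl, -⟩
  · have hyu : y ∈ M.us := by rw [e]; simp
    have hm := (Merged.refl hg hyu).absorb e (by rw [hp, hci]) (hcd y hp) hid
    have eu := hg.absorb_us e
    have hn := hg.nodupU
    rw [e] at hn
    rcases h2 with ⟨A', q, B', e', hq, rfl⟩ | ⟨rfl, -⟩
    · have e1 : (A ++ [y]) ++ i :: B = A' ++ i :: (q :: B') := by rw [← e', e]; simp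
      obtain ⟨-, rfl⟩ := append_cons_inj e1 (by simpa using hn)
      have hyq : y ≠ q := by rintro rfl; exact notMem_right_of_nodup hn (by simp)
      have hqu : q ∈ M.us := by rw [e]; simp
      have hm2 := hm.absorb eu (by rw [hp, hq]) (hcd y hp) (hcd q hq)
      refine ⟨mono hm2 ?_ ?_, ?_⟩
      · have := add_le_of_bound hF hyu hqu hyq; omega
      · have := add_le_of_bound hL hyu hqu hyq; omega
      -- Besides `i`, only its direct successor is absorbed, and `hne` says that `n` is not this
      -- node.
      · intro n hnu hni hne
        have hnq : n ≠ q := by rintro rfl; exact hne _ _ e'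
        rw [hm.graph.absorb_us eu]
        rw [e] at hnu
        simp only [List.mem_append, List.mem_cons] at hnu ⊢
        tauto
    · refine ⟨mono hm ?_ ?_, ?_⟩
      · have := hF' y hyu; omega
      · have := hL' y hyu; omega
      · intro n hnu hni hne
        rw [eu]
        rw [e] at hnu
        simp only [List.mem_append, List.mem_cons] at hnu ⊢
        tauto
  · have hm := Merged.refl hg hi
    rcases h2 with ⟨A, q, B, e, hq, rfl⟩ | ⟨rfl, -⟩
    · have hqu : q ∈ M'.us := by rw [e]; simp
      have hm2 := hm.absorb e (by rw [hci, hq]) hid (hcd q hq)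
      refine ⟨mono hm2 ?_ ?_, ?_⟩
      · have := hF' q hqu; omega
      · have := hL' q hqu; omega
      · intro n hnu hni hne
        have hnq : n ≠ q := by rintro rfl; exact hne _ _ e
        rw [hg.absorb_us e]
        rw [e] at hnu
        simp only [List.mem_append, List.mem_cons] at hnu ⊢
        tauto
    · exact ⟨mono hm (by omega) (by omega), fun n hn _ _ => hn⟩

/-- Merging keeps the B-tree exact. -/
theorem exact_of_merge (hg : Graph M) (hT : TreeInv m M) (hE : Exact b M) {i y : ℕ}
    (hid : i ≠ M.dol) (hci : M.chr i = c) (hc : dollar < c)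
    (h1 : MergePrev M c i M' y) (h2 : MergeNext M c i M' y M'') :
    TreeInv m M'' ∧ Exact b M'' := by
  have hcd : ∀ z, M.chr z = c → z ≠ M.dol := by
    rintro z hz rfl
    rw [hg.dol_chr] at hz
    omega
  have key : TreeInv m M' ∧ Exact b M' ∧ Graph M' ∧ M'.chr = M.chr ∧ M'.dol = M.dol ∧
      M'.chr y = c := by
    rcases h1 with ⟨A, p, B, e, hp, rfl, rfl⟩ | ⟨rfl, rfl, -⟩
    · have hcc : M.chr y = M.chr i := by rw [hp, hci]
      obtain ⟨h3, h4⟩ := hE.absorb_of_adjacent hg hT e hcc (hcd y hp) hid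
      exact ⟨h3, h4, hg.absorb e hcc (hcd y hp) hid, by simp, by simp, by simpa using hp⟩
    · exact ⟨hT, hE, hg, rfl, rfl, hci⟩
  obtain ⟨k1, k2, k3, k4, k5, k6⟩ := key
  rcases h2 with ⟨A, q, B, e, hq, rfl⟩ | ⟨rfl, -⟩
  · obtain ⟨A', e'⟩ := h1.us_eq hg e
    refine k2.absorb_of_adjacent k3 k1 e' ?_ ?_ ?_
    · rw [k6, k4, hq]
    · rw [k5]; exact hcd y (by rw [← k4]; exact k6)
    · rw [k5]; exact hcd q hq
  · exact ⟨k1, k2⟩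

/-- If the old dollar node is merged with its predecessor only, the B-tree remains exact. -/
theorem Ready.exact_of_prev (h : Ready b m t α c M w s A B V₁ V₂ U₁ U₂) (ht : IsText t)
    (hc : dollar < c) {y : ℕ}
    (h1 : MergePrev (M.inserted c (U₁ ++ [w]) U₂ V₁ V₂) c M.dol M' y)
    (h2 : MergeNext (M.inserted c (U₁ ++ [w]) U₂ V₁ V₂) c M.dol M' y M'')
    {A₀ V₀ : List ℕ} {a : ℕ} (eA : A = A₀ ++ [a]) (eV : V₁ = V₀ ++ [a]) (ha : M.chr a = c)
    (hB : ∀ q ∈ B.head?, M.chr q ≠ c) : TreeInv m M'' ∧ Exact b M'' := by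
  have hg := h.good.graph
  have hfu := hg.fresh_notMem
  have hfd : M.fresh ≠ M.dol := fun h => hfu (h ▸ hg.dol_mem)
  have eU : M.us = (U₁ ++ [w]) ++ U₂ := by rw [h.us_eq]; simp
  have hg2 := h.place.graph hg hc eU h.total_eq
  obtain ⟨hT2, htn2⟩ := h.place.tree (c := c) hg h.good.tree eU
  obtain ⟨A', B', e2⟩ := h.place.prev_adjacent hg ht h.good.flat eU h.total_eq eA eV
  rw [← Model.inserted_us (M := M) (c := c) (V₁ := V₁) (V₂ := V₂)] at e2
  have hau : a ∈ M.us := by rw [h.place.us_eq, eA]; simp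
  have had : a ≠ M.dol := by
    rintro rfl; rw [hg.dol_chr] at ha; omega
  have haf : a ≠ M.fresh := by rintro rfl; exact hfu hau
  have ha2 : (M.inserted c (U₁ ++ [w]) U₂ V₁ V₂).chr a = c := by
    rw [Model.inserted_chr haf had, ha]
  have hdn : M.dol ∉ (M.inserted c (U₁ ++ [w]) U₂ V₁ V₂).treeNodes := by
    rw [htn2, mem_map_replace]
    simp [hfd.symm]
  -- The new `dollar` node does not separate `a` from the old one, so the merge with `a` takes
  -- place.
  have p1 : M' = (M.inserted c (U₁ ++ [w]) U₂ V₁ V₂).absorb a M.dol := by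
    rcases h1 with ⟨A1, p, B1, e, hp, rfl, rfl⟩ | ⟨-, -, h3⟩
    · have e3 : (A1 ++ [y]) ++ M.dol :: B1 = (A' ++ [a]) ++ M.dol :: B' := by
        simpa using e.symm.trans e2
      have hn := hg2.nodupU
      rw [e] at hn
      have := (append_cons_inj e3 (by simpa using hn)).1
      have := (List.append_inj' this (by simp)).2
      simp only [List.cons.injEq, and_true] at this
      rw [this]
    · exact absurd ha2 (h3 _ _ _ e2)
  -- A successor that carries `c` would be the head of `B`, since the new `dollar` node carries
  -- another character.
  have p2 : M'' = M' := by
    rcases h2 with ⟨A1, q, B1, e, hq, -⟩ | ⟨rfl, -⟩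
    · exfalso
      have hqf : q ≠ M.fresh := by
        rintro rfl
        have := hg2.dol_chr
        rw [Model.inserted_dol, hq] at this
        omega
      have hnu := hg.nodupU
      rw [h.place.us_eq] at hnu
      have hq2 : q ≠ M.dol := by
        rintro rfl
        have hn := hg2.nodupU
        rw [e] at hn
        exact notMem_right_of_nodup hn (by simp)
      have e3 := filter_fresh hg eU
      rw [← Model.inserted_us (M := M) (c := c) (V₁ := V₁) (V₂ := V₂), e, List.filter_append,
        List.filter_cons_of_pos (by simpa using hfd.symm),
        List.filter_cons_of_pos (by simpa using hqf), h.place.us_eq] at e3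
      have := (append_cons_inj e3.symm hnu).2
      refine hB q (by simp [this]) ?_
      rwa [Model.inserted_chr hqf hq2] at hq
    · rfl
  rw [p2, p1]
  obtain ⟨A1, B1, e3⟩ := hg2.adjacent e2 (by rw [ha2, Model.inserted_chr_dol])
  obtain ⟨h4, h5⟩ := hT2.absorb hg2 e3 (Or.inr hdn)
  exact ⟨h4, h.place.exact_of_prev hg h.good.tree h.good.exact eU h5⟩

/-- The properties of the resulting graph. -/
structure Output (b : Prop) (m : ℕ) (t : List ℕ) (α : ℕ) (M : Model) (y : ℕ) (s : Option ℕ) :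
    Prop where
  good : Good b m t M
  mem : y ∈ M.us
  degF_le : ∀ v ∈ M.us, M.degF v ≤ 2 * α
  degL_le : ∀ v ∈ M.us, M.degL v ≤ 2 * α
  heavyF : ∀ v ∈ M.us, α ≤ M.degF v → v = y ∨ ∃ n, s = some n ∧ M.tgtF n = v
  heavyL : ∀ v ∈ M.us, α ≤ M.degL v → v = y ∨ ∃ n, s = some n ∧ M.tgtL n = v
  second : ∀ n, s = some n → n ∈ M.us

/-- The new `dollar` node has length `1 < α`, no other in-degree grows, and the edge of the second
part in `E_F` is untouched. -/
theorem Ready.degF_inserted (h : Ready b m t α c M w s A B V₁ V₂ U₁ U₂) (hc : dollar < c)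
    (hα : 2 ≤ α) : ∀ v ∈ (M.inserted c (U₁ ++ [w]) U₂ V₁ V₂).us,
      (M.inserted c (U₁ ++ [w]) U₂ V₁ V₂).degF v < α ∨
      ((M.inserted c (U₁ ++ [w]) U₂ V₁ V₂).degF v ≤ α ∧
        ∃ n, s = some n ∧ (M.inserted c (U₁ ++ [w]) U₂ V₁ V₂).tgtF n = v) := by
  have hg := h.good.graph
  have eU : M.us = (U₁ ++ [w]) ++ U₂ := by rw [h.us_eq]; simp
  have hg2 := h.place.graph hg hc eU h.total_eq
  intro v hv
  by_cases hvf : v = M.fresh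
  · left
    have := hg2.degF_le_len v
    rw [hvf, hg.len_inserted.1] at this
    rw [hvf]; omega
  · have hvu : v ∈ M.us := by
      rw [Model.inserted_us] at hv
      rw [eU]
      simp only [List.mem_append, List.mem_cons] at hv ⊢
      tauto
    have h1 := h.place.degF_le (c := c) (U₁ := U₁ ++ [w]) (U₂ := U₂) hg hvf
    rcases h.degF v hvu with h2 | ⟨h2, n, h3, h4⟩
    · exact Or.inl (h1.trans_lt h2)
    · refine Or.inr ⟨h1.trans h2, n, h3, ?_⟩
      obtain ⟨h5, h6⟩ := h.second n h3
      have hnf : n ≠ M.fresh := by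
        rintro rfl
        exact hg.fresh_notMem (by rw [eU]; simp [List.mem_of_mem_head? h5])
      simp [Model.inserted, Model.newDollar, Model.insertDollar, hnf, h6, h4]

theorem Ready.degL_inserted (h : Ready b m t α c M w s A B V₁ V₂ U₁ U₂) (hc : dollar < c)
    (hα : 2 ≤ α) : ∀ v ∈ (M.inserted c (U₁ ++ [w]) U₂ V₁ V₂).us,
      (M.inserted c (U₁ ++ [w]) U₂ V₁ V₂).degL v < α ∨
      ((M.inserted c (U₁ ++ [w]) U₂ V₁ V₂).degL v ≤ α ∧
        ∃ n, s = some n ∧ (M.inserted c (U₁ ++ [w]) U₂ V₁ V₂).tgtL n = v) := by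
  have hg := h.good.graph
  have eU : M.us = (U₁ ++ [w]) ++ U₂ := by rw [h.us_eq]; simp
  have hg2 := h.place.graph hg hc eU h.total_eq
  intro v hv
  by_cases hvf : v = M.fresh
  · left
    have := hg2.degL_le_len v
    rw [hvf, hg.len_inserted.1] at this
    rw [hvf]; omega
  by_cases hvd : v = M.dol
  · left
    have := hg2.degL_le_len v
    rw [hvd, hg.len_inserted.2] at this
    rw [hvd]; omega
  · have hvu : v ∈ M.us := by
      rw [Model.inserted_us] at hv
      rw [eU]
      simp only [List.mem_append, List.mem_cons] at hv ⊢
      tauto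
    have h1 := Placement.degL_le (c := c) (V₁ := V₁) (V₂ := V₂) hg eU hvf hvd
    rcases h.degL v hvu with h2 | ⟨h2, n, h3, h4⟩
    · exact Or.inl (h1.trans_lt h2)
    · refine Or.inr ⟨h1.trans h2, n, h3, ?_⟩
      obtain ⟨h5, h6⟩ := h.second n h3
      have hnf : n ≠ M.fresh := by
        rintro rfl
        exact hg.fresh_notMem (by rw [eU]; simp [List.mem_of_mem_head? h5])
      -- The redirected edge of `E_L` starts at the node at position `0`, while the second part
      -- starts at `total M.len V₁ + 1`; so the edge of the second part keeps its head.
      have hnt : n ≠ M.tgtF M.dol := by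
        intro hh
        have h7 := (hg.edgesF M.dol ((hg.mem_iff _).mp hg.dol_mem)).2.1
        rw [← hh, h.place.vs_eq] at h7
        obtain ⟨U₂', rfl⟩ : ∃ U₂', U₂ = n :: U₂' := by
          cases U₂ with
          | nil => simp at h5
          | cons a U₂ =>
            simp only [List.head?_cons, Option.some_inj] at h5
            exact ⟨U₂, by rw [h5]⟩
        have hn := hg.nodupU
        rw [eU] at hn
        rw [eU, pos_middle (notMem_left_of_nodup hn), h.total_eq] at h7
        simp [pos] at h7
        omega
      simp [Model.inserted, Model.newDollar, Model.insertDollar, hnf, hnt, h4]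

/-- After the merges, every node except `y` has at most the in-degrees it had before, and reaches
`α` only as the head of an edge of the second part. -/
theorem Ready.output (h : Ready b m t α c M w s A B V₁ V₂ U₁ U₂) (ht : IsText t)
    (hc : dollar < c) (hα : 2 ≤ α) {y : ℕ}
    (h1 : MergePrev (M.inserted c (U₁ ++ [w]) U₂ V₁ V₂) c M.dol M' y)
    (h2 : MergeNext (M.inserted c (U₁ ++ [w]) U₂ V₁ V₂) c M.dol M' y M'') :
    Output b m (c :: t) α M'' y s ∧ M''.heavyU = M.heavyU ∧ M''.heavyV = M.heavyV := by
  have hg := h.good.graph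
  have hfu := hg.fresh_notMem
  have hfd : M.fresh ≠ M.dol := fun h => hfu (h ▸ hg.dol_mem)
  have eU : M.us = (U₁ ++ [w]) ++ U₂ := by rw [h.us_eq]; simp
  have hg2 := h.place.graph hg hc eU h.total_eq
  have hF2 := h.degF_inserted hc hα
  have hL2 := h.degL_inserted hc hα
  have hid : M.dol ≠ (M.inserted c (U₁ ++ [w]) U₂ V₁ V₂).dol := by
    rw [Model.inserted_dol]; exact hfd.symm
  have hi : M.dol ∈ (M.inserted c (U₁ ++ [w]) U₂ V₁ V₂).us := by
    have := hg.dol_mem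
    rw [eU] at this
    rw [Model.inserted_us]
    simp only [List.mem_append, List.mem_cons] at this ⊢
    tauto
  obtain ⟨hm, hs⟩ := merged_of_merge hg2 hi hid Model.inserted_chr_dol hc hα h1 h2 hF2 hL2
    (hg.len_inserted.2 ▸ hg2.degF_le_len M.dol) (hg.len_inserted.2 ▸ hg2.degL_le_len M.dol)
  have hTE : TreeInv m M'' ∧ Exact b M'' := by
    -- If the successor carries `c`, the insertion alone keeps the tree exact and each merge is a
    -- separate step; otherwise insertion and merge are taken together.
    rcases h.place.cases with ⟨q, B', eB, hq⟩ | ⟨A₀, a, V₀, eA, eV, ha, hB⟩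
    · exact exact_of_merge hg2 (h.place.tree hg h.good.tree eU).1
        (h.place.exact_of_next hg h.good.tree h.good.exact eU eB hq) hid Model.inserted_chr_dol hc
        h1 h2
    · exact h.exact_of_prev ht hc h1 h2 eA eV ha hB
  refine ⟨⟨⟨hm.graph, hTE.1, ?_, hTE.2⟩, hm.mem, ?_, ?_, ?_, ?_, ?_⟩, ?_, ?_⟩
  · rw [hm.flat]; exact h.place.flat_inserted hg hc ht h.good.flat eU h.total_eq
  · intro v hv
    by_cases hvy : v = y
    · rw [hvy]; exact hm.degF_self
    · refine (hm.degF v hvy).trans ?_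
      rcases hF2 v (hm.sub v hv) with h3 | h3 <;> omega
  · intro v hv
    by_cases hvy : v = y
    · rw [hvy]; exact hm.degL_self
    · refine (hm.degL v hvy).trans ?_
      rcases hL2 v (hm.sub v hv) with h3 | h3 <;> omega
  · intro v hv hle
    by_cases hvy : v = y
    · exact Or.inl hvy
    · right
      rcases hF2 v (hm.sub v hv) with h3 | ⟨-, n, h4, h5⟩
      · have := hm.degF v hvy; omega
      · exact ⟨n, h4, by rw [hm.tgtF n (h5 ▸ hv), h5]⟩
  · intro v hv hle
    by_cases hvy : v = y
    · exact Or.inl hvy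
    · right
      rcases hL2 v (hm.sub v hv) with h3 | ⟨-, n, h4, h5⟩
      · have := hm.degL v hvy; omega
      · exact ⟨n, h4, by rw [hm.tgtL n (h5 ▸ hv), h5]⟩
  · intro n hn
    obtain ⟨h5, h6⟩ := h.second n hn
    obtain ⟨U₂', e2⟩ : ∃ U₂', U₂ = n :: U₂' := by
      cases hU : U₂ with
      | nil => simp [hU] at h5
      | cons a U₂ =>
        simp only [hU, List.head?_cons, Option.some_inj] at h5
        exact ⟨U₂, by rw [h5]⟩
    -- The second part stands right behind the new `dollar` node and not behind the old one, so no
    -- merge absorbs it.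
    refine hs n (by rw [Model.inserted_us, e2]; simp) h6 fun A1 B1 e3 => ?_
    have hn2 := hg2.nodupU
    rw [e3] at hn2
    rw [Model.inserted_us, e2] at e3
    have e4 : (A1 ++ [M.dol]) ++ n :: B1 = ((U₁ ++ [w]) ++ [M.fresh]) ++ n :: U₂' := by
      simpa using e3.symm
    have := (append_cons_inj e4 (by simpa using hn2)).1
    have := (List.append_inj' this (by simp)).2
    simp only [List.cons.injEq, and_true] at this
    exact hfd this.symm
  · rw [hm.heavyU]; simp [Model.inserted, Model.newDollar, Model.insertDollar]
  · rw [hm.heavyV]; simp [Model.inserted, Model.newDollar, Model.insertDollar]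

end

/-! ## The fast update operation -/

theorem Models.setHeavyU {M : Model} {S : State} (h : Models M S) (l : List ℕ) :
    Models { M with heavyU := l } { S with heavyU := l } := { h with heavyU := rfl }

theorem Models.setHeavyV {M : Model} {S : State} (h : Models M S) (l : List ℕ) :
    Models { M with heavyV := l } { S with heavyV := l } := { h with heavyV := rfl }

/-- The listing stops after `α` entries, so a node is heavy precisely if the list is full, and a
check takes at most `α + 3` steps. -/
theorem spec_checkHeavyU {M : Model} {S : State} (h : Models M S) (hg : Graph M) {α : ℕ}
    {l : List ℕ} (hl : ∀ x ∈ l, x ∈ M.us) :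
    Spec (checkHeavyU α l) S (l.length * (α + 3)) 0 (fun _ S' => Models
      { M with heavyU := M.heavyU ++ l.dedup.filter (fun x => α ≤ M.degF x) } S') := by
  have key : ∀ (k : List ℕ) (M : Model) (S : State), Models M S → Graph M → (∀ x ∈ k, x ∈ M.us) →
      Spec (k.forM fun u => do
        let e ← incomingF u α
        if e.length = α then pushHeavyU u else pure ()) S (k.length * (α + 3)) 0
      (fun _ S' => Models
        { M with heavyU := M.heavyU ++ k.filter (fun x => α ≤ M.degF x) } S') := by
    intro k
    induction k with
    | nil =>
      intro M S h _ _
      exact (Spec.pure (by simpa using h)).mono (by simp) le_rfl (fun _ _ h => h)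
    | cons a k ih =>
      intro M S h hg hk
      have ha := hk a (by simp)
      refine (Spec.bind (k := α + 3) (k' := k.length * (α + 3)) (c := 0) (c' := 0)
        (f := fun _ => k.forM fun u => do
          let e ← incomingF u α
          if e.length = α then pushHeavyU u else pure ())
        (Q := fun _ S' => Models { M with
          heavyU := M.heavyU ++ [a].filter (fun x => α ≤ M.degF x) } S') ?_ ?_).mono
        (by simp; ring_nf; omega) le_rfl (fun _ _ h => h)
      · refine (Spec.bind (k' := 1) (c' := 0) (spec_incomingF h hg ha α) ?_).mono (by omega)
          (by omega) (fun _ _ h => h)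
        rintro _ _ ⟨rfl, rfl⟩
        have e : (List.take α (M.vs.filter (fun y => M.tgtF y = a))).length = min α (M.degF a) := by
          rw [List.length_take, Model.degF, indeg, List.countP_eq_length_filter]
        rw [e]
        by_cases hd : α ≤ M.degF a
        · rw [if_pos (by omega)]
          refine ⟨le_rfl, le_rfl, ?_⟩
          have := h.setHeavyU (M.heavyU ++ [a])
          simpa [pushHeavyU, hd, h.heavyU] using this
        · rw [if_neg (by omega)]
          refine (Spec.pure ?_).mono (by omega) le_rfl (fun _ _ h => h)
          simpa [hd] using h
      · rintro _ S1 h1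
        refine (ih _ S1 h1 { hg with } (fun x hx => hk x (by simp [hx]))).mono le_rfl le_rfl ?_
        rintro _ S2 h2
        have e : (a :: k).filter (fun x => α ≤ M.degF x) =
            [a].filter (fun x => α ≤ M.degF x) ++ k.filter (fun x => α ≤ M.degF x) := by
          rw [← List.filter_append]; rfl
        rw [e, ← List.append_assoc]
        exact h2
  refine (key l.dedup M S h hg (fun x hx => hl x (List.mem_dedup.mp hx))).mono ?_ le_rfl
    (fun _ _ h => h)
  exact Nat.mul_le_mul_right _ (List.dedup_sublist l).length_le

theorem spec_checkHeavyV {M : Model} {S : State} (h : Models M S) (hg : Graph M) {α : ℕ}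
    {l : List ℕ} (hl : ∀ x ∈ l, x ∈ M.us) :
    Spec (checkHeavyV α l) S (l.length * (α + 3)) 0 (fun _ S' => Models
      { M with heavyV := M.heavyV ++ l.dedup.filter (fun x => α ≤ M.degL x) } S') := by
  have key : ∀ (k : List ℕ) (M : Model) (S : State), Models M S → Graph M → (∀ x ∈ k, x ∈ M.us) →
      Spec (k.forM fun u => do
        let e ← incomingL u α
        if e.length = α then pushHeavyV u else pure ()) S (k.length * (α + 3)) 0
      (fun _ S' => Models
        { M with heavyV := M.heavyV ++ k.filter (fun x => α ≤ M.degL x) } S') := by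
    intro k
    induction k with
    | nil =>
      intro M S h _ _
      exact (Spec.pure (by simpa using h)).mono (by simp) le_rfl (fun _ _ h => h)
    | cons a k ih =>
      intro M S h hg hk
      have ha := hk a (by simp)
      refine (Spec.bind (k := α + 3) (k' := k.length * (α + 3)) (c := 0) (c' := 0)
        (f := fun _ => k.forM fun u => do
          let e ← incomingL u α
          if e.length = α then pushHeavyV u else pure ())
        (Q := fun _ S' => Models { M with
          heavyV := M.heavyV ++ [a].filter (fun x => α ≤ M.degL x) } S') ?_ ?_).mono
        (by simp; ring_nf; omega) le_rfl (fun _ _ h => h)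
      · refine (Spec.bind (k' := 1) (c' := 0) (spec_incomingL h hg ((hg.mem_iff a).mp ha) α) ?_).mono
          (by omega) (by omega) (fun _ _ h => h)
        rintro _ _ ⟨rfl, rfl⟩
        have e : (List.take α (M.us.filter (fun y => M.tgtL y = a))).length = min α (M.degL a) := by
          rw [List.length_take, Model.degL, indeg, List.countP_eq_length_filter]
        rw [e]
        by_cases hd : α ≤ M.degL a
        · rw [if_pos (by omega)]
          refine ⟨le_rfl, le_rfl, ?_⟩
          have := h.setHeavyV (M.heavyV ++ [a])
          simpa [pushHeavyV, hd, h.heavyV] using this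
        · rw [if_neg (by omega)]
          refine (Spec.pure ?_).mono (by omega) le_rfl (fun _ _ h => h)
          simpa [hd] using h
      · rintro _ S1 h1
        refine (ih _ S1 h1 { hg with } (fun x hx => hk x (by simp [hx]))).mono le_rfl le_rfl ?_
        rintro _ S2 h2
        have e : (a :: k).filter (fun x => α ≤ M.degL x) =
            [a].filter (fun x => α ≤ M.degL x) ++ k.filter (fun x => α ≤ M.degL x) := by
          rw [← List.filter_append]; rfl
        rw [e, ← List.append_assoc]
        exact h2
  refine (key l.dedup M S h hg (fun x hx => hl x (List.mem_dedup.mp hx))).mono ?_ le_rfl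
    (fun _ _ h => h)
  exact Nat.mul_le_mul_right _ (List.dedup_sublist l).length_le

/-- The resulting graph with the arrays of heavy nodes. -/
structure Updated (b : Prop) (m : ℕ) (t : List ℕ) (α : ℕ) (M : Model) : Prop where
  good : Good b m t M
  degF_le : ∀ v ∈ M.us, M.degF v ≤ 2 * α
  degL_le : ∀ v ∈ M.us, M.degL v ≤ 2 * α
  heavyU_nodup : M.heavyU.Nodup
  heavyV_nodup : M.heavyV.Nodup
  heavyU_mem : ∀ x, x ∈ M.heavyU ↔ x ∈ M.us ∧ α ≤ M.degF x
  heavyV_mem : ∀ x, x ∈ M.heavyV ↔ x ∈ M.us ∧ α ≤ M.degL x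
  heavyU_length : M.heavyU.length ≤ 2
  heavyV_length : M.heavyV.length ≤ 2

section
variable {b : Prop} {m c α : ℕ} {t : List ℕ} {M : Model} {S : State}

/-- All heavy nodes occur in `l`, so checking `l` finds all of them; they are among the two nodes
`y` and `a`, whatever the length of `l`. -/
theorem heavy_list {us l : List ℕ} {deg : ℕ → ℕ} {a y : ℕ} (hl : ∀ x ∈ l, x ∈ us)
    (hy : ∀ v ∈ us, α ≤ deg v → v ∈ l ∧ (v = y ∨ v = a)) :
    (l.dedup.filter (fun x => α ≤ deg x)).Nodup ∧
    (∀ x, x ∈ l.dedup.filter (fun x => α ≤ deg x) ↔ x ∈ us ∧ α ≤ deg x) ∧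
    (l.dedup.filter (fun x => α ≤ deg x)).length ≤ 2 := by
  have hn : (l.dedup.filter (fun x => α ≤ deg x)).Nodup := (List.nodup_dedup l).filter _
  have hm : ∀ x, x ∈ l.dedup.filter (fun x => α ≤ deg x) ↔ x ∈ us ∧ α ≤ deg x := by
    intro x
    rw [List.mem_filter, List.mem_dedup, decide_eq_true_eq]
    exact ⟨fun h => ⟨hl x h.1, h.2⟩, fun h => ⟨(hy x h.1 h.2).1, h.2⟩⟩
  refine ⟨hn, hm, ?_⟩
  have hsub : l.dedup.filter (fun x => α ≤ deg x) ⊆ [y, a] := by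
    intro x hx
    have h1 := (hm x).mp hx
    simpa using (hy x h1.1 h1.2).2
  exact (hn.subperm hsub).length_le

theorem Output.updated {y : ℕ} {s : Option ℕ} (h : Output b m t α M y s) {lF lL : List ℕ}
    (hF : ∀ x ∈ lF, x ∈ M.us) (hL : ∀ x ∈ lL, x ∈ M.us) (yF : y ∈ lF) (yL : y ∈ lL)
    (sF : ∀ n, s = some n → M.tgtF n ∈ lF) (sL : ∀ n, s = some n → M.tgtL n ∈ lL) :
    Updated b m t α { M with
      heavyU := lF.dedup.filter (fun x => α ≤ M.degF x)
      heavyV := lL.dedup.filter (fun x => α ≤ M.degL x) } := by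
  -- A name for the second part; it is a dummy value if there was no split.
  have hs : ∃ n', ∀ n, s = some n → n = n' := by
    cases s with
    | none => exact ⟨0, by simp⟩
    | some n => exact ⟨n, by simp [eq_comm]⟩
  obtain ⟨n', hn'⟩ := hs
  obtain ⟨f1, f2, f3⟩ := heavy_list (α := α) (deg := M.degF) (y := y) (a := M.tgtF n') hF (by
    intro v hv hd
    rcases h.heavyF v hv hd with rfl | ⟨n, hn, rfl⟩
    · exact ⟨yF, Or.inl rfl⟩
    · exact ⟨sF n hn, Or.inr (by rw [hn' n hn])⟩)
  obtain ⟨l1, l2, l3⟩ := heavy_list (α := α) (deg := M.degL) (y := y) (a := M.tgtL n') hL (by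
    intro v hv hd
    rcases h.heavyL v hv hd with rfl | ⟨n, hn, rfl⟩
    · exact ⟨yL, Or.inl rfl⟩
    · exact ⟨sL n hn, Or.inr (by rw [hn' n hn])⟩)
  exact ⟨⟨{ h.good.graph with }, { h.good.tree with }, h.good.flat, h.good.exact⟩, h.degF_le,
    h.degL_le, f1, l1, f2, l2, f3, l3⟩

/-- The bounds of the phases add up to `25 * α + 166` steps and `4` order maintenance calls, within
`200 * α` and `200`. -/
theorem spec_fastUpdate (h : Models M S) (hG : Good b m t M) (ht : IsText t) (hc : dollar < c)
    (hα : 2 ≤ α) (hn : (∃ A a B, M.us = A ++ a :: M.dol :: B ∧ M.chr a = c) ∨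
      ∃ A b B, M.us = A ++ M.dol :: b :: B ∧ M.chr b = c)
    (hF : ∀ v ∈ M.us, M.degF v < α) (hL : ∀ v ∈ M.us, M.degL v < α)
    (hU : M.heavyU = []) (hV : M.heavyV = []) :
    Spec (fastUpdate α c) S (200 * α) 200 (fun _ S' => ∃ M', Models M' S' ∧
      Updated b m (c :: t) α M') := by
  unfold fastUpdate
  refine Spec.mono (k := 1 + (4 + ((7 * α + 40) + (41 + ((12 * α + 60) + (1 + (1 + (3 * (α + 3) +
    3 * (α + 3))))))))) (c := 0 + (0 + (1 + (1 + (2 + (0 + (0 + (0 + 0))))))))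
    (Q := fun _ S' => ∃ M', Models M' S' ∧ Updated b m (c :: t) α M')
    (Spec.bind spec_readRegs ?_) (by omega) (by omega) (fun _ _ h => h)
  rintro _ _ ⟨rfl, rfl⟩
  refine Spec.bind (spec_findPosition h hG.graph hc hn) ?_
  rintro _ _ ⟨rfl, A, B, V₁, V₂, hp, rfl⟩
  refine Spec.bind (spec_splitStep h hG hp hF hL) ?_
  rintro ⟨w', s⟩ S1 ⟨M1, w, A', B', V₁', V₂', U₁, U₂, hw, hr, hz, hd, hU1, hV1, h1⟩
  dsimp only at hw hr ⊢
  subst hw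
  have hg1 := hr.good.graph
  have eU : M1.us = (U₁ ++ [w]) ++ U₂ := by rw [hr.us_eq]; simp
  rw [← hz, h.dol, ← hd]
  refine Spec.bind (spec_replaceAndInsert h1 hg1 hr.us_eq hr.place.vs_eq) ?_
  rintro _ S2 h2
  have h2' : Models (M1.inserted c (U₁ ++ [w]) U₂ V₁' V₂') S2 := by
    simpa [Model.inserted, Model.newDollar] using h2
  have hg2 := hr.place.graph hg1 hc eU hr.total_eq
  have hF2 := hr.degF_inserted hc hα
  have hL2 := hr.degL_inserted hc hα
  have hi : M1.dol ∈ (M1.inserted c (U₁ ++ [w]) U₂ V₁' V₂').us := by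
    have := hg1.dol_mem
    rw [eU] at this
    rw [Model.inserted_us]
    simp only [List.mem_append, List.mem_cons] at this ⊢
    tauto
  refine Spec.bind (spec_mergeStep h2' hg2 (K := α) hi Model.inserted_chr_dol hc
    (fun v hv => by rcases hF2 v hv with h | h <;> omega)
    (fun v hv => by rcases hL2 v hv with h | h <;> omega)) ?_
  rintro y S3 ⟨M', M3, hm1, hm2, h3⟩
  obtain ⟨ho, hU3, hV3⟩ := hr.output ht hc hα hm1 hm2
  rw [hU1, hU] at hU3
  rw [hV1, hV] at hV3
  have hg3 := ho.good.graph
  have htF : ∀ x ∈ M3.us, M3.tgtF x ∈ M3.us := fun x hx => (hg3.edgesF x ((hg3.mem_iff x).mp hx)).1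
  have htL : ∀ x ∈ M3.us, M3.tgtL x ∈ M3.us := fun x hx =>
    (hg3.mem_iff _).mpr (hg3.edgesL x hx).1
  have hfin : ∀ lF lL : List ℕ, lF.length ≤ 3 → lL.length ≤ 3 → (∀ x ∈ lF, x ∈ M3.us) →
      (∀ x ∈ lL, x ∈ M3.us) → y ∈ lF → y ∈ lL → (∀ n, s = some n → M3.tgtF n ∈ lF) →
      (∀ n, s = some n → M3.tgtL n ∈ lL) →
      Spec (do checkHeavyU α lF; checkHeavyV α lL) S3 (3 * (α + 3) + 3 * (α + 3)) (0 + 0)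
        (fun _ S' => ∃ M', Models M' S' ∧ Updated b m (c :: t) α M') := by
    intro lF lL kF kL hlF hlL yF yL sF sL
    refine Spec.bind ((spec_checkHeavyU h3 hg3 hlF).mono (Nat.mul_le_mul_right _ kF) le_rfl
      (fun _ _ h => h)) ?_
    rintro _ S4 h4
    refine (spec_checkHeavyV h4 { hg3 with } hlL).mono (Nat.mul_le_mul_right _ kL) le_rfl ?_
    rintro _ S5 h5
    refine ⟨_, ?_, ho.updated hlF hlL yF yL sF sL⟩
    convert h5 using 2
    · simp [hU3]
    · simp only [hV3, List.nil_append]; rfl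
  refine Spec.bind spec_read ?_
  rintro _ _ ⟨rfl, rfl⟩
  rw [h3.tgtF, h3.tgtL]
  cases s with
  | some n =>
    refine Spec.bind spec_read ?_
    rintro _ _ ⟨rfl, rfl⟩
    rw [h3.tgtF, h3.tgtL]
    have hnu := ho.second n rfl
    refine hfin _ _ (by simp) (by simp) ?_ ?_ (by simp) (by simp) (by simp) (by simp)
    · simp [htF n hnu, ho.mem, htF y ho.mem]
    · simp [htL n hnu, ho.mem, htL y ho.mem]
  | none =>
    refine Spec.mono (hfin _ _ (by simp) (by simp) ?_ ?_ (by simp) (by simp) (by simp)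
      (by simp)) (by omega) (by omega) (fun _ _ h => h)
    · simp [ho.mem, htF y ho.mem]
    · simp [ho.mem, htL y ho.mem]

end

/-! ## Stored graphs -/

theorem exists_append_cons_cons {l : List ℕ} {i x y : ℕ} (h1 : l[i]? = some x)
    (h2 : l[i + 1]? = some y) : ∃ A B, l = A ++ x :: y :: B := by
  obtain ⟨hi, rfl⟩ := List.getElem?_eq_some_iff.mp h1
  obtain ⟨hi', rfl⟩ := List.getElem?_eq_some_iff.mp h2
  refine ⟨l.take i, l.drop (i + 2), ?_⟩
  rw [← List.drop_eq_getElem_cons, ← List.drop_eq_getElem_cons, List.take_append_drop]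

section
variable {b : Prop} {m c α : ℕ} {t : List ℕ} {M : Model} {S : State}

theorem Graph.exists_neighbour (hg : Graph M)
    (h : ∃ i : ℕ, (∃ r, M.labels[i]? = some r ∧ r.1 = dollar) ∧
      ((∃ r, 0 < i ∧ M.labels[i - 1]? = some r ∧ r.1 = c) ∨
        (∃ r, M.labels[i + 1]? = some r ∧ r.1 = c))) :
    (∃ A a B, M.us = A ++ a :: M.dol :: B ∧ M.chr a = c) ∨
      ∃ A b B, M.us = A ++ M.dol :: b :: B ∧ M.chr b = c := by
  have hl : ∀ (k : ℕ) r, M.labels[k]? = some r → ∃ x, M.us[k]? = some x ∧ M.chr x = r.1 := by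
    intro k r hr
    simp only [Model.labels, labels, List.getElem?_map, Option.map_eq_some_iff] at hr
    obtain ⟨x, hx, rfl⟩ := hr
    exact ⟨x, hx, rfl⟩
  obtain ⟨i, ⟨r, hr, hrd⟩, h⟩ := h
  obtain ⟨x, hx, hxr⟩ := hl i r hr
  have hxd : x = M.dol := by
    by_contra hne
    have := hg.dol_lt x (List.mem_of_getElem? hx) hne
    omega
  subst hxd
  rcases h with ⟨r', hi, hr', hc⟩ | ⟨r', hr', hc⟩
  · obtain ⟨a, ha, har⟩ := hl _ _ hr'
    have hx' : M.us[i - 1 + 1]? = some M.dol := by rwa [Nat.sub_add_cancel hi]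
    obtain ⟨A, B, e⟩ := exists_append_cons_cons ha hx'
    exact Or.inl ⟨A, a, B, e, har.trans hc⟩
  · obtain ⟨a, ha, har⟩ := hl _ _ hr'
    obtain ⟨A, B, e⟩ := exists_append_cons_cons hx ha
    exact Or.inr ⟨A, a, B, e, har.trans hc⟩

theorem ncard_le_length {n : ℕ} {us l : List ℕ} (hn : n = us.length) (hu : us.Nodup)
    {s : Set (Fin n)} (h : ∀ i ∈ s, us[(i : ℕ)]'(hn ▸ i.2) ∈ l) : s.ncard ≤ l.length := by
  refine le_trans ?_ l.toFinset_card_le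
  rw [← Set.ncard_coe_finset]
  refine Set.ncard_le_ncard_of_injOn (fun i => us[(i : ℕ)]'(hn ▸ i.2)) ?_ ?_
    (Finset.finite_toSet _)
  · intro i hi
    simpa using h i hi
  · intro i _ j _ hij
    exact Fin.ext ((hu.getElem_inj_iff).mp hij)

theorem Models.treeNodes_eq (h : Models M S) : S.treeNodes = M.treeNodes := by
  rw [State.treeNodes, Model.treeNodes, h.tree, h.slots]

/-- A represented graph of bounded degrees is a stored graph. -/
theorem Updated.stored (hM : Updated b m t α M) (h : Models M S) (ht : IsText t) :
    ∃ D', IsDBWT t D' ∧ Balanced (2 * α + 1) t D' ∧ {i | HeavyU α t D' i}.ncard ≤ 2 ∧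
      {i | HeavyV α t D' i}.ncard ≤ 2 ∧ Stores α m t D' S ∧ (b → StoresAll α m t D' S) := by
  have hg := hM.good.graph
  have hf := hM.good.flat
  have hlen : M.labels.length = M.us.length := length_labels _ _ _
  have hlt : ∀ i : Fin M.labels.length, (i : ℕ) < M.us.length := fun i => hlen ▸ i.2
  have hst := storesAt_of_models ht h hg hM.good.tree hf hM.heavyU_nodup hM.heavyU_mem
    hM.heavyV_nodup hM.heavyV_mem
  refine ⟨M.labels, isDBWT_labels.mpr ⟨hg.len_pos, hf⟩, fun i => ⟨?_, ?_⟩, ?_, ?_,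
    ⟨_, hst, fun i hi => ?_⟩, fun hb => ⟨_, hst, fun i => ⟨fun hi => ?_, fun hi => ?_⟩⟩⟩
  -- In-degrees up to `2 * α` are allowed in a `(2 * α + 1)`-balanced DBWT.
  · rw [hg.heavyU_iff ht hf _ i (hlt i)]
    have := hM.degF_le _ (List.getElem_mem (hlt i))
    rw [Model.degF] at this
    omega
  · rw [hg.heavyV_iff ht hf _ i (hlt i)]
    have := hM.degL_le _ (List.getElem_mem (hlt i))
    rw [Model.degL] at this
    omega
  · refine (ncard_le_length hlen hg.nodupU fun i hi => ?_).trans hM.heavyU_length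
    exact (hM.heavyU_mem _).mpr ⟨List.getElem_mem _, (hg.heavyU_iff ht hf _ i (hlt i)).mp hi⟩
  · refine (ncard_le_length hlen hg.nodupU fun i hi => ?_).trans hM.heavyV_length
    exact (hM.heavyV_mem _).mpr ⟨List.getElem_mem _, (hg.heavyV_iff ht hf _ i (hlt i)).mp hi⟩
  · rw [h.treeNodes_eq] at hi
    exact (hg.treeCond_iff i.2 (hlt i)).mpr ((hM.good.exact _).1 hi)
  · rw [h.treeNodes_eq] at hi
    exact (hg.treeCond_iff i.2 (hlt i)).mpr ((hM.good.exact _).1 hi)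
  · rw [h.treeNodes_eq]
    exact (hM.good.exact _).2 hb ((hg.treeCond_iff i.2 (hlt i)).mp hi)

/-- The fast update operation on a stored graph. -/
theorem spec_fastUpdate_stored {D : List (ℕ × ℕ)} (ht : IsText t) (hα : 2 ≤ α) (hc : dollar < c)
    (hct : IsText (c :: t)) (hD : IsDBWT t D) (hbal : Balanced α t D)
    (hn : ∃ i : ℕ, (∃ r, D[i]? = some r ∧ r.1 = dollar) ∧
      ((∃ r, 0 < i ∧ D[i - 1]? = some r ∧ r.1 = c) ∨ (∃ r, D[i + 1]? = some r ∧ r.1 = c)))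
    (h : Stores α m t D S) :
    Spec (fastUpdate α c) S (200 * α) 200 (fun _ S' => ∃ D', IsDBWT (c :: t) D' ∧
      Balanced (2 * α + 1) (c :: t) D' ∧ {i | HeavyU α (c :: t) D' i}.ncard ≤ 2 ∧
      {i | HeavyV α (c :: t) D' i}.ncard ≤ 2 ∧ Stores α m (c :: t) D' S' ∧
      (StoresAll α m t D S → StoresAll α m (c :: t) D' S')) := by
  obtain ⟨node, hs, htree⟩ := h
  obtain ⟨M, hM, hg, hT, hf, rfl, hus⟩ := exists_model ht hD hs
  have hlen : M.labels.length = M.us.length := length_labels _ _ _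
  have hlt : ∀ i : Fin M.labels.length, (i : ℕ) < M.us.length := fun i => hlen ▸ i.2
  have hnode : ∀ i : Fin M.labels.length, node i = M.us[(i : ℕ)]'(hlt i) := by
    intro i
    simp [hus]
  have hex : ∀ x ∈ M.us, ∃ i : Fin M.labels.length, M.us[(i : ℕ)]'(hlt i) = x := by
    intro x hx
    obtain ⟨i, hi, rfl⟩ := List.getElem_of_mem hx
    exact ⟨⟨i, hlen ▸ hi⟩, rfl⟩
  -- The parameter of `Exact` is the hypothesis that the input tree is complete, so both claims
  -- about the B-tree come out of one argument.
  have hE : Exact (StoresAll α m t M.labels S) M := by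
    intro z
    constructor
    · intro hz
      obtain ⟨i, rfl⟩ := hex z (hT.treeNodes_mem hg hz)
      rw [← hM.treeNodes_eq, ← hnode] at hz
      exact (hg.treeCond_iff i.2 (hlt i)).mp (htree i hz)
    · rintro ⟨node', hs', htree'⟩ hz
      -- The order maintenance structure lists the addresses in the order of `U`, so the memory
      -- determines the assignment of addresses.
      obtain rfl : node' = node := List.ofFn_injective (hs'.order_eq.symm.trans hs.order_eq)
      obtain ⟨i, rfl⟩ := hex z (hg.mem_of_nodeCond hz)
      rw [← hM.treeNodes_eq, ← hnode]
      exact (htree' i).mpr ((hg.treeCond_iff i.2 (hlt i)).mpr hz)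
  refine (spec_fastUpdate hM ⟨hg, hT, hf, hE⟩ ht hc hα (hg.exists_neighbour hn) ?_ ?_ ?_ ?_).mono
    le_rfl le_rfl ?_
  · intro v hv
    obtain ⟨i, rfl⟩ := hex v hv
    exact not_le.mp fun hle => (hbal i).1 ((hg.heavyU_iff ht hf α i (hlt i)).mpr hle)
  · intro v hv
    obtain ⟨i, rfl⟩ := hex v hv
    exact not_le.mp fun hle => (hbal i).2 ((hg.heavyV_iff ht hf α i (hlt i)).mpr hle)
  -- The input is `α`-balanced, so its arrays of heavy nodes are empty and the output arrays contain
  -- exactly what the checks append.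
  · rw [← hM.heavyU, List.eq_nil_iff_forall_not_mem]
    intro x hx
    obtain ⟨i, hi, -⟩ := (hs.heavyU_mem x).mp hx
    exact (hbal i).1 hi
  · rw [← hM.heavyV, List.eq_nil_iff_forall_not_mem]
    intro x hx
    obtain ⟨i, hi, -⟩ := (hs.heavyV_mem x).mp hx
    exact (hbal i).2 hi
  · rintro _ S' ⟨M', hM', hU⟩
    exact hU.stored hM' hct

end

end RComp

theorem mainTheorem5 :
    ∃ C : ℕ, ∀ (α m : ℕ), 2 ≤ α → 2 ≤ m →
      ∀ (T : List ℕ), RComp.IsText T →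
      ∀ (δ : ℕ), 1 ≤ δ → δ < T.length →
      ∀ (c : ℕ), T[T.length - δ - 1]? = some c →
      ∀ (D : List (ℕ × ℕ)),
        RComp.IsDBWT (RComp.suffixOfLength T δ) D →
        RComp.Balanced α (RComp.suffixOfLength T δ) D →
        (∃ i : ℕ, (∃ r, D[i]? = some r ∧ r.1 = RComp.dollar) ∧
          ((∃ r, 0 < i ∧ D[i - 1]? = some r ∧ r.1 = c) ∨
            (∃ r, D[i + 1]? = some r ∧ r.1 = c))) →
      ∀ (S : RComp.State), RComp.Stores α m (RComp.suffixOfLength T δ) D S →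
        -- running time
        (RComp.fastUpdate α c S).steps ≤ C * α ∧
        (RComp.fastUpdate α c S).orderCalls ≤ C ∧
        -- output
        ∃ D' : List (ℕ × ℕ),
          RComp.IsDBWT (RComp.suffixOfLength T (δ + 1)) D' ∧
          RComp.Balanced (2 * α + 1) (RComp.suffixOfLength T (δ + 1)) D' ∧
          {i | RComp.HeavyU α (RComp.suffixOfLength T (δ + 1)) D' i}.ncard ≤ 2 ∧
          {i | RComp.HeavyV α (RComp.suffixOfLength T (δ + 1)) D' i}.ncard ≤ 2 ∧
          -- the output graph, with a B-tree that satisfies the invariant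
          RComp.Stores α m (RComp.suffixOfLength T (δ + 1)) D' (RComp.fastUpdate α c S).st ∧
          (RComp.StoresAll α m (RComp.suffixOfLength T δ) D S →
            RComp.StoresAll α m (RComp.suffixOfLength T (δ + 1)) D'
              (RComp.fastUpdate α c S).st) := by
  refine ⟨200, ?_⟩
  intro α m hα _ T hT δ h1 h2 c hc D hD hbal hn S hS
  have hsuc := RComp.suffixOfLength_succ h2 hc
  have hct := hT.drop (Nat.le_add_left 1 δ)
  rw [hsuc] at hct ⊢
  exact RComp.spec_fastUpdate_stored (hT.drop h1) hα (hT.dollar_lt h1 h2 hc) hct hD hbal hn hS
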